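/- Let $D\ge 0$ be the space-time dimension (the gauge theory of interest has $D=4$), let $N$ be the number of gauge indices, and let $A_\mu\colon\mathbb R^D\to\mathbb C^{N\times N}$ ($\mu=1,\dots,D$) be smooth and Hermitian-matrix valued (an external gauge field in the fundamental representation). Let $D_\mu=\partial_\mu-iA_\mu$ be the covariant derivative, and let $U(w,x)=\mathrm{Pexp}\bigl(i\int_{x\to w}A_\mu\,dz^\mu\bigr)$ be the path-ordered exponential along the straight segment from $x$ to $w$ (with $A(w)$ on the left). Fields carry a gauge index and a spinor (or other internal) index. Operators $\hat X$ are given by matrices of distributions $\langle u|\hat X|v\rangle$ on $\mathbb R^D\times\mathbb R^D$. The generalized Wigner transform of $\hat X$ is $$X_W(x,p)=\int dy\,e^{ip\cdot y}\,U(x,x-\tfrac y2)\,\langle x-\tfrac y2|\hat X|x+\tfrac y2\rangle\,U(x+\tfrac y2,x),$$ a generalized function of $(x,p)$, understood through its pairing with the test functions $\Phi(x,p)=(2\pi)^{-D}\int e^{-ip\cdot y}g(x,y)\,dy$, $g\in C_c^\infty(\mathbb R^D\times\mathbb R^D)$. The generalized star product of Weyl symbols is defined by $X_W\bigstar Y_W=(\hat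 X\hat Y)_W$, for operators such that $\hat Y$ maps test functions to test functions: for $h\in C_c^\infty(\mathbb R^D\times\mathbb R^D)$, $(u,w)\mapsto\int\langle w|\hat Y|v\rangle h(u,v)\,dv$ is again in $C_c^\infty$. Let $$\hat Q=Q(x,-iD)=\sum_{n,m\ge0} f^{\mu_1\dots\mu_m}_{\nu_1\dots\nu_n}\bigl(x^{\nu_1}\cdots x^{\nu_n}D_{\mu_1}\cdots D_{\mu_m}+\text{all permutations}\bigr),$$ where the $f$ are constant matrices in spinor space (the sum over all $(n+m)!$ orderings of the factors, and over repeated indices, is understood), $f$ vanishes for $m$ larger than some $M$, and the series converges absolutely for all $x$, in the sense that $\sum_{n,m,\nu,\mu}(n+m)!\,R^n\,\|f^{\mu_1\dots\mu_m}_{\nu_1\dots\nu_n}\|<\infty$ for every $R>0$. Let $Q(x,p)$ be the function obtained from the same expression by replacing $D_\mu$ by the commuting variable $ip_\mu$ (acting as the identity on gauge indices). Let $\hat G=\hat Q^{-1}$ be a Green function of $\hat Q$: an operator with $\hat G\hat Q=1$ and $\hat Q\hat G=1$, that is, for all $h\in C_c^\infty(\mathbb R^D\times\mathbb R^D)$ and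 all matrix components, $\int\!\!\int G(u,w)\,(\hat Q_w h)(u,w)\,du\,dw=\int h(u,u)\,du$, and likewise with $\hat Q$ acting on the first variable of $G$ (by transposition). Then the Wigner transform $G_W$ of $\hat G$ satisfies the generalized Groenewold equation $$G_W(x,p)\bigstar Q(x,p)=1 .$$ In particular the star product of $G_W$ with the function $Q(x,p)$ is defined. -/

import Mathlib

open scoped Distributions Kronecker

noncomputable section

namespace GaugeWigner

/-- Euclidean space-time `ℝ^D`. -/
abbrev E (D : ℕ) := EuclideanSpace ℝ (Fin D)

/-- Smooth compactly supported functions `h(u, v)` on `ℝ^D × ℝ^D`. -/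
abbrev Test2 (D : ℕ) := 𝓓((⊤ : TopologicalSpace.Opens (E D × E D)), ℂ)

/-- Smooth compactly supported functions on `ℝ^D`. -/
abbrev Test1 (D : ℕ) := 𝓓((⊤ : TopologicalSpace.Opens (E D)), ℂ)

open Classical in
/-- A function on `ℝ^D × ℝ^D`, seen as a test function. It is only meant for functions that are
smooth with compact support (other functions are sent to `0`). -/
def toTest {D : ℕ} (h : E D × E D → ℂ) : Test2 D :=
  if H : ContDiff ℝ ((⊤ : ℕ∞) : WithTop ℕ∞) h ∧ HasCompactSupport h then
    ⟨h, H.1, H.2, fun _ _ => trivial⟩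
  else 0

/-- Multiplet-valued functions `ψ : ℝ^D → ℂ^ι ⊗ ℂ^σ`, where `ι` is the set of gauge indices (the
fundamental representation) and `σ` the set of spinor and other internal indices. -/
abbrev Field (D : ℕ) (ι σ : Type*) := E D → (ι × σ → ℂ)

/-- An operator `X̂`, given by its matrix elements `⟨u|X̂|v⟩`: a matrix, in the gauge and spinor
indices, of distributions on `ℝ^D × ℝ^D`. -/
abbrev Kernel (D : ℕ) (ι σ : Type*) := ι × σ → ι × σ → (Test2 D →L[ℂ] ℂ)

/-! ### Parallel transport -/

section Wilson

variable {D : ℕ} {ι : Type*} [Fintype ι] [DecidableEq ι]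

/-- Terms of the path-ordered exponential along `t ↦ x + t (w - x)`: the `n`-th one is the integral
of `(i Ȧ)(s_n) ⋯ (i Ȧ)(s_1)` over `0 ≤ s_1 ≤ ⋯ ≤ s_n ≤ t`, where
`Ȧ(s) = ∑_μ (w - x)^μ A_μ(x + s (w - x))`. -/
def wilsonTerm (A : Fin D → E D → Matrix ι ι ℂ) (w x : E D) : ℕ → ℝ → Matrix ι ι ℂ
  | 0 => fun _ => 1
  | n + 1 => fun t => Matrix.of fun i j => ∫ s in (0 : ℝ)..t,
      ((Complex.I • ∑ μ, (((w - x) μ : ℝ) : ℂ) • A μ (x + s • (w - x)))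
        * wilsonTerm A w x n s) i j

/-- `U(w, x) = Pexp (i ∫_{x → w} A)` along the straight segment from `x` to `w`; `A(w)` stands on
the left, `A(x)` on the right. -/
def wilson (A : Fin D → E D → Matrix ι ι ℂ) (w x : E D) : Matrix ι ι ℂ :=
  ∑' n, wilsonTerm A w x n 1

end Wilson

/-! ### Symbols and the generalized Wigner transform -/

/-- Test functions on phase space: the functions `Φ(x, p) = (2π)^{-D} ∫ e^{-ip·y} g(x, y) dy`, with
`g` smooth and compactly supported. -/
def PhaseTest (D : ℕ) :=
  {Φ : E D → E D → ℂ // ∃ g : Test2 D, ∀ x p, Φ x p = (((2 * Real.pi) ^ D : ℝ) : ℂ)⁻¹ *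
    ∫ y : E D, Complex.exp (-(Complex.I * ((inner ℝ p y : ℝ) : ℂ))) * g (x, y)}

/-- Generalized matrix-valued functions of `(x, p)`, given by their pairings
`∫∫ a(x, p) Φ(x, p) dx dp` with the test functions `Φ`. -/
abbrev Symbol (D : ℕ) (ι σ : Type*) := PhaseTest D → Matrix (ι × σ) (ι × σ) ℂ

/-- An ordinary function of `(x, p)`, seen as a generalized function. -/
def ofFun {D : ℕ} {ι σ : Type*} (q : E D → E D → Matrix (ι × σ) (ι × σ) ℂ) : Symbol D ι σ :=
  fun Φ => Matrix.of fun a b => ∫ z : E D × E D, q z.1 z.2 a b * Φ.1 z.1 z.2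

/-- `∫ e^{ip·y} Φ(x, p) dp`. -/
def fourierP {D : ℕ} (Φ : PhaseTest D) (x y : E D) : ℂ :=
  ∫ p : E D, Complex.exp (Complex.I * ((inner ℝ p y : ℝ) : ℂ)) * Φ.1 x p

section Calculus

variable {D : ℕ} {ι σ : Type*} [Fintype ι] [DecidableEq ι] [Fintype σ] [DecidableEq σ]

/-- The generalized Wigner transform
`X_W(x, p) = ∫ dy e^{ip·y} U(x, x - y/2) ⟨x - y/2|X̂|x + y/2⟩ U(x + y/2, x)`,
paired with `Φ(x, p)` and written in the variables `u = x - y/2`, `v = x + y/2`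
(a change of variables with Jacobian `1`). -/
def wigner (A : Fin D → E D → Matrix ι ι ℂ) (X : Kernel D ι σ) : Symbol D ι σ :=
  fun Φ => Matrix.of fun a b => ∑ c, ∑ d, X c d (toTest fun z : E D × E D =>
    (wilson A ((1 / 2 : ℝ) • (z.1 + z.2)) z.1 ⊗ₖ (1 : Matrix σ σ ℂ)) a c
      * fourierP Φ ((1 / 2 : ℝ) • (z.1 + z.2)) (z.2 - z.1)
      * (wilson A z.2 ((1 / 2 : ℝ) • (z.1 + z.2)) ⊗ₖ (1 : Matrix σ σ ℂ)) d b)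

/-- `Ẑ = X̂ Ŷ`, that is `⟨u|Ẑ|v⟩ = ∫ ⟨u|X̂|w⟩ ⟨w|Ŷ|v⟩ dw`, where `Ŷ` maps test functions to test
functions: for every test function `h` the function
`(T h)(u, w) = ∫ ⟨w|Ŷ|v⟩ h(u, v) dv` is a test function, and `Ẑ(h) = X̂(T h)`. -/
def IsProduct (X Y Z : Kernel D ι σ) : Prop :=
  ∃ T : Test2 D → ι × σ → ι × σ → Test2 D,
    (∀ (h : Test2 D) (u : E D) (χ : Test1 D) (c d : ι × σ),
      Y c d (toTest fun z : E D × E D => χ z.1 * h (u, z.2)) = ∫ w : E D, χ w * T h c d (u, w)) ∧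
    ∀ (h : Test2 D) (a d : ι × σ), Z a d h = ∑ c, X a c (T h c d)

/-- `c` is the Weyl symbol of the product of operators whose Weyl symbols are `a` and `b`. -/
def IsStarProduct (A : Fin D → E D → Matrix ι ι ℂ) (a b c : Symbol D ι σ) : Prop :=
  ∃ X Y Z : Kernel D ι σ,
    wigner A X = a ∧ wigner A Y = b ∧ IsProduct X Y Z ∧ wigner A Z = c

open Classical in
/-- The generalized star product `a ★ b` (with value `0` where it is not defined). -/
def starProd (A : Fin D → E D → Matrix ι ι ℂ) (a b : Symbol D ι σ) : Symbol D ι σ :=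
  if h : ∃ c, IsStarProduct A a b c then h.choose else 0

/-! ### The Dirac operator and its Green function -/

/-- The product, in the order prescribed by the permutation `s`, of the `n + m` factors
`x^{ν_1}, …, x^{ν_n}, D_{μ_1}, …, D_{μ_m}`. -/
def orderedWord {M : Type*} [Monoid M] (x P : Fin D → M) {n m : ℕ} (ν : Fin n → Fin D)
    (μ : Fin m → Fin D) (s : Equiv.Perm (Fin (n + m))) : M :=
  (List.ofFn fun i => Fin.append (x ∘ ν) (P ∘ μ) (s i)).prod

/-- Coefficients `f^{μ_1 … μ_m}_{ν_1 … ν_n}`: matrices in the spinor indices. -/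
abbrev Coeffs (D : ℕ) (σ : Type*) :=
  (n m : ℕ) → (Fin n → Fin D) → (Fin m → Fin D) → Matrix σ σ ℂ

/-- Multiplication by the coordinate `x^ν`. -/
def mulX (ν : Fin D) : Function.End (Field D ι σ) :=
  fun ψ x => ((x ν : ℝ) : ℂ) • ψ x

/-- The covariant derivative `D_μ = ∂_μ - i A_μ`. -/
def covD (A : Fin D → E D → Matrix ι ι ℂ) (μ : Fin D) : Function.End (Field D ι σ) :=
  fun ψ x => fderiv ℝ ψ x (EuclideanSpace.single μ 1)
    - Complex.I • (A μ x ⊗ₖ (1 : Matrix σ σ ℂ)).mulVec (ψ x)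

/-- The formal transpose `-∂_μ - i A_μᵀ` of the covariant derivative. -/
def covDT (A : Fin D → E D → Matrix ι ι ℂ) (μ : Fin D) : Function.End (Field D ι σ) :=
  fun ψ x => -fderiv ℝ ψ x (EuclideanSpace.single μ 1)
    - Complex.I • ((A μ x).transpose ⊗ₖ (1 : Matrix σ σ ℂ)).mulVec (ψ x)

/-- `∑_{n,m} f^{μ_1 … μ_m}_{ν_1 … ν_n} (x^{ν_1} ⋯ x^{ν_n} P_{μ_1} ⋯ P_{μ_m} + all permutations)`
acting on functions. -/
def weylOrdered (f : Coeffs D σ) (P : Fin D → Function.End (Field D ι σ))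
    (ψ : Field D ι σ) : Field D ι σ :=
  fun x => ∑' k : ℕ × ℕ, ∑ ν, ∑ μ, ∑ s : Equiv.Perm (Fin (k.1 + k.2)),
    ((1 : Matrix ι ι ℂ) ⊗ₖ f k.1 k.2 ν μ).mulVec (orderedWord mulX P ν μ s ψ x)

/-- The operator `Q̂ = Q(x, -iD)`. -/
def diracOp (A : Fin D → E D → Matrix ι ι ℂ) (f : Coeffs D σ) : Field D ι σ → Field D ι σ :=
  weylOrdered f (covD A)

/-- The formal transpose of `Q̂`: `∫ (Q̂ᵀ φ) · ψ = ∫ φ · (Q̂ ψ)`. Transposition reverses the order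
of the factors, which only permutes the terms of the symmetrization. -/
def diracOpT (A : Fin D → E D → Matrix ι ι ℂ) (f : Coeffs D σ) : Field D ι σ → Field D ι σ :=
  weylOrdered (fun n m ν μ => (f n m ν μ).transpose) (covDT A)

/-- The function `Q(x, p)`: the same expression with commuting variables, `-iD` being replaced by
`p`, that is `D` by `ip`. -/
def diracSymbol (f : Coeffs D σ) (x p : E D) : Matrix σ σ ℂ :=
  ∑' k : ℕ × ℕ, ∑ ν, ∑ μ, ∑ s : Equiv.Perm (Fin (k.1 + k.2)),
    (orderedWord (fun ν : Fin D => ((x ν : ℝ) : ℂ)) (fun μ => Complex.I * ((p μ : ℝ) : ℂ)) ν μ s)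
      • f k.1 k.2 ν μ

/-- The matrix elements of the identity operator, `δ(u - v)`, paired with `h`. -/
def deltaPairing (a d : ι × σ) (h : Test2 D) : ℂ :=
  if a = d then ∫ u : E D, h (u, u) else 0

/-- `Ĝ = Q̂⁻¹`, as identities between matrix elements:
`ĜQ̂ = 1`, where `∫ G(u, w) Q(w, v) h(u, v) = ∫ G(u, w) (Q̂_w h)(u, w)`, and
`Q̂Ĝ = 1`, where `∫ Q(u, w) G(w, v) h(u, v) = ∫ G(w, v) (Q̂ᵀ_w h)(w, v)`. -/
def IsGreenFunction (A : Fin D → E D → Matrix ι ι ℂ) (f : Coeffs D σ) (G : Kernel D ι σ) : Prop :=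
  (∀ (h : Test2 D) (a d : ι × σ),
    ∑ c, G a c (toTest fun z : E D × E D =>
      diracOp A f (fun v => Pi.single d (h (z.1, v))) z.2 c) = deltaPairing a d h) ∧
  (∀ (h : Test2 D) (a d : ι × σ),
    ∑ c, G c d (toTest fun z : E D × E D =>
      diracOpT A f (fun u => Pi.single a (h (u, z.2))) z.1 c) = deltaPairing a d h)

/-- Convergence of the series that defines `Q`: finite order in the derivatives, and absolute
convergence for every value of the coordinates (each term counts its `(n + m)!` permutations). -/
def Coeffs.Convergent (f : Coeffs D σ) : Prop :=
  (∃ M : ℕ, ∀ n m ν μ, M < m → f n m ν μ = 0) ∧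
  ∀ R : ℝ, 0 < R → Summable fun k : ℕ × ℕ =>
    ∑ ν, ∑ μ, ∑ a, ∑ b, ((k.1 + k.2).factorial : ℝ) * R ^ k.1 * ‖f k.1 k.2 ν μ a b‖

end Calculus

end GaugeWigner

end

/-! The star product of two symbols is the symbol of the product of the operators behind them. The
equation therefore splits into three facts: `Q(x, p)` is the Weyl symbol of Q̂, ĜQ̂ = 1, and the
identity has symbol 1. The second is the Green function identity. The third holds because U(u, u) =
1 and Fourier inversion at y = 0 recovers g(u, 0). The value of the star product does not depend on
any choice, since the symbol determines the operator (`wigner_injective`: the parallel transports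
are invertible) and a product with Q̂ is determined by its factors (`eq_deltaKernel_of_isProduct`).

The main point is the first fact, `wigner_diracKernel`. By polarization (`sum_perm_prod_ofFn`), a
symmetrized product of letters x, D is an alternating sum of powers L^k with L = a·x + b·D, and its
commuting counterpart is the same sum of powers of a·x + i b·p. It remains to see that L^k has
symbol (a·x + i b·p)^k. Formally, (e^{tL} H)(u) = e^{t a·u + t² a·b/2} U(u, u + tb) H(u + tb). No
exponential of operators is needed: differentiating the right side in t amounts to replacing H by LH
(`hasDerivAt_transported`), so its k-th derivative at 0 is L^k H. For H the test function of the
Wigner transform, the three transports along the line cancel (`sum_spinAct_transported_wignerTest`)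
and only the scalar e^{t a·u + t² a·b/2} g(u + tb/2, tb) is left. Integrating over u and translating
by tb/2 gives ∫ e^{t a·x} g(x, tb) dx, which by Fourier inversion is ∫∫ e^{t(a·x + i b·p)} Φ dx dp
(`expMoment_zero`). Comparing k-th derivatives at t = 0 proves the claim.

Two analytic inputs support this. The path-ordered exponential is smooth in its endpoints
(`contDiff_wilson`), because the Dyson series is a Neumann series, that is, an inverse in a Banach
algebra. The series of Q̂ maps test functions to test functions (`exists_derivBound_diracTerm`): at
most M derivatives are lost, while each x costs only a fixed factor on a compact set, which the
convergence for every R absorbs. -/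

noncomputable section

namespace GaugeWigner

open MeasureTheory Set

/-! ### The Dyson series in a Banach algebra -/

section Dyson

variable {R : Type*} [NormedRing R] [NormedAlgebra ℝ R]

/-- The terms of the Dyson series of the linear equation `Y' = b Y`. -/
def dysonTerm (b : ℝ → R) : ℕ → ℝ → R
  | 0 => fun _ => 1
  | n + 1 => fun t => ∫ s in (0 : ℝ)..t, b s * dysonTerm b n s

/-- The Dyson series, the solution of `Y' = b Y` with `Y 0 = 1`. -/
def dyson (b : ℝ → R) (t : ℝ) : R := ∑' n, dysonTerm b n t

theorem dysonTerm_zero_right (b : ℝ → R) (n : ℕ) : dysonTerm b (n + 1) 0 = 0 := by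
  simp [dysonTerm]

theorem continuous_dysonTerm {b : ℝ → R} (hb : Continuous b) (n : ℕ) :
    Continuous (dysonTerm b n) := by
  induction n with
  | zero => exact continuous_const
  | succ n ih =>
    exact intervalIntegral.continuous_primitive
      (fun _ _ => (hb.mul ih).intervalIntegrable _ _) 0

theorem hasDerivAt_dysonTerm [CompleteSpace R] {b : ℝ → R} (hb : Continuous b) (n : ℕ) (t : ℝ) :
    HasDerivAt (dysonTerm b (n + 1)) (b t * dysonTerm b n t) t := by
  have hc : Continuous fun s => b s * dysonTerm b n s := hb.mul (continuous_dysonTerm hb n)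
  exact intervalIntegral.integral_hasDerivAt_right (hc.intervalIntegrable _ _)
    (hc.stronglyMeasurableAtFilter _ _) hc.continuousAt

/-- Reflecting time turns the equation with generator b(s) into the one with generator -b(-s), so
estimates for negative times follow from those for nonnegative times. -/
theorem dysonTerm_neg (b : ℝ → R) (n : ℕ) (t : ℝ) :
    dysonTerm b n (-t) = dysonTerm (fun s => -b (-s)) n t := by
  induction n generalizing t with
  | zero => rfl
  | succ n ih =>
    simp only [dysonTerm]
    simp only [← ih, neg_mul]
    rw [intervalIntegral.integral_neg,
      intervalIntegral.integral_comp_neg (fun s => b s * dysonTerm b n s), neg_zero,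
      intervalIntegral.integral_symm]

/-- The induction step of the factorial bounds, for the Dyson terms and for the powers of the
Volterra operator alike. -/
theorem integral_mul_pow_div_factorial (C t : ℝ) (n : ℕ) :
    ∫ s in (0 : ℝ)..t, C * ((C * s) ^ n / n.factorial) = (C * t) ^ (n + 1) / (n + 1).factorial := by
  have : ∀ s : ℝ, C * ((C * s) ^ n / n.factorial) = C ^ (n + 1) / n.factorial * s ^ n := by
    intro s; rw [mul_pow]; ring
  simp only [this, intervalIntegral.integral_const_mul, integral_pow]
  rw [Nat.factorial_succ]
  push_cast
  have : (n.factorial : ℝ) ≠ 0 := by positivity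
  rw [mul_pow]
  field_simp
  simp

/-- The n-th term integrates a product of n factors over an ordered simplex of volume t^n/n!. The
factor `‖1‖` is kept because a normed ring need not satisfy ‖1‖ = 1. -/
theorem norm_dysonTerm_le_of_nonneg {b : ℝ → R} {C T : ℝ}
    (hC : ∀ s ∈ Icc 0 T, ‖b s‖ ≤ C) (n : ℕ) {t : ℝ} (ht : t ∈ Icc 0 T) :
    ‖dysonTerm b n t‖ ≤ (C * t) ^ n / n.factorial * ‖(1 : R)‖ := by
  induction n generalizing t with
  | zero => simp [dysonTerm]
  | succ n ih =>
    have hC0 : 0 ≤ C := (norm_nonneg _).trans (hC t ht)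
    have h1 : ‖dysonTerm b (n + 1) t‖ ≤
        ∫ s in (0 : ℝ)..t, C * ((C * s) ^ n / n.factorial) * ‖(1 : R)‖ := by
      refine intervalIntegral.norm_integral_le_of_norm_le ht.1 ?_
        (Continuous.intervalIntegrable (by fun_prop) _ _)
      refine Filter.Eventually.of_forall fun s hs => ?_
      have hs' : s ∈ Icc 0 T := ⟨hs.1.le, hs.2.trans ht.2⟩
      calc ‖b s * dysonTerm b n s‖ ≤ ‖b s‖ * ‖dysonTerm b n s‖ := norm_mul_le _ _
        _ ≤ C * ((C * s) ^ n / n.factorial * ‖(1 : R)‖) :=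
          mul_le_mul (hC s hs') (ih hs') (norm_nonneg _) hC0
        _ = _ := by ring
    rwa [intervalIntegral.integral_mul_const, integral_mul_pow_div_factorial] at h1

theorem norm_dysonTerm_le {b : ℝ → R} {C T : ℝ}
    (hC : ∀ s ∈ Icc (-T) T, ‖b s‖ ≤ C) (n : ℕ) {t : ℝ} (ht : t ∈ Icc (-T) T) :
    ‖dysonTerm b n t‖ ≤ (C * |t|) ^ n / n.factorial * ‖(1 : R)‖ := by
  rcases le_total 0 t with h | h
  · rw [abs_of_nonneg h]
    exact norm_dysonTerm_le_of_nonneg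
      (fun s hs => hC s ⟨by linarith [hs.1, hs.2], hs.2⟩) n ⟨h, ht.2⟩
  · rw [abs_of_nonpos h, ← neg_neg t, dysonTerm_neg, neg_neg]
    refine norm_dysonTerm_le_of_nonneg (T := T) (fun s hs => ?_) n
      ⟨by linarith, by linarith [ht.1]⟩
    rw [norm_neg]
    exact hC _ ⟨by linarith [hs.2], by linarith [hs.1, hs.2]⟩

theorem summable_dysonTerm [CompleteSpace R] {b : ℝ → R} (hb : Continuous b) (t : ℝ) :
    Summable fun n => dysonTerm b n t := by
  obtain ⟨C, hC⟩ := (isCompact_Icc (a := -|t|) (b := |t|)).exists_bound_of_continuousOn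
    hb.continuousOn
  refine .of_norm_bounded ((Real.summable_pow_div_factorial (C * |t|)).mul_right ‖(1 : R)‖)
    fun n => norm_dysonTerm_le hC n ⟨neg_abs_le t, le_abs_self t⟩

theorem dyson_zero (b : ℝ → R) : dyson b 0 = 1 := by
  rw [dyson, tsum_eq_single 0]
  · rfl
  · intro n hn
    obtain ⟨k, rfl⟩ := Nat.exists_eq_succ_of_ne_zero hn
    exact dysonTerm_zero_right b k

/-- Termwise differentiation: the derivative of term n + 1 is b times term n, and these are
dominated uniformly on a bounded interval by an exponential series. -/
theorem hasDerivAt_dyson [CompleteSpace R] {b : ℝ → R} (hb : Continuous b) (t : ℝ) :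
    HasDerivAt (dyson b) (b t * dyson b t) t := by
  set T : ℝ := |t| + 1 with hT
  have hT0 : 0 < T := by positivity
  obtain ⟨C, hC⟩ := (isCompact_Icc (a := -T) (b := T)).exists_bound_of_continuousOn
    hb.continuousOn
  have htT : t ∈ Ioo (-T) T := by
    constructor <;> [linarith [neg_abs_le t]; linarith [le_abs_self t]]
  have hC0 : 0 ≤ C := (norm_nonneg _).trans (hC 0 ⟨by linarith, hT0.le⟩)
  have key := hasDerivAt_tsum_of_isPreconnected
    (u := fun n => C * ((C * T) ^ n / n.factorial * ‖(1 : R)‖))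
    (g := fun n => dysonTerm b (n + 1)) (g' := fun n s => b s * dysonTerm b n s)
    (t := Ioo (-T) T) (y₀ := t) (y := t)
    (((Real.summable_pow_div_factorial (C * T)).mul_right _).mul_left _) isOpen_Ioo
    isPreconnected_Ioo (fun n s _ => hasDerivAt_dysonTerm hb n s) ?_ htT
    ((summable_nat_add_iff 1).2 (summable_dysonTerm hb t)) htT
  · have h2 : dyson b = fun s => 1 + ∑' n, dysonTerm b (n + 1) s := by
      funext s
      rw [dyson, (summable_dysonTerm hb s).tsum_eq_zero_add]
      rfl
    rw [(summable_dysonTerm hb t).tsum_mul_left] at key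
    rw [h2]
    have := key.const_add 1
    rwa [← dyson, show dyson b t = _ from rfl, h2] at this
  · intro n s hs
    have hs' := Ioo_subset_Icc_self hs
    refine (norm_mul_le _ _).trans (mul_le_mul (hC s hs') ?_ (norm_nonneg _) hC0)
    refine (norm_dysonTerm_le hC n hs').trans ?_
    have : |s| ≤ T := abs_le.2 hs'
    gcongr

theorem linearODE_unique {b Y₁ Y₂ : ℝ → R} (hb : Continuous b)
    (h₁ : ∀ t, HasDerivAt Y₁ (b t * Y₁ t) t) (h₂ : ∀ t, HasDerivAt Y₂ (b t * Y₂ t) t)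
    (h0 : Y₁ 0 = Y₂ 0) (t : ℝ) : Y₁ t = Y₂ t := by
  set T : ℝ := |t| + 1 with hT
  obtain ⟨C, hC⟩ := (isCompact_Icc (a := -T) (b := T)).exists_bound_of_continuousOn
    hb.continuousOn
  have hT0 : 0 < T := by positivity
  have htT : t ∈ Ioo (-T) T := by
    constructor <;> [linarith [neg_abs_le t]; linarith [le_abs_self t]]
  refine ODE_solution_unique_of_mem_Ioo (v := fun s y => b s * y) (s := fun _ => univ)
    (K := C.toNNReal) (a := -T) (b := T) (t₀ := 0) (fun s hs => ?_)
    ⟨by linarith, hT0⟩ (fun s _ => ⟨h₁ s, trivial⟩) (fun s _ => ⟨h₂ s, trivial⟩) h0 htT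
  refine LipschitzWith.lipschitzOnWith (LipschitzWith.of_dist_le_mul fun y z => ?_)
  rw [dist_eq_norm, dist_eq_norm, ← mul_sub]
  refine (norm_mul_le _ _).trans (mul_le_mul_of_nonneg_right ?_ (norm_nonneg _))
  exact (hC s (Ioo_subset_Icc_self hs)).trans (Real.le_coe_toNNReal C)

theorem eq_dyson_mul [CompleteSpace R] {b Y : ℝ → R} (hb : Continuous b)
    (h : ∀ t, HasDerivAt Y (b t * Y t) t) (t : ℝ) : Y t = dyson b t * Y 0 := by
  refine linearODE_unique hb h (Y₂ := fun t => dyson b t * Y 0) (fun s => ?_)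
    (by simp [dyson_zero]) t
  simpa [mul_assoc] using (hasDerivAt_dyson hb s).mul_const (Y 0)

end Dyson

end GaugeWigner

end

noncomputable section

namespace GaugeWigner

open MeasureTheory Set
open scoped unitInterval

/-! ### Smooth dependence of the Dyson series on parameters -/

section CurryUnitInterval

variable {F : Type} {G : Type*} [NormedAddCommGroup F] [NormedSpace ℝ F]
  [NormedAddCommGroup G] [NormedSpace ℝ G]

/-- Continuous functions on the unit interval, as a normed space. -/
def CI (G : Type*) [NormedAddCommGroup G] := C(I, G)

namespace CI

instance : NormedAddCommGroup (CI G) := inferInstanceAs (NormedAddCommGroup C(I, G))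

instance : NormedSpace ℝ (CI G) := inferInstanceAs (NormedSpace ℝ C(I, G))

instance [CompleteSpace G] : CompleteSpace (CI G) := inferInstanceAs (CompleteSpace C(I, G))

instance : FunLike (CI G) I G := inferInstanceAs (FunLike C(I, G) I G)

/-- A continuous function on the unit interval, as an element of the normed space. -/
def mk (p : I → G) (hp : Continuous p) : CI G := (⟨p, hp⟩ : C(I, G))

omit [NormedSpace ℝ G] in
@[simp] theorem mk_apply (p : I → G) (hp : Continuous p) (s : I) : mk p hp s = p s := rfl

omit [NormedSpace ℝ G] in
@[ext] theorem ext {p q : CI G} (h : ∀ s, p s = q s) : p = q := ContinuousMap.ext h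

omit [NormedSpace ℝ G] in
@[fun_prop] theorem continuous (p : CI G) : Continuous p := ContinuousMap.continuous p

omit [NormedSpace ℝ G] in
@[simp] theorem add_apply (p q : CI G) (s : I) : (p + q) s = p s + q s := rfl

omit [NormedSpace ℝ G] in
@[simp] theorem sub_apply (p q : CI G) (s : I) : (p - q) s = p s - q s := rfl

@[simp] theorem smul_apply (r : ℝ) (p : CI G) (s : I) : (r • p) s = r • p s := rfl

omit [NormedSpace ℝ G] in
theorem norm_le (p : CI G) {C : ℝ} (hC : 0 ≤ C) : ‖p‖ ≤ C ↔ ∀ s, ‖p s‖ ≤ C :=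
  ContinuousMap.norm_le _ hC

omit [NormedSpace ℝ G] in
theorem norm_apply_le (p : CI G) (s : I) : ‖p s‖ ≤ ‖p‖ := ContinuousMap.norm_coe_le_norm p s

/-- Evaluation at a point. -/
def eval (s : I) : CI G →L[ℝ] G :=
  LinearMap.mkContinuous
    { toFun := fun p => p s
      map_add' := fun _ _ => rfl
      map_smul' := fun _ _ => rfl } 1 fun p => by rw [one_mul]; exact p.norm_apply_le s

end CI

/-- A continuous family of functions on the unit interval. -/
def curryI (g : F × ℝ → G) (hg : Continuous g) (z : F) : CI G :=
  CI.mk (fun s => g (z, s)) (by fun_prop)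

omit [NormedSpace ℝ F] [NormedSpace ℝ G] in
@[simp] theorem curryI_apply (g : F × ℝ → G) (hg : Continuous g) (z : F) (s : I) :
    curryI g hg z s = g (z, s) := rfl

omit [NormedSpace ℝ F] [NormedSpace ℝ G] in
theorem continuous_curryI (g : F × ℝ → G) (hg : Continuous g) : Continuous (curryI g hg) :=
  ContinuousMap.continuous_of_continuous_uncurry (Y := I) (Z := G)
    (fun z => (⟨fun s => g (z, s), by fun_prop⟩ : C(I, G))) (by
    change Continuous fun p : F × I => g (p.1, p.2)
    fun_prop)

/-- Evaluating a continuous family of linear maps at a vector. -/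
def flipI : CI (F →L[ℝ] G) →L[ℝ] (F →L[ℝ] CI G) :=
  LinearMap.mkContinuous₂
    (LinearMap.mk₂ ℝ (fun (c : CI (F →L[ℝ] G)) (v : F) =>
      CI.mk (fun s => c s v) (by fun_prop))
      (fun c d v => by ext; simp) (fun r c v => by ext; simp)
      (fun c v w => by ext; simp) (fun r c v => by ext; simp)) 1 fun c v => by
    rw [one_mul, CI.norm_le _ (by positivity)]
    intro s
    exact ((c s).le_opNorm v).trans
      (mul_le_mul_of_nonneg_right (c.norm_apply_le s) (norm_nonneg _))

@[simp] theorem flipI_apply (c : CI (F →L[ℝ] G)) (v : F) (s : I) : flipI c v s = c s v := rfl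

/-- The remainder must be small uniformly in s. Continuity of the curried g' in the sup norm gives
one radius for all s, and the mean value inequality on that ball does the rest. -/
theorem hasFDerivAt_curryI (g : F × ℝ → G) (hg : Continuous g) (g' : F × ℝ → F →L[ℝ] G)
    (hg' : Continuous g') (h : ∀ z s, HasFDerivAt (fun z => g (z, s)) (g' (z, s)) z) (z : F) :
    HasFDerivAt (curryI g hg) (flipI (curryI g' hg' z)) z := by
  rw [hasFDerivAt_iff_isLittleO, Asymptotics.isLittleO_iff]
  intro ε hε
  obtain ⟨δ, hδ, hball⟩ := Metric.continuousAt_iff.1 (continuous_curryI g' hg').continuousAt ε hε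
  filter_upwards [Metric.ball_mem_nhds z hδ] with x hx
  rw [CI.norm_le _ (by positivity)]
  intro s
  have := (convex_ball z δ).norm_image_sub_le_of_norm_hasFDerivWithin_le' (𝕜 := ℝ)
    (f := fun z => g (z, s)) (f' := fun z => g' (z, s)) (φ := g' (z, s)) (C := ε)
    (fun y _ => (h y s).hasFDerivWithinAt) (fun y hy => ?_) (Metric.mem_ball_self hδ) hx
  · simpa using this
  · have h1 := (hball hy).le
    rw [dist_eq_norm] at h1
    exact ((curryI g' hg' y - curryI g' hg' z).norm_apply_le s).trans h1

/-- The derivative of a curried function is the curried partial derivative followed by the linear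
map `flipI`. The induction changes the target from G to F →L G, hence the generalization over G. -/
theorem contDiff_curryI (n : ℕ) {G : Type*} [NormedAddCommGroup G] [NormedSpace ℝ G]
    (g : F × ℝ → G) (hg : ContDiff ℝ ((⊤ : ℕ∞) : WithTop ℕ∞) g) :
    ContDiff ℝ n (curryI g hg.continuous) := by
  induction n generalizing G with
  | zero => exact contDiff_zero.2 (continuous_curryI g _)
  | succ n ih =>
    set g' : F × ℝ → F →L[ℝ] G :=
      fun p => (fderiv ℝ g p).comp (ContinuousLinearMap.inl ℝ F ℝ) with hg'
    have hg's : ContDiff ℝ ((⊤ : ℕ∞) : WithTop ℕ∞) g' :=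
      (hg.fderiv_right (m := ((⊤ : ℕ∞) : WithTop ℕ∞)) (by simp)).clm_comp contDiff_const
    push_cast
    rw [contDiff_succ_iff_hasFDerivAt]
    refine ⟨fun z => flipI (curryI g' hg's.continuous z),
      (flipI (F := F) (G := G)).contDiff.comp (ih g' hg's), fun z => ?_⟩
    refine hasFDerivAt_curryI g _ g' _ (fun z s => ?_) z
    have h1 : HasFDerivAt (fun z : F => (z, s)) (ContinuousLinearMap.inl ℝ F ℝ) z :=
      hasFDerivAt_prodMk_left z s
    exact ((hg.differentiable (by simp)) (z, s)).hasFDerivAt.comp z h1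

end CurryUnitInterval

/-- A convergent Neumann series is the inverse of 1 - v, and inversion is smooth at units. Only
summability of the powers is required, not ‖v‖ < 1. -/
theorem contDiff_tsum_pow {F 𝔸 : Type*} [NormedAddCommGroup F] [NormedSpace ℝ F] [NormedRing 𝔸]
    [NormedAlgebra ℝ 𝔸] [CompleteSpace 𝔸] {n : ℕ} {v : F → 𝔸}
    (hs : ∀ z, Summable fun k => v z ^ k) (hv : ContDiff ℝ n v) :
    ContDiff ℝ n fun z => ∑' k, v z ^ k := by
  refine contDiff_iff_contDiffAt.2 fun z => ?_
  let u : F → 𝔸ˣ := fun z =>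
    ⟨1 - v z, ∑' k, v z ^ k, (hs z).one_sub_mul_tsum_pow, (hs z).tsum_pow_mul_one_sub⟩
  have h1 : (fun z => ∑' k, v z ^ k) = fun z => Ring.inverse (1 - v z) := by
    funext z
    exact (Ring.inverse_unit (u z)).symm
  rw [h1]
  exact ContDiffAt.comp z (g := Ring.inverse) (contDiffAt_ringInverse ℝ (u z))
    (contDiffAt_const.sub hv.contDiffAt)

/-! ### The Dyson series as the Neumann series of a Volterra operator. -/

section Volterra

variable {R : Type*} [NormedRing R] [NormedAlgebra ℝ R]

/-- The Volterra operator `p ↦ ∫₀ᵗ b p`, as a function of `b`. -/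
def volterra : CI R →L[ℝ] (CI R →L[ℝ] CI R) :=
  have hint : ∀ (b p : CI R) (t : ℝ), IntervalIntegrable
      (IccExtend (zero_le_one (α := ℝ)) fun s => b s * p s) volume 0 t := fun b p t =>
    ((b.continuous.mul p.continuous).Icc_extend').intervalIntegrable _ _
  LinearMap.mkContinuous₂
    (LinearMap.mk₂ ℝ (fun b p : CI R => CI.mk
      (fun t => ∫ s in (0 : ℝ)..t, IccExtend zero_le_one (fun s => b s * p s) s)
      ((intervalIntegral.continuous_primitive
        (fun _ _ => ((b.continuous.mul p.continuous).Icc_extend').intervalIntegrable _ _) 0).comp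
          continuous_subtype_val))
      (fun b c p => by
        ext t
        simp only [CI.mk_apply, CI.add_apply]
        rw [← intervalIntegral.integral_add (hint _ _ _) (hint _ _ _)]
        exact intervalIntegral.integral_congr fun s _ => add_mul _ _ _)
      (fun r b p => by
        ext t
        simp only [CI.mk_apply, CI.smul_apply]
        rw [← intervalIntegral.integral_smul]
        exact intervalIntegral.integral_congr fun s _ => smul_mul_assoc _ _ _)
      (fun b p q => by
        ext t
        simp only [CI.mk_apply, CI.add_apply]
        rw [← intervalIntegral.integral_add (hint _ _ _) (hint _ _ _)]
        exact intervalIntegral.integral_congr fun s _ => mul_add _ _ _)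
      (fun r b p => by
        ext t
        simp only [CI.mk_apply, CI.smul_apply]
        rw [← intervalIntegral.integral_smul]
        exact intervalIntegral.integral_congr fun s _ => mul_smul_comm _ _ _)) 1 fun b p => by
    rw [one_mul, CI.norm_le _ (by positivity)]
    intro t
    refine (intervalIntegral.norm_integral_le_of_norm_le_const (C := ‖b‖ * ‖p‖)
      fun s _ => (norm_mul_le _ _).trans (mul_le_mul (b.norm_apply_le _) (p.norm_apply_le _)
        (norm_nonneg _) (norm_nonneg _))).trans ?_
    rw [sub_zero, abs_of_nonneg t.2.1]
    exact mul_le_of_le_one_right (by positivity) t.2.2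

theorem volterra_apply (b p : CI R) (t : I) :
    volterra b p t = ∫ s in (0 : ℝ)..t, IccExtend zero_le_one (fun s => b s * p s) s := rfl

theorem norm_volterra_pow_apply_le (b p : CI R) (n : ℕ) (t : I) :
    ‖((volterra b) ^ n) p t‖ ≤ (‖b‖ * t) ^ n / n.factorial * ‖p‖ := by
  induction n generalizing t with
  | zero => simpa using p.norm_apply_le t
  | succ n ih =>
    rw [pow_succ', ContinuousLinearMap.mul_def, ContinuousLinearMap.comp_apply, volterra_apply]
    have h1 : ‖∫ s in (0 : ℝ)..t, IccExtend zero_le_one (fun s => b s * (volterra b ^ n) p s) s‖ ≤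
        ∫ s in (0 : ℝ)..t, ‖b‖ * ((‖b‖ * s) ^ n / n.factorial) * ‖p‖ := by
      refine intervalIntegral.norm_integral_le_of_norm_le t.2.1 ?_
        (Continuous.intervalIntegrable (by fun_prop) _ _)
      refine Filter.Eventually.of_forall fun s hs => ?_
      have hs' : s ∈ Icc (0 : ℝ) 1 := ⟨hs.1.le, hs.2.trans t.2.2⟩
      rw [IccExtend_of_mem _ _ hs']
      calc ‖b ⟨s, hs'⟩ * (volterra b ^ n) p ⟨s, hs'⟩‖
          ≤ ‖b ⟨s, hs'⟩‖ * ‖(volterra b ^ n) p ⟨s, hs'⟩‖ := norm_mul_le _ _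
        _ ≤ ‖b‖ * ((‖b‖ * s) ^ n / n.factorial * ‖p‖) :=
          mul_le_mul (b.norm_apply_le _) (ih ⟨s, hs'⟩) (norm_nonneg _) (norm_nonneg _)
        _ = _ := by ring
    rwa [intervalIntegral.integral_mul_const, integral_mul_pow_div_factorial] at h1

theorem norm_volterra_pow_le (b : CI R) (n : ℕ) :
    ‖(volterra b) ^ n‖ ≤ ‖b‖ ^ n / n.factorial := by
  refine ContinuousLinearMap.opNorm_le_bound _ (by positivity) fun p => ?_
  rw [CI.norm_le _ (by positivity)]
  intro t
  refine (norm_volterra_pow_apply_le b p n t).trans ?_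
  have h0 : (0 : ℝ) ≤ t := t.2.1
  have h1 : (t : ℝ) ≤ 1 := t.2.2
  have : ‖b‖ * t ≤ ‖b‖ := mul_le_of_le_one_right (norm_nonneg _) h1
  gcongr

theorem summable_volterra_pow [CompleteSpace R] (b : CI R) :
    Summable fun n => (volterra b) ^ n :=
  .of_norm_bounded (Real.summable_pow_div_factorial ‖b‖) (norm_volterra_pow_le b)

theorem volterra_pow_one_apply (β : ℝ → R) (b : CI R) (hb : ∀ s : I, b s = β s) (n : ℕ)
    (t : I) : (volterra b ^ n) (CI.mk (fun _ => 1) continuous_const) t = dysonTerm β n t := by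
  induction n generalizing t with
  | zero => simp [dysonTerm]
  | succ n ih =>
    rw [pow_succ', ContinuousLinearMap.mul_def, ContinuousLinearMap.comp_apply, volterra_apply]
    refine intervalIntegral.integral_congr fun s hs => ?_
    rw [uIcc_of_le t.2.1] at hs
    have hs' : s ∈ Icc (0 : ℝ) 1 := ⟨hs.1, hs.2.trans t.2.2⟩
    simp only [IccExtend_of_mem _ _ hs', hb, ih]

/-- Evaluation of an operator at the constant function `1` and the endpoint `1`. -/
def evalOneI : (CI R →L[ℝ] CI R) →L[ℝ] R :=
  (CI.eval (1 : I)).comp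
    (ContinuousLinearMap.apply ℝ (CI R) (CI.mk (fun _ => (1 : R)) continuous_const))

theorem dyson_eq_tsum_volterra [CompleteSpace R] (β : ℝ → R) (b : CI R)
    (hb : ∀ s : I, b s = β s) : dyson β 1 = evalOneI (∑' n, volterra b ^ n) := by
  rw [evalOneI.map_tsum (summable_volterra_pow b)]
  exact tsum_congr fun n => (volterra_pow_one_apply β b hb n 1).symm

/-- A composition of smooth maps: parameter to generator in C([0, 1]), generator to Volterra
operator (linear), Neumann series, and evaluation of the resulting operator at the constant 1 and
time 1 (linear). -/
theorem contDiff_dyson {F : Type} [NormedAddCommGroup F] [NormedSpace ℝ F] [CompleteSpace R]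
    (g : F × ℝ → R) (hg : ContDiff ℝ ((⊤ : ℕ∞) : WithTop ℕ∞) g) :
    ContDiff ℝ ((⊤ : ℕ∞) : WithTop ℕ∞) fun z => dyson (fun s => g (z, s)) 1 := by
  have h1 : (fun z => dyson (fun s => g (z, s)) 1) =
      fun z => evalOneI (∑' n, volterra (curryI g hg.continuous z) ^ n) := funext fun z =>
    dyson_eq_tsum_volterra (fun s => g (z, s)) (curryI g hg.continuous z) (fun _ => rfl)
  rw [h1]
  refine contDiff_infty.2 fun n => ?_
  exact evalOneI.contDiff.comp (contDiff_tsum_pow (fun z => summable_volterra_pow _)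
    (volterra.contDiff.comp (contDiff_curryI n g hg)))

end Volterra

end GaugeWigner

end

noncomputable section

namespace GaugeWigner

open MeasureTheory Set

/-! ### The path-ordered exponential along straight segments -/

section Wilson

open scoped Matrix.Norms.Operator

variable {D : ℕ} {ι : Type*} [Fintype ι] [DecidableEq ι]

omit [DecidableEq ι] in
/-- The entry of a matrix, as a continuous linear map. -/
def entryCLM (i j : ι) : Matrix ι ι ℂ →L[ℝ] ℂ :=
  LinearMap.toContinuousLinearMap (Matrix.entryLinearMap ℝ ℂ i j)

theorem contDiff_matrix {F : Type*} [NormedAddCommGroup F] [NormedSpace ℝ F]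
    {n : WithTop ℕ∞} {M : F → Matrix ι ι ℂ} (h : ∀ i j, ContDiff ℝ n fun x => M x i j) :
    ContDiff ℝ n M := by
  have : M = fun x => ∑ i, ∑ j, M x i j • Matrix.single i j (1 : ℂ) := by
    funext x
    conv_lhs => rw [Matrix.matrix_eq_sum_single (M x)]
    simp [Matrix.smul_single]
  rw [this]
  exact ContDiff.sum fun i _ => ContDiff.sum fun j _ => (h i j).smul contDiff_const

omit [DecidableEq ι] in
theorem contDiff_entry {F : Type*} [NormedAddCommGroup F] [NormedSpace ℝ F]
    {n : WithTop ℕ∞} {M : F → Matrix ι ι ℂ} (h : ContDiff ℝ n M) (i j : ι) :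
    ContDiff ℝ n fun x => M x i j :=
  (entryCLM i j).contDiff.comp h

omit [DecidableEq ι] [Fintype ι] in
/-- The contraction `i ∑_μ v^μ A_μ(y)`. -/
def gaugeGen (A : Fin D → E D → Matrix ι ι ℂ) (v y : E D) : Matrix ι ι ℂ :=
  Complex.I • ∑ μ, ((v μ : ℝ) : ℂ) • A μ y

omit [DecidableEq ι] [Fintype ι] in
theorem gaugeGen_smul (A : Fin D → E D → Matrix ι ι ℂ) (r : ℝ) (v y : E D) :
    gaugeGen A (r • v) y = r • gaugeGen A v y := by
  simp only [gaugeGen, PiLp.smul_apply, smul_eq_mul, Complex.ofReal_mul, Finset.smul_sum]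
  refine Finset.sum_congr rfl fun μ _ => ?_
  ext i j
  simp only [Matrix.smul_apply, smul_eq_mul, Complex.real_smul]
  ring

variable {A : Fin D → E D → Matrix ι ι ℂ}

theorem contDiff_gaugeGen
    (hA : ∀ μ i j, ContDiff ℝ ((⊤ : ℕ∞) : WithTop ℕ∞) fun x => A μ x i j) :
    ContDiff ℝ ((⊤ : ℕ∞) : WithTop ℕ∞) fun p : E D × E D => gaugeGen A p.1 p.2 := by
  refine contDiff_matrix fun i j => ?_
  simp only [gaugeGen, Matrix.smul_apply, Matrix.sum_apply, smul_eq_mul]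
  refine contDiff_const.mul (ContDiff.sum fun μ _ => ContDiff.mul ?_ ?_)
  · exact Complex.ofRealCLM.contDiff.comp
      ((EuclideanSpace.proj (𝕜 := ℝ) μ).contDiff.comp contDiff_fst)
  · exact (hA μ i j).comp contDiff_snd

theorem contDiff_gaugeGen_segment
    (hA : ∀ μ i j, ContDiff ℝ ((⊤ : ℕ∞) : WithTop ℕ∞) fun x => A μ x i j) :
    ContDiff ℝ ((⊤ : ℕ∞) : WithTop ℕ∞) fun p : (E D × E D) × ℝ =>
      gaugeGen A (p.1.1 - p.1.2) (p.1.2 + p.2 • (p.1.1 - p.1.2)) := by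
  have h : ContDiff ℝ ((⊤ : ℕ∞) : WithTop ℕ∞) fun p : (E D × E D) × ℝ =>
      ((p.1.1 - p.1.2, p.1.2 + p.2 • (p.1.1 - p.1.2)) : E D × E D) := by
    have h1 : ContDiff ℝ ((⊤ : ℕ∞) : WithTop ℕ∞) fun p : (E D × E D) × ℝ => p.1.1 - p.1.2 :=
      (contDiff_fst.comp contDiff_fst).sub (contDiff_snd.comp contDiff_fst)
    exact h1.prodMk ((contDiff_snd.comp contDiff_fst).add (contDiff_snd.smul h1))
  have h2 := (contDiff_gaugeGen hA).comp h
  exact h2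

theorem continuous_gaugeGen_segment
    (hA : ∀ μ i j, ContDiff ℝ ((⊤ : ℕ∞) : WithTop ℕ∞) fun x => A μ x i j) (w x : E D) :
    Continuous fun s : ℝ => gaugeGen A (w - x) (x + s • (w - x)) :=
  (contDiff_gaugeGen_segment hA).continuous.comp
    (f := fun s : ℝ => (((w, x) : E D × E D), s)) (by fun_prop)

/-- The path-ordered exponential is defined by integrals of entries, the Dyson series by integrals
in the matrix algebra. They agree because taking an entry is a continuous linear map. -/
theorem wilsonTerm_eq_dysonTerm
    (hA : ∀ μ i j, ContDiff ℝ ((⊤ : ℕ∞) : WithTop ℕ∞) fun x => A μ x i j) (w x : E D) (n : ℕ) :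
    wilsonTerm A w x n = dysonTerm (fun s => gaugeGen A (w - x) (x + s • (w - x))) n := by
  induction n with
  | zero => rfl
  | succ n ih =>
    funext t
    ext i j
    have hc : Continuous fun s : ℝ => gaugeGen A (w - x) (x + s • (w - x)) *
        dysonTerm (fun s => gaugeGen A (w - x) (x + s • (w - x))) n s :=
      (continuous_gaugeGen_segment hA w x).mul
        (continuous_dysonTerm (continuous_gaugeGen_segment hA w x) n)
    have := (entryCLM i j).intervalIntegral_comp_comm (hc.intervalIntegrable (μ := volume) 0 t)
    simp only [wilsonTerm, dysonTerm, Matrix.of_apply, ih]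
    exact this

theorem wilson_eq_dyson
    (hA : ∀ μ i j, ContDiff ℝ ((⊤ : ℕ∞) : WithTop ℕ∞) fun x => A μ x i j) (w x : E D) :
    wilson A w x = dyson (fun s => gaugeGen A (w - x) (x + s • (w - x))) 1 := by
  simp only [wilson, dyson, wilsonTerm_eq_dysonTerm hA]
  rfl

theorem contDiff_wilson
    (hA : ∀ μ i j, ContDiff ℝ ((⊤ : ℕ∞) : WithTop ℕ∞) fun x => A μ x i j) :
    ContDiff ℝ ((⊤ : ℕ∞) : WithTop ℕ∞) fun z : E D × E D => wilson A z.1 z.2 := by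
  simp only [wilson_eq_dyson hA]
  exact contDiff_dyson _ (contDiff_gaugeGen_segment hA)

/-- A solution of the transport equation along the segment from `x` to `w` is transported by the
path-ordered exponential. -/
theorem wilson_mul_of_hasDerivAt
    (hA : ∀ μ i j, ContDiff ℝ ((⊤ : ℕ∞) : WithTop ℕ∞) fun x => A μ x i j) {w x : E D}
    {Y : ℝ → Matrix ι ι ℂ}
    (hY : ∀ t, HasDerivAt Y (gaugeGen A (w - x) (x + t • (w - x)) * Y t) t) :
    wilson A w x * Y 0 = Y 1 := by
  rw [wilson_eq_dyson hA]
  exact (eq_dyson_mul (continuous_gaugeGen_segment hA w x) hY 1).symm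

/-- The solution of the transport equation along the line `t ↦ u + t b`. -/
def lineTransport (A : Fin D → E D → Matrix ι ι ℂ) (u b : E D) (t : ℝ) : Matrix ι ι ℂ :=
  dyson (fun s => gaugeGen A b (u + s • b)) t

theorem continuous_gaugeGen_line
    (hA : ∀ μ i j, ContDiff ℝ ((⊤ : ℕ∞) : WithTop ℕ∞) fun x => A μ x i j) (u b : E D) :
    Continuous fun s : ℝ => gaugeGen A b (u + s • b) := by
  simpa using continuous_gaugeGen_segment hA (u + b) u

theorem hasDerivAt_lineTransport
    (hA : ∀ μ i j, ContDiff ℝ ((⊤ : ℕ∞) : WithTop ℕ∞) fun x => A μ x i j) (u b : E D) (t : ℝ) :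
    HasDerivAt (lineTransport A u b) (gaugeGen A b (u + t • b) * lineTransport A u b t) t :=
  hasDerivAt_dyson (continuous_gaugeGen_line hA u b) t

theorem lineTransport_zero (u b : E D) : lineTransport A u b 0 = 1 := dyson_zero _

/-- The segment between two points of a line is an affine reparametrization of a piece of that line,
and the generator is linear in the direction, so the factor t - s produced by the chain rule is the
right one. -/
theorem wilson_mul_lineTransport
    (hA : ∀ μ i j, ContDiff ℝ ((⊤ : ℕ∞) : WithTop ℕ∞) fun x => A μ x i j) (u b : E D) (s t : ℝ) :
    wilson A (u + t • b) (u + s • b) * lineTransport A u b s = lineTransport A u b t := by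
  have h := wilson_mul_of_hasDerivAt hA (w := u + t • b) (x := u + s • b)
    (Y := fun r => lineTransport A u b (s + r * (t - s))) fun r => ?_
  · simpa using h
  · have h1 : HasDerivAt (fun r : ℝ => s + r * (t - s)) (t - s) r := by
      simpa using ((hasDerivAt_id r).mul_const (t - s)).const_add s
    have h2 := (hasDerivAt_lineTransport hA u b (s + r * (t - s))).scomp r h1
    have h3 : u + t • b - (u + s • b) = (t - s) • b := by module
    have h4 : u + s • b + r • (t - s) • b = u + (s + r * (t - s)) • b := by module
    rw [h3, gaugeGen_smul, h4, smul_mul_assoc]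
    exact h2

theorem wilson_line_eq
    (hA : ∀ μ i j, ContDiff ℝ ((⊤ : ℕ∞) : WithTop ℕ∞) fun x => A μ x i j) (u b : E D) (t : ℝ) :
    wilson A (u + t • b) u = lineTransport A u b t := by
  simpa [lineTransport_zero] using wilson_mul_lineTransport hA u b 0 t

theorem wilson_self
    (hA : ∀ μ i j, ContDiff ℝ ((⊤ : ℕ∞) : WithTop ℕ∞) fun x => A μ x i j) (u : E D) :
    wilson A u u = 1 := by
  simpa [lineTransport_zero] using wilson_line_eq hA u 0 0

theorem wilson_mul_wilson_line
    (hA : ∀ μ i j, ContDiff ℝ ((⊤ : ℕ∞) : WithTop ℕ∞) fun x => A μ x i j) (u b : E D) (s t : ℝ) :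
    wilson A (u + t • b) (u + s • b) * wilson A (u + s • b) u = wilson A (u + t • b) u := by
  rw [wilson_line_eq hA, wilson_line_eq hA, wilson_mul_lineTransport hA]

theorem wilson_mul_wilson_symm
    (hA : ∀ μ i j, ContDiff ℝ ((⊤ : ℕ∞) : WithTop ℕ∞) fun x => A μ x i j) (x w : E D) :
    wilson A x w * wilson A w x = 1 := by
  have := wilson_mul_wilson_line hA x (w - x) 1 0
  simpa [wilson_self hA] using this

theorem hasDerivAt_wilson_line
    (hA : ∀ μ i j, ContDiff ℝ ((⊤ : ℕ∞) : WithTop ℕ∞) fun x => A μ x i j) (u b : E D) (t : ℝ) :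
    HasDerivAt (fun t : ℝ => wilson A (u + t • b) u)
      (gaugeGen A b (u + t • b) * wilson A (u + t • b) u) t := by
  simp only [wilson_line_eq hA]
  exact hasDerivAt_lineTransport hA u b t

/-- Obtained by differentiating U(u, w) U(w, u) = 1 along the line. Differentiability of the first
factor comes from the smoothness of U in both endpoints. -/
theorem hasDerivAt_wilson_line_symm
    (hA : ∀ μ i j, ContDiff ℝ ((⊤ : ℕ∞) : WithTop ℕ∞) fun x => A μ x i j) (u b : E D) (t : ℝ) :
    HasDerivAt (fun t : ℝ => wilson A u (u + t • b))
      (-(wilson A u (u + t • b) * gaugeGen A b (u + t • b))) t := by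
  have hd : DifferentiableAt ℝ (fun t : ℝ => wilson A u (u + t • b)) t :=
    (((contDiff_wilson hA).comp (f := fun t : ℝ => ((u, u + t • b) : E D × E D))
      (by fun_prop)).differentiable (by simp)) t
  obtain ⟨W', hW'⟩ : ∃ W', HasDerivAt (fun t : ℝ => wilson A u (u + t • b)) W' t :=
    ⟨_, hd.hasDerivAt⟩
  have h1 := hW'.mul (hasDerivAt_wilson_line hA u b t)
  have h2 : ((fun t : ℝ => wilson A u (u + t • b)) * fun t : ℝ => wilson A (u + t • b) u) =
      fun _ => 1 := funext fun s => wilson_mul_wilson_symm hA _ _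
  rw [h2] at h1
  have h3 := h1.unique (hasDerivAt_const t (1 : Matrix ι ι ℂ))
  have h4 : W' = -(wilson A u (u + t • b) * gaugeGen A b (u + t • b)) := by
    have h5 : W' * wilson A (u + t • b) u * wilson A u (u + t • b) = W' := by
      rw [mul_assoc, wilson_mul_wilson_symm hA, mul_one]
    rw [← h5, eq_neg_of_add_eq_zero_left h3, neg_mul, ← mul_assoc, mul_assoc _ _ (wilson A u _),
      wilson_mul_wilson_symm hA, mul_one]
  rwa [h4] at hW'

/-- Transporting from the midpoint of a segment around the segment and back. -/
theorem wilson_mul_wilson_mul_wilson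
    (hA : ∀ μ i j, ContDiff ℝ ((⊤ : ℕ∞) : WithTop ℕ∞) fun x => A μ x i j) (u b : E D) (s t : ℝ) :
    wilson A (u + s • b) u * (wilson A u (u + t • b) * wilson A (u + t • b) (u + s • b)) = 1 := by
  have h1 := wilson_mul_wilson_line hA u b s t
  have h2 : wilson A u (u + t • b) * wilson A (u + t • b) (u + s • b) =
      wilson A u (u + s • b) := by
    calc _ = wilson A u (u + t • b) * wilson A (u + t • b) (u + s • b) *
          (wilson A (u + s • b) u * wilson A u (u + s • b)) := by
            rw [wilson_mul_wilson_symm hA, mul_one]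
      _ = wilson A u (u + t • b) * (wilson A (u + t • b) (u + s • b) *
          wilson A (u + s • b) u) * wilson A u (u + s • b) := by simp only [mul_assoc]
      _ = _ := by rw [h1, wilson_mul_wilson_symm hA, one_mul]
  rw [h2, wilson_mul_wilson_symm hA]

end Wilson

end GaugeWigner

end

noncomputable section

namespace GaugeWigner

open MeasureTheory Set

/-! ### Ordered words -/

section Words

/-- The product of the letters of a word in two alphabets. -/
def wordProd {α M : Type*} [Monoid M] (X P : α → M) (l : List (α ⊕ α)) : M :=
  (l.map (Sum.elim X P)).prod

theorem wordProd_cons {α M : Type*} [Monoid M] (X P : α → M) (a : α ⊕ α) (l : List (α ⊕ α)) :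
    wordProd X P (a :: l) = Sum.elim X P a * wordProd X P l := by
  simp [wordProd]

/-- The word of which `orderedWord` is the product. -/
def orderedLetters {α : Type*} {n m : ℕ} (ν : Fin n → α) (μ : Fin m → α)
    (s : Equiv.Perm (Fin (n + m))) : List (α ⊕ α) :=
  List.ofFn fun i => Fin.append (Sum.inl ∘ ν) (Sum.inr ∘ μ) (s i)

theorem comp_append {α β : Type*} {n m : ℕ} (F : α → β) (a : Fin n → α) (b : Fin m → α)
    (i : Fin (n + m)) : F (Fin.append a b i) = Fin.append (F ∘ a) (F ∘ b) i := by
  refine Fin.addCases (fun j => ?_) (fun j => ?_) i <;> simp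

theorem orderedWord_eq_wordProd {D : ℕ} {M : Type*} [Monoid M] (x P : Fin D → M) {n m : ℕ}
    (ν : Fin n → Fin D) (μ : Fin m → Fin D) (s : Equiv.Perm (Fin (n + m))) :
    orderedWord x P ν μ s = wordProd x P (orderedLetters ν μ s) := by
  unfold orderedWord wordProd orderedLetters
  rw [List.map_ofFn]
  congr 2
  funext i
  rw [Function.comp_apply, comp_append (Sum.elim x P)]
  rfl

theorem orderedLetters_perm {α : Type*} {n m : ℕ} (ν : Fin n → α) (μ : Fin m → α)
    (s : Equiv.Perm (Fin (n + m))) :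
    (orderedLetters ν μ s).Perm (List.ofFn (Sum.inl ∘ ν) ++ List.ofFn (Sum.inr ∘ μ)) := by
  rw [← List.ofFn_fin_append]
  exact Equiv.Perm.ofFn_comp_perm s _

theorem countP_isRight_orderedLetters {α : Type*} {n m : ℕ} (ν : Fin n → α) (μ : Fin m → α)
    (s : Equiv.Perm (Fin (n + m))) : (orderedLetters ν μ s).countP Sum.isRight = m := by
  rw [(orderedLetters_perm ν μ s).countP_eq, List.countP_append, List.countP_eq_zero.2,
    List.countP_eq_length.2] <;> simp

theorem countP_isLeft_orderedLetters {α : Type*} {n m : ℕ} (ν : Fin n → α) (μ : Fin m → α)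
    (s : Equiv.Perm (Fin (n + m))) : (orderedLetters ν μ s).countP Sum.isLeft = n := by
  rw [(orderedLetters_perm ν μ s).countP_eq, List.countP_append, List.countP_eq_length.2,
    List.countP_eq_zero.2] <;> simp

theorem orderedWord_of_comm {D : ℕ} {M : Type*} [CommMonoid M] (x P : Fin D → M) {n m : ℕ}
    (ν : Fin n → Fin D) (μ : Fin m → Fin D) (s : Equiv.Perm (Fin (n + m))) :
    orderedWord x P ν μ s = (∏ i, x (ν i)) * ∏ i, P (μ i) := by
  rw [orderedWord_eq_wordProd, wordProd,
    ((orderedLetters_perm ν μ s).map (Sum.elim x P)).prod_eq]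
  simp [List.map_ofFn, List.prod_ofFn, Function.comp_def]

/-- The polarization formula for the symmetrized product of noncommuting elements of a ring. -/
theorem sum_perm_prod_ofFn {R : Type*} [Ring R] {k : ℕ} (a : Fin k → R) :
    ∑ s : Equiv.Perm (Fin k), (List.ofFn fun i => a (s i)).prod =
      ∑ C : Finset (Fin k), (-1 : ℤ) ^ C.card • (∑ i ∈ Cᶜ, a i) ^ k := by
  classical
  -- Expanding the power gives the words a(r 0)⋯a(r (k-1)) over all maps r with values in S.
  have hpow : ∀ S : Finset (Fin k), (∑ i ∈ S, a i) ^ k =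
      ∑ r : Fin k → Fin k, if ∀ i, r i ∈ S then (List.ofFn fun i => a (r i)).prod else 0 := by
    intro S
    have h1 := (MultilinearMap.mkPiAlgebraFin ℤ k R).map_sum_finset (fun _ j => a j) fun _ => S
    simp only [MultilinearMap.mkPiAlgebraFin_apply] at h1
    rw [← Finset.sum_filter]
    rw [show (List.ofFn fun _ : Fin k => ∑ j ∈ S, a j).prod = (∑ i ∈ S, a i) ^ k by simp] at h1
    rw [h1]
    refine Finset.sum_congr ?_ fun _ _ => rfl
    ext r
    simp [Fintype.mem_piFinset]
  simp only [hpow, Finset.smul_sum]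
  rw [Finset.sum_comm]
  -- Inclusion-exclusion for a fixed word: the sets C that contribute are those disjoint from the
  -- range of r, and their signs cancel unless r is surjective, hence a permutation.
  have hr : ∀ r : Fin k → Fin k, (∑ C : Finset (Fin k), (-1 : ℤ) ^ C.card •
      (if ∀ i, r i ∈ Cᶜ then (List.ofFn fun i => a (r i)).prod else 0)) =
      if Function.Bijective r then (List.ofFn fun i => a (r i)).prod else 0 := by
    intro r
    have h1 : ∀ C : Finset (Fin k), (∀ i, r i ∈ Cᶜ) ↔ C ∈ (Finset.univ.image r)ᶜ.powerset := by
      intro C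
      simp only [Finset.mem_compl, Finset.mem_powerset, Finset.subset_iff, Finset.mem_image,
        Finset.mem_univ, true_and, not_exists]
      exact ⟨fun h x hx i hi => h i (hi ▸ hx), fun h i hi => h hi i rfl⟩
    simp only [h1, smul_ite, smul_zero]
    rw [← Finset.sum_filter, Finset.filter_mem_eq_inter, Finset.univ_inter, ← Finset.sum_smul,
      Finset.sum_powerset_neg_one_pow_card]
    have h2 : (Finset.univ.image r)ᶜ = ∅ ↔ Function.Bijective r := by
      rw [Finset.compl_eq_empty_iff, ← Finite.surjective_iff_bijective, Finset.eq_univ_iff_forall]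
      simp [Function.Surjective]
    simp only [h2, ite_smul, one_smul, zero_smul]
  simp only [hr]
  rw [← Finset.sum_filter]
  symm
  refine Finset.sum_bij' (fun r hr => Equiv.ofBijective r (Finset.mem_filter.1 hr).2)
    (fun s _ => s) (fun _ _ => Finset.mem_univ _)
    (fun s _ => Finset.mem_filter.2 ⟨Finset.mem_univ _, s.bijective⟩) (fun _ _ => rfl)
    (fun _ _ => Equiv.ext fun _ => rfl) (fun _ _ => rfl)

end Words

/-! ### Bounds on derivatives of first-order operators -/

section Bounds

variable {F V V' : Type*} [NormedAddCommGroup F] [NormedSpace ℝ F]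
  [NormedAddCommGroup V] [NormedSpace ℝ V] [NormedAddCommGroup V'] [NormedSpace ℝ V']

/-- Smooth functions supported in `K` whose derivatives up to order `j` are bounded by `C`. -/
structure DerivBound (K : Set F) (j : ℕ) (C : ℝ) (H : F → V) : Prop where
  contDiff : ContDiff ℝ ((⊤ : ℕ∞) : WithTop ℕ∞) H
  tsupport_subset : tsupport H ⊆ K
  bound : ∀ i ≤ j, ∀ z, ‖iteratedFDeriv ℝ i H z‖ ≤ C

namespace DerivBound

variable {K : Set F} {j : ℕ} {C : ℝ} {H : F → V}

theorem nonneg [Nonempty F] (h : DerivBound K j C H) : 0 ≤ C :=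
  (norm_nonneg _).trans (h.bound 0 (Nat.zero_le _) (Classical.arbitrary F))

theorem of_bound_on (h1 : ContDiff ℝ ((⊤ : ℕ∞) : WithTop ℕ∞) H) (h2 : tsupport H ⊆ K)
    (hC : 0 ≤ C) (h3 : ∀ i ≤ j, ∀ z ∈ K, ‖iteratedFDeriv ℝ i H z‖ ≤ C) : DerivBound K j C H := by
  refine ⟨h1, h2, fun i hi z => ?_⟩
  by_cases hz : z ∈ K
  · exact h3 i hi z hz
  · have : iteratedFDeriv ℝ i H z = 0 := by
      by_contra h
      exact hz (h2 (support_iteratedFDeriv_subset i h))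
    simpa [this] using hC

theorem norm_le (h : DerivBound K j C H) (z : F) : ‖H z‖ ≤ C := by
  simpa using h.bound 0 (Nat.zero_le _) z

theorem eq_zero (h : DerivBound K j C H) {z : F} (hz : z ∉ K) : H z = 0 :=
  image_eq_zero_of_notMem_tsupport fun h' => hz (h.tsupport_subset h')

/-- One order of differentiability is the price of each derivative; this is what the index j keeps
track of. -/
theorem fderiv_apply (h : DerivBound K (j + 1) C H) (e : F) :
    DerivBound K j (‖e‖ * C) fun z => fderiv ℝ H z e := by
  have hd : ContDiff ℝ ((⊤ : ℕ∞) : WithTop ℕ∞) (fderiv ℝ H) :=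
    h.contDiff.fderiv_right (m := ((⊤ : ℕ∞) : WithTop ℕ∞)) (by simp)
  refine ⟨hd.clm_apply contDiff_const, (closure_mono fun z hz => ?_).trans
    ((tsupport_fderiv_subset ℝ).trans h.tsupport_subset), fun i hi z => ?_⟩
  · intro h0
    exact hz (by simp [h0])
  · have h1 := norm_iteratedFDeriv_clm_apply_const (𝕜 := ℝ) (f := fderiv ℝ H) (c := e) (x := z)
      (n := i) (N := ((⊤ : ℕ∞) : WithTop ℕ∞)) hd.contDiffAt (by exact_mod_cast le_top)
    rw [norm_iteratedFDeriv_fderiv] at h1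
    exact h1.trans (mul_le_mul_of_nonneg_left (h.bound _ (by omega) z) (norm_nonneg _))

theorem add {H' : F → V} {C' : ℝ} (h : DerivBound K j C H) (h' : DerivBound K j C' H') :
    DerivBound K j (C + C') fun z => H z + H' z := by
  refine ⟨h.contDiff.add h'.contDiff, (tsupport_add H H').trans
    (union_subset h.tsupport_subset h'.tsupport_subset), fun i hi z => ?_⟩
  have h1 : ContDiff ℝ i H := h.contDiff.of_le (by exact_mod_cast le_top)
  have h2 : ContDiff ℝ i H' := h'.contDiff.of_le (by exact_mod_cast le_top)
  change ‖iteratedFDeriv ℝ i (H + H') z‖ ≤ _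
  rw [iteratedFDeriv_add_apply h1.contDiffAt h2.contDiffAt]
  exact (norm_add_le _ _).trans (add_le_add (h.bound i hi z) (h'.bound i hi z))

theorem sum {κ : Type*} {s : Finset κ} {H : κ → F → V} {C : κ → ℝ}
    (h : ∀ k ∈ s, DerivBound K j (C k) (H k)) :
    DerivBound K j (∑ k ∈ s, C k) fun z => ∑ k ∈ s, H k z := by
  classical
  induction s using Finset.induction_on with
  | empty =>
    simp only [Finset.sum_empty]
    refine ⟨contDiff_const, by simp [tsupport], fun i _ z => ?_⟩
    simp [show (fun _ : F => (0 : V)) = 0 from rfl]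
  | insert k s hk ih =>
    simp only [Finset.sum_insert hk]
    exact (h k (Finset.mem_insert_self _ _)).add
      (ih fun k' hk' => h k' (Finset.mem_insert_of_mem hk'))

theorem mono {C' : ℝ} {j' : ℕ} (h : DerivBound K j C H) (hC : C ≤ C') (hj : j' ≤ j) :
    DerivBound K j' C' H :=
  ⟨h.contDiff, h.tsupport_subset, fun i hi z => (h.bound i (hi.trans hj) z).trans hC⟩

theorem clm_apply (h : DerivBound K j C H) (T : V →L[ℝ] V') {N : ℝ} (hN : ‖T‖ ≤ N) :
    DerivBound K j (N * C) fun z => T (H z) := by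
  refine ⟨T.contDiff.comp h.contDiff, (tsupport_comp_subset (map_zero T) H).trans
    h.tsupport_subset, fun i hi z => ?_⟩
  have := T.norm_iteratedFDeriv_comp_left (N := ((⊤ : ℕ∞) : WithTop ℕ∞))
    (h.contDiff.contDiffAt (x := z)) (n := i) (by exact_mod_cast le_top)
  exact this.trans (mul_le_mul hN (h.bound i hi z) (norm_nonneg _) ((norm_nonneg _).trans hN))

/-- Leibniz rule, with binomial coefficients summing to 2^i. The constant β is fixed before H, C and
j ≤ J, so the estimate can be iterated along words of any length with the same constant for each
letter. -/
theorem exists_bilinear {U : Type*} [NormedAddCommGroup U] [NormedSpace ℝ U]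
    (T : U →L[ℝ] V →L[ℝ] V') (hK : IsCompact K) {b : F → U}
    (hb : ContDiff ℝ ((⊤ : ℕ∞) : WithTop ℕ∞) b) (J : ℕ) :
    ∃ β, 0 ≤ β ∧ ∀ j ≤ J, ∀ (C : ℝ) (H : F → V), 0 ≤ C → DerivBound K j C H →
      DerivBound K j (β * C) fun z => T (b z) (H z) := by
  have h1 : ∀ i, ∃ c, ∀ z ∈ K, ‖iteratedFDeriv ℝ i b z‖ ≤ c := fun i =>
    hK.exists_bound_of_continuousOn
      (hb.continuous_iteratedFDeriv (by exact_mod_cast le_top)).continuousOn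
  choose c hc using h1
  set M : ℝ := ∑ i ∈ Finset.range (J + 1), |c i| with hM
  have hM0 : 0 ≤ M := Finset.sum_nonneg fun i _ => abs_nonneg _
  have hMc : ∀ i ≤ J, ∀ z ∈ K, ‖iteratedFDeriv ℝ i b z‖ ≤ M := fun i hi z hz =>
    (hc i z hz).trans ((le_abs_self _).trans (Finset.single_le_sum (f := fun i => |c i|)
      (fun i _ => abs_nonneg _) (Finset.mem_range.2 (by omega))))
  refine ⟨‖T‖ * (2 ^ J * M), by positivity, fun j hj C H hC h => of_bound_on
    (T.isBoundedBilinearMap.contDiff.comp (hb.prodMk h.contDiff)) ?_ (by positivity)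
    fun i hi z hz => ?_⟩
  · refine (closure_mono fun z hz => ?_).trans h.tsupport_subset
    intro h0
    exact hz (by simp [h0])
  · refine (T.norm_iteratedFDeriv_le_of_bilinear hb h.contDiff z (n := i)
      (by exact_mod_cast le_top)).trans ?_
    rw [mul_assoc]
    refine mul_le_mul_of_nonneg_left ?_ (norm_nonneg T)
    calc ∑ k ∈ Finset.range (i + 1), (i.choose k : ℝ) * ‖iteratedFDeriv ℝ k b z‖ *
          ‖iteratedFDeriv ℝ (i - k) H z‖
        ≤ ∑ k ∈ Finset.range (i + 1), (i.choose k : ℝ) * (M * C) := by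
          refine Finset.sum_le_sum fun k hk => ?_
          rw [mul_assoc]
          have hk' := Finset.mem_range.1 hk
          exact mul_le_mul_of_nonneg_left (mul_le_mul (hMc k (by omega) z hz)
            (h.bound _ (by omega) z) (norm_nonneg _) hM0) (Nat.cast_nonneg _)
      _ = 2 ^ i * (M * C) := by
          rw [← Finset.sum_mul]
          congr 1
          exact_mod_cast Nat.sum_range_choose i
      _ ≤ 2 ^ J * M * C := by
          rw [mul_assoc]
          exact mul_le_mul_of_nonneg_right
            (pow_le_pow_right₀ (by norm_num) (by omega)) (by positivity)

theorem exists_of_hasCompactSupport {H : F → V}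
    (hH : ContDiff ℝ ((⊤ : ℕ∞) : WithTop ℕ∞) H) (hc : HasCompactSupport H) (N : ℕ) :
    ∃ C, DerivBound (tsupport H) N C H := by
  have h1 : ∀ i : ℕ, ∃ c, ∀ z ∈ tsupport H, ‖iteratedFDeriv ℝ i H z‖ ≤ c := fun i =>
    hc.isCompact.exists_bound_of_continuousOn
      (hH.continuous_iteratedFDeriv (by exact_mod_cast le_top)).continuousOn
  choose c hc using h1
  refine ⟨∑ i ∈ Finset.range (N + 1), |c i|, DerivBound.of_bound_on hH Subset.rfl
    (Finset.sum_nonneg fun _ _ => abs_nonneg _) fun i hi z hz => (hc i z hz).trans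
      ((le_abs_self _).trans (Finset.single_le_sum (f := fun i => |c i|)
        (fun _ _ => abs_nonneg _) (Finset.mem_range.2 (by omega))))⟩

end DerivBound

end Bounds

/-! ### First-order operators on smooth functions. -/

section SmoothFn

variable (F V : Type*) [NormedAddCommGroup F] [NormedSpace ℝ F]
  [NormedAddCommGroup V] [NormedSpace ℝ V] [NormedSpace ℂ V] [IsScalarTower ℝ ℂ V]

/-- The space of smooth functions. -/
def smoothFn : Submodule ℂ (F → V) where
  carrier := {H | ContDiff ℝ ((⊤ : ℕ∞) : WithTop ℕ∞) H}
  add_mem' := fun {H _} (h : ContDiff ℝ ((⊤ : ℕ∞) : WithTop ℕ∞) H) h' => ContDiff.add h h'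
  zero_mem' := (contDiff_const : ContDiff ℝ ((⊤ : ℕ∞) : WithTop ℕ∞) fun _ : F => (0 : V))
  smul_mem' := fun c H (h : ContDiff ℝ ((⊤ : ℕ∞) : WithTop ℕ∞) H) => h.const_smul c

variable {F V}

theorem mem_smoothFn {H : F → V} :
    H ∈ smoothFn F V ↔ ContDiff ℝ ((⊤ : ℕ∞) : WithTop ℕ∞) H := Iff.rfl

theorem smoothFn.contDiff (H : smoothFn F V) : ContDiff ℝ ((⊤ : ℕ∞) : WithTop ℕ∞) H.1 :=
  mem_smoothFn.1 H.2

theorem smoothFn.differentiable (H : smoothFn F V) : Differentiable ℝ H.1 :=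
  (smoothFn.contDiff H).differentiable (by simp)

/-- The first-order operator `H ↦ ∂_e H + B H`. -/
def firstOrder (e : F) (B : F → V →L[ℂ] V) (hB : ContDiff ℝ ((⊤ : ℕ∞) : WithTop ℕ∞) B) :
    Module.End ℂ (smoothFn F V) where
  toFun H := ⟨fun z => fderiv ℝ H.1 z e + B z (H.1 z),
    mem_smoothFn.2 <| (((smoothFn.contDiff H).fderiv_right
      (m := ((⊤ : ℕ∞) : WithTop ℕ∞)) (by simp)).clm_apply contDiff_const).add
      (((ContinuousLinearMap.restrictScalarsL ℂ V V ℝ ℝ).contDiff.comp hB).clm_apply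
        (smoothFn.contDiff H))⟩
  map_add' H H' := by
    ext z
    have h1 := smoothFn.differentiable H z
    have h2 := smoothFn.differentiable H' z
    simp only [Submodule.coe_add, Pi.add_apply, map_add, fderiv_add h1 h2,
      _root_.add_apply]
    abel
  map_smul' c H := by
    ext z
    have h1 := smoothFn.differentiable H z
    simp only [Submodule.coe_smul, Pi.smul_apply, map_smul, fderiv_const_smul h1 c,
      _root_.smul_apply, RingHom.id_apply, smul_add]

theorem firstOrder_apply (e : F) (B : F → V →L[ℂ] V)
    (hB : ContDiff ℝ ((⊤ : ℕ∞) : WithTop ℕ∞) B) (H : smoothFn F V) (z : F) :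
    (firstOrder e B hB H).1 z = fderiv ℝ H.1 z e + B z (H.1 z) := rfl

variable {K : Set F}

theorem DerivBound.exists_firstOrder (hK : IsCompact K) (e : F) {B : F → V →L[ℂ] V}
    (hB : ContDiff ℝ ((⊤ : ℕ∞) : WithTop ℕ∞) B) (J : ℕ) :
    ∃ c, 0 ≤ c ∧ ∀ j ≤ J, ∀ (C : ℝ) (H : smoothFn F V), 0 ≤ C → DerivBound K (j + 1) C H.1 →
      DerivBound K j (c * C) (firstOrder e B hB H).1 := by
  obtain ⟨β, hβ, h⟩ := DerivBound.exists_bilinear (V := V)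
    (ContinuousLinearMap.restrictScalarsL ℂ V V ℝ ℝ) hK hB J
  refine ⟨‖e‖ + β, by positivity, fun j hj C H hC hH => ?_⟩
  rw [add_mul]
  exact (hH.fderiv_apply e).add (h j hj C H.1 hC (hH.mono le_rfl (Nat.le_succ j)))

/-- With direction 0 no order of differentiability is lost. This is essential for the letters x,
whose number in a word is unbounded. -/
theorem DerivBound.exists_zeroOrder (hK : IsCompact K) {B : F → V →L[ℂ] V}
    (hB : ContDiff ℝ ((⊤ : ℕ∞) : WithTop ℕ∞) B) (J : ℕ) :
    ∃ c, 0 ≤ c ∧ ∀ j ≤ J, ∀ (C : ℝ) (H : smoothFn F V), 0 ≤ C → DerivBound K j C H.1 →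
      DerivBound K j (c * C) (firstOrder 0 B hB H).1 := by
  obtain ⟨β, hβ, h⟩ := DerivBound.exists_bilinear (V := V)
    (ContinuousLinearMap.restrictScalarsL ℂ V V ℝ ℝ) hK hB J
  refine ⟨β, by positivity, fun j hj C H hC hH => ?_⟩
  have h1 : (firstOrder 0 B hB H).1 = fun z =>
      ContinuousLinearMap.restrictScalarsL ℂ V V ℝ ℝ (B z) (H.1 z) := by
    funext z
    simp [firstOrder_apply]
  rw [h1]
  exact h j hj C H.1 hC hH

/-- A word in operators `X` that preserve and operators `P` that lower the order of
differentiability by one. -/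
theorem DerivBound.wordProd {α : Type*} {X P : α → Module.End ℂ (smoothFn F V)} {J : ℕ}
    {ρ c : ℝ} (hρ : 0 ≤ ρ) (hc : 0 ≤ c)
    (hX : ∀ ν, ∀ j ≤ J, ∀ (C : ℝ) (H : smoothFn F V), 0 ≤ C → DerivBound K j C H.1 →
      DerivBound K j (ρ * C) (X ν H).1)
    (hP : ∀ μ, ∀ j ≤ J, ∀ (C : ℝ) (H : smoothFn F V), 0 ≤ C → DerivBound K (j + 1) C H.1 →
      DerivBound K j (c * C) (P μ H).1)
    {C : ℝ} (hC : 0 ≤ C) {H : smoothFn F V}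
    (l : List (α ⊕ α)) {j : ℕ} (hj : j + l.countP Sum.isRight ≤ J)
    (h : DerivBound K (j + l.countP Sum.isRight) C H.1) :
    DerivBound K j (ρ ^ l.countP Sum.isLeft * c ^ l.countP Sum.isRight * C)
      (GaugeWigner.wordProd X P l H).1 := by
  induction l generalizing j with
  | nil => simpa [GaugeWigner.wordProd] using h
  | cons a l ih =>
    cases a with
    | inl ν =>
      simp only [List.countP_cons, Sum.isRight_inl, Sum.isLeft_inl, if_true, Bool.false_eq_true,
        if_false, add_zero] at h hj ⊢
      have h1 := hX ν j (by omega) _ _ (by positivity) (ih hj h)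
      rw [pow_succ']
      rw [wordProd_cons, Module.End.mul_apply, Sum.elim_inl]
      convert h1 using 1
      ring
    | inr μ =>
      simp only [List.countP_cons, Sum.isRight_inr, Sum.isLeft_inr, if_true, Bool.false_eq_true,
        if_false, add_zero] at h hj ⊢
      have h1 := hP μ j (by omega) _ _ (by positivity)
        (ih (j := j + 1) (by omega) (by convert h using 1; omega))
      rw [pow_succ']
      rw [wordProd_cons, Module.End.mul_apply, Sum.elim_inr]
      convert h1 using 1
      ring

end SmoothFn

end GaugeWigner

end

noncomputable section

namespace GaugeWigner

open MeasureTheory Set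

/-! ### The operators `x` and `D` on two-point functions -/

section TwoPoint

open scoped Matrix.Norms.Operator

variable {D : ℕ} {ι σ : Type*} [Fintype ι] [DecidableEq ι] [Fintype σ] [DecidableEq σ]

omit [DecidableEq ι] in
variable (σ) in
/-- The action of a gauge matrix on multiplets. -/
def gaugeAct : Matrix ι ι ℂ →ₗ[ℝ] ((ι × σ → ℂ) →L[ℂ] (ι × σ → ℂ)) where
  toFun M := LinearMap.toContinuousLinearMap (Matrix.mulVecLin (M ⊗ₖ (1 : Matrix σ σ ℂ)))
  map_add' M N := by
    ext v : 1
    simp [Matrix.add_kronecker]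
  map_smul' r M := by
    ext v : 1
    simp [Matrix.smul_kronecker]

omit [DecidableEq ι] in
theorem gaugeAct_apply (M : Matrix ι ι ℂ) (v : ι × σ → ℂ) :
    gaugeAct σ M v = (M ⊗ₖ (1 : Matrix σ σ ℂ)).mulVec v := rfl

omit [DecidableEq σ] in
/-- The action of a spinor matrix on multiplets. -/
def spinAct (M : Matrix σ σ ℂ) : (ι × σ → ℂ) →L[ℝ] (ι × σ → ℂ) :=
  LinearMap.toContinuousLinearMap ((Matrix.mulVecLin ((1 : Matrix ι ι ℂ) ⊗ₖ M)).restrictScalars ℝ)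

omit [DecidableEq σ] in
theorem spinAct_apply (M : Matrix σ σ ℂ) (v : ι × σ → ℂ) :
    spinAct M v = ((1 : Matrix ι ι ℂ) ⊗ₖ M).mulVec v := rfl

omit [DecidableEq σ] in
theorem norm_spinAct_le (M : Matrix σ σ ℂ) :
    ‖(spinAct M : (ι × σ → ℂ) →L[ℝ] (ι × σ → ℂ))‖ ≤ ∑ a, ∑ b, ‖M a b‖ := by
  refine ContinuousLinearMap.opNorm_le_bound _ (by positivity) fun v => ?_
  refine (pi_norm_le_iff_of_nonneg (by positivity)).2 fun ⟨i, a⟩ => ?_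
  have h1 : spinAct M v (i, a) = ∑ b, M a b * v (i, b) := by
    rw [spinAct_apply, Matrix.mulVec, dotProduct, Fintype.sum_prod_type,
      Finset.sum_eq_single i]
    · simp [Matrix.kroneckerMap_apply]
    · intro j _ hj
      simp [Matrix.kroneckerMap_apply, Matrix.one_apply_ne' hj]
    · simp
  rw [h1, Finset.sum_mul]
  calc ‖∑ b, M a b * v (i, b)‖ ≤ ∑ b, ‖M a b‖ * ‖v‖ :=
        norm_sum_le_of_le _ fun b _ => by
          rw [norm_mul]
          exact mul_le_mul_of_nonneg_left (norm_le_pi_norm v _) (norm_nonneg _)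
    _ = (∑ b, ‖M a b‖) * ‖v‖ := (Finset.sum_mul ..).symm
    _ ≤ _ := Finset.single_le_sum (f := fun a => (∑ b, ‖M a b‖) * ‖v‖)
        (fun a _ => by positivity) (Finset.mem_univ a)

variable (A : Fin D → E D → Matrix ι ι ℂ)

/-- The multiplication operator in `a·x + b·D`. -/
def linCoeff (σ : Type*) [Fintype σ] [DecidableEq σ] (v : E D × E D) (z : E D × E D) :
    (ι × σ → ℂ) →L[ℂ] (ι × σ → ℂ) :=
  (inner ℝ v.1 z.2 : ℝ) • ContinuousLinearMap.id ℂ (ι × σ → ℂ) - gaugeAct σ (gaugeGen A v.2 z.2)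

variable {A}

theorem contDiff_linCoeff
    (hA : ∀ μ i j, ContDiff ℝ ((⊤ : ℕ∞) : WithTop ℕ∞) fun x => A μ x i j) (v : E D × E D) :
    ContDiff ℝ ((⊤ : ℕ∞) : WithTop ℕ∞) (linCoeff A σ v) := by
  have h1 : ContDiff ℝ ((⊤ : ℕ∞) : WithTop ℕ∞) fun z : E D × E D => gaugeGen A v.2 z.2 := by
    have h2 := (contDiff_gaugeGen hA).comp
      ((contDiff_const (c := v.2)).prodMk (contDiff_snd (E := E D) (F := E D)))
    exact h2
  have h3 : ContDiff ℝ ((⊤ : ℕ∞) : WithTop ℕ∞)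
      fun z : E D × E D => gaugeAct σ (gaugeGen A v.2 z.2) :=
    (LinearMap.toContinuousLinearMap (gaugeAct (ι := ι) σ)).contDiff.comp h1
  have h4 : ContDiff ℝ ((⊤ : ℕ∞) : WithTop ℕ∞) fun z : E D × E D => (inner ℝ v.1 z.2 : ℝ) :=
    contDiff_const.inner ℝ contDiff_snd
  exact (h4.smul contDiff_const).sub h3

/-- The operator `a·x + b·D`, for `v = (a, b)`, acting on the second variable of a two-point
function. -/
def linOp (hA : ∀ μ i j, ContDiff ℝ ((⊤ : ℕ∞) : WithTop ℕ∞) fun x => A μ x i j)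
    (v : E D × E D) : Module.End ℂ (smoothFn (E D × E D) (ι × σ → ℂ)) :=
  firstOrder (0, v.2) (linCoeff A σ v) (contDiff_linCoeff hA v)

variable (hA : ∀ μ i j, ContDiff ℝ ((⊤ : ℕ∞) : WithTop ℕ∞) fun x => A μ x i j)

theorem linOp_apply (v : E D × E D) (H : smoothFn (E D × E D) (ι × σ → ℂ)) (z : E D × E D) :
    (linOp hA v H).1 z = fderiv ℝ H.1 z (0, v.2) + (((inner ℝ v.1 z.2 : ℝ) : ℂ) • H.1 z -
      (gaugeGen A v.2 z.2 ⊗ₖ (1 : Matrix σ σ ℂ)).mulVec (H.1 z)) := by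
  rw [linOp, firstOrder_apply, linCoeff, _root_.sub_apply, gaugeAct_apply]
  rfl

omit [Fintype ι] [DecidableEq ι] in
theorem gaugeGen_add (A : Fin D → E D → Matrix ι ι ℂ) (v w y : E D) :
    gaugeGen A (v + w) y = gaugeGen A v y + gaugeGen A w y := by
  simp [gaugeGen, add_smul, Finset.sum_add_distrib]

theorem linOp_add (v w : E D × E D) :
    linOp (σ := σ) hA (v + w) = linOp hA v + linOp hA w := by
  ext H : 1
  refine Subtype.ext (funext fun z => ?_)
  rw [LinearMap.add_apply, Submodule.coe_add, Pi.add_apply, linOp_apply, linOp_apply, linOp_apply]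
  have h1 : ((0, (v + w).2) : E D × E D) = (0, v.2) + (0, w.2) := by simp
  rw [h1, map_add, Prod.snd_add, gaugeGen_add, Matrix.add_kronecker, Matrix.add_mulVec,
    Prod.fst_add, inner_add_left, Complex.ofReal_add, add_smul]
  abel

theorem linOp_sum {κ : Type*} (s : Finset κ) (v : κ → E D × E D) :
    linOp (σ := σ) hA (∑ k ∈ s, v k) = ∑ k ∈ s, linOp hA (v k) :=
  map_sum (AddMonoidHom.mk' (linOp (σ := σ) hA) (linOp_add hA)) v s

/-- Multiplication by the coordinate `x^ν` of the second point. -/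
def xOp (ν : Fin D) : Module.End ℂ (smoothFn (E D × E D) (ι × σ → ℂ)) :=
  linOp hA (EuclideanSpace.single ν 1, 0)

/-- The covariant derivative in the second point. -/
def pOp (μ : Fin D) : Module.End ℂ (smoothFn (E D × E D) (ι × σ → ℂ)) :=
  linOp hA (0, EuclideanSpace.single μ 1)

theorem mulX_section (ν : Fin D) (H : smoothFn (E D × E D) (ι × σ → ℂ)) (u : E D) :
    (mulX ν fun v => H.1 (u, v)) = fun v => (xOp hA ν H).1 (u, v) := by
  funext w
  rw [xOp, linOp_apply]
  have h1 : (0 : E D × E D) = (0, 0) := rfl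
  simp [mulX, ← h1, gaugeGen, EuclideanSpace.inner_single_left]

theorem covD_section (μ : Fin D) (H : smoothFn (E D × E D) (ι × σ → ℂ)) (u : E D) :
    (covD A μ fun v => H.1 (u, v)) = fun v => (pOp hA μ H).1 (u, v) := by
  funext w
  have h1 : HasFDerivAt (fun v => H.1 (u, v))
      ((fderiv ℝ H.1 (u, w)).comp (ContinuousLinearMap.inr ℝ (E D) (E D))) w :=
    (smoothFn.differentiable H (u, w)).hasFDerivAt.comp w (hasFDerivAt_prodMk_right u w)
  have h2 : gaugeGen A (EuclideanSpace.single μ 1) w = Complex.I • A μ w := by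
    rw [gaugeGen, Finset.sum_eq_single μ] <;> simp +contextual
  rw [pOp, linOp_apply, covD, h1.fderiv, h2, Matrix.smul_kronecker, Matrix.smul_mulVec]
  simp [sub_eq_add_neg]

/-- The operators of the statement act on functions of one point; here the first point is a passive
parameter. Working with two-point functions makes joint smoothness visible and turns words into
products of linear endomorphisms. -/
theorem wordProd_section (l : List (Fin D ⊕ Fin D)) (H : smoothFn (E D × E D) (ι × σ → ℂ))
    (u : E D) : (wordProd mulX (covD A) l fun v => H.1 (u, v)) =
      fun v => (wordProd (xOp hA) (pOp hA) l H).1 (u, v) := by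
  induction l with
  | nil => rfl
  | cons a l ih =>
    rw [wordProd_cons, wordProd_cons, Module.End.mul_apply]
    change Sum.elim mulX (covD A) a (wordProd mulX (covD A) l fun v => H.1 (u, v)) = _
    rw [ih]
    cases a with
    | inl ν => exact mulX_section hA ν _ u
    | inr μ => exact covD_section hA μ _ u

/-- The vectors of which the letters `x^{ν_i}`, `D_{μ_j}` are the operators `a·x + b·D`. -/
def letterVec {n m : ℕ} (ν : Fin n → Fin D) (μ : Fin m → Fin D) : Fin (n + m) → E D × E D :=
  Fin.append (fun i => (EuclideanSpace.single (ν i) 1, 0))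
    (fun i => (0, EuclideanSpace.single (μ i) 1))

/-- The symmetrized product of the letters `x^{ν_i}`, `D_{μ_j}`. -/
def symOp {n m : ℕ} (ν : Fin n → Fin D) (μ : Fin m → Fin D) :
    Module.End ℂ (smoothFn (E D × E D) (ι × σ → ℂ)) :=
  ∑ s : Equiv.Perm (Fin (n + m)), orderedWord (xOp hA) (pOp hA) ν μ s

/-- Polarization combined with the additivity of v ↦ `linOp hA v`: only powers of a single operator
a·x + b·D remain. -/
theorem symOp_eq {n m : ℕ} (ν : Fin n → Fin D) (μ : Fin m → Fin D) :
    symOp (σ := σ) hA ν μ = ∑ C : Finset (Fin (n + m)),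
      (-1 : ℤ) ^ C.card • linOp hA (∑ i ∈ Cᶜ, letterVec ν μ i) ^ (n + m) := by
  have h1 : ∀ i, Fin.append (xOp (σ := σ) hA ∘ ν) (pOp hA ∘ μ) i = linOp hA (letterVec ν μ i) := by
    intro i
    rw [letterVec, comp_append (linOp (σ := σ) hA)]
    rfl
  unfold symOp orderedWord
  refine (sum_perm_prod_ofFn (R := Module.End ℂ (smoothFn (E D × E D) (ι × σ → ℂ))) _).trans ?_
  simp only [h1, linOp_sum]

variable (f : Coeffs D σ)

/-- The terms of `Q̂`, acting on the second variable of a two-point function. -/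
def diracTerm (H : smoothFn (E D × E D) (ι × σ → ℂ)) (k : ℕ × ℕ) (z : E D × E D) : ι × σ → ℂ :=
  ∑ ν, ∑ μ, spinAct (f k.1 k.2 ν μ) ((symOp hA ν μ H).1 z)

/-- The operator `Q̂`, acting on the second variable of a two-point function. -/
def dirac₂ (H : smoothFn (E D × E D) (ι × σ → ℂ)) (z : E D × E D) : ι × σ → ℂ :=
  ∑' k, diracTerm hA f H k z

theorem diracOp_section (H : smoothFn (E D × E D) (ι × σ → ℂ)) (u w : E D) :
    diracOp A f (fun v => H.1 (u, v)) w = dirac₂ hA f H (u, w) := by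
  unfold diracOp weylOrdered dirac₂ diracTerm
  refine tsum_congr fun k => Finset.sum_congr rfl fun ν _ => Finset.sum_congr rfl fun μ _ => ?_
  have h1 : (symOp hA ν μ H).1 (u, w) =
      ∑ s, orderedWord mulX (covD A) ν μ s (fun v => H.1 (u, v)) w := by
    rw [symOp, LinearMap.sum_apply, Submodule.coe_sum, Finset.sum_apply]
    refine Finset.sum_congr rfl fun s _ => ?_
    rw [orderedWord_eq_wordProd, orderedWord_eq_wordProd, wordProd_section hA]
  rw [h1, map_sum]
  rfl

/-- The bounds on the terms of `Q̂`. -/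
def diracBound (ρ c : ℝ) (k : ℕ × ℕ) : ℝ :=
  ∑ ν, ∑ μ, (∑ a, ∑ b, ‖f k.1 k.2 ν μ a b‖) * ((k.1 + k.2).factorial * (ρ ^ k.1 * c ^ k.2))

variable {f}

-- The powers of c are bounded by (c + 1)^M, since m ≤ M on nonzero coefficients; the powers of ρ
-- are absorbed by the convergence hypothesis at R = ρ + 1, which is positive even for ρ = 0.
omit [DecidableEq σ] in
theorem summable_diracBound (hf : f.Convergent) {ρ c : ℝ} (hρ : 0 ≤ ρ) (hc : 0 ≤ c) :
    Summable (diracBound f ρ c) := by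
  obtain ⟨⟨M, hM⟩, hs⟩ := hf
  refine .of_nonneg_of_le (fun k => by unfold diracBound; positivity) (fun k => ?_)
    ((hs (ρ + 1) (by positivity)).mul_right ((c + 1) ^ M))
  rw [Finset.sum_mul]
  refine Finset.sum_le_sum fun ν _ => ?_
  rw [Finset.sum_mul]
  refine Finset.sum_le_sum fun μ _ => ?_
  simp only [Finset.sum_mul]
  refine Finset.sum_le_sum fun a _ => Finset.sum_le_sum fun b _ => ?_
  by_cases hk : M < k.2
  · simp [hM _ _ ν μ hk]
  · have h1 : ρ ^ k.1 ≤ (ρ + 1) ^ k.1 := by gcongr; linarith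
    have h2 : c ^ k.2 ≤ (c + 1) ^ M :=
      (pow_le_pow_left₀ hc (by linarith) _).trans
        (pow_le_pow_right₀ (by linarith) (not_lt.1 hk))
    calc _ = (k.1 + k.2).factorial * (ρ ^ k.1 * c ^ k.2) * ‖f k.1 k.2 ν μ a b‖ := by ring
      _ ≤ (k.1 + k.2).factorial * ((ρ + 1) ^ k.1 * (c + 1) ^ M) * ‖f k.1 k.2 ν μ a b‖ := by gcongr
      _ = _ := by ring

theorem exists_uniform_const {κ : Type*} [Fintype κ] {p : κ → ℝ → Prop}
    (hp : ∀ k c c', c ≤ c' → p k c → p k c') (h : ∀ k, ∃ c, 0 ≤ c ∧ p k c) :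
    ∃ c, 0 ≤ c ∧ ∀ k, p k c := by
  choose c hc0 hc using h
  exact ⟨∑ k, c k, Finset.sum_nonneg fun k _ => hc0 k, fun k =>
    hp k _ _ (Finset.single_le_sum (fun k _ => hc0 k) (Finset.mem_univ k)) (hc k)⟩

theorem exists_derivBound_diracTerm (hM : ∃ M : ℕ, ∀ n m ν μ, M < m → f n m ν μ = 0)
    {K : Set (E D × E D)} (hK : IsCompact K) (J : ℕ) :
    ∃ (N : ℕ) (ρ c : ℝ), 0 ≤ ρ ∧ 0 ≤ c ∧ ∀ (C : ℝ) (H : smoothFn (E D × E D) (ι × σ → ℂ)),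
      DerivBound K N C H.1 → ∀ k, DerivBound K J (diracBound f ρ c k * C) (diracTerm hA f H k) := by
  obtain ⟨M, hM⟩ := hM
  obtain ⟨ρ, hρ, hX⟩ := exists_uniform_const (κ := Fin D)
    (p := fun ν ρ => ∀ j ≤ J + M, ∀ (C : ℝ) (H : smoothFn (E D × E D) (ι × σ → ℂ)), 0 ≤ C →
      DerivBound K j C H.1 → DerivBound K j (ρ * C) (xOp hA ν H).1)
    (fun ν c c' hcc h j hj C H hC hH => (h j hj C H hC hH).mono
      (mul_le_mul_of_nonneg_right hcc hC) le_rfl)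
    (fun ν => DerivBound.exists_zeroOrder hK (contDiff_linCoeff hA _) (J + M))
  obtain ⟨c, hc, hP⟩ := exists_uniform_const (κ := Fin D)
    (p := fun μ c => ∀ j ≤ J + M, ∀ (C : ℝ) (H : smoothFn (E D × E D) (ι × σ → ℂ)), 0 ≤ C →
      DerivBound K (j + 1) C H.1 → DerivBound K j (c * C) (pOp hA μ H).1)
    (fun ν c c' hcc h j hj C H hC hH => (h j hj C H hC hH).mono
      (mul_le_mul_of_nonneg_right hcc hC) le_rfl)
    (fun ν => DerivBound.exists_firstOrder hK _ (contDiff_linCoeff hA _) (J + M))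
  -- A nonzero term contains at most M covariant derivatives, so J + M orders of control on H leave
  -- J orders on every term, for all k at once.
  refine ⟨J + M, ρ, c, hρ, hc, fun C H hH k => ?_⟩
  have hC : 0 ≤ C := hH.nonneg
  unfold diracBound
  simp only [Finset.sum_mul]
  refine DerivBound.sum fun ν _ => DerivBound.sum fun μ _ => ?_
  simp only [← Finset.sum_mul]
  by_cases hk : M < k.2
  · have h0 : ∀ v : ι × σ → ℂ, spinAct (f k.1 k.2 ν μ) v = 0 := fun v => by
      rw [spinAct_apply, hM _ _ ν μ hk]; simp
    simp only [h0]
    refine ⟨contDiff_const, by simp [tsupport], fun i _ z => ?_⟩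
    rw [iteratedFDeriv_fun_zero]
    simp only [Pi.zero_apply, norm_zero]
    positivity
  · have h1 : DerivBound K J ((k.1 + k.2).factorial * (ρ ^ k.1 * c ^ k.2 * C))
        (symOp hA ν μ H).1 := by
      have h2 : (symOp hA ν μ H).1 = fun z => ∑ s : Equiv.Perm (Fin (k.1 + k.2)),
          (wordProd (xOp hA) (pOp hA) (orderedLetters ν μ s) H).1 z := by
        funext z
        rw [symOp, LinearMap.sum_apply, Submodule.coe_sum, Finset.sum_apply]
        simp only [orderedWord_eq_wordProd]
      have h3 : ((k.1 + k.2).factorial : ℝ) * (ρ ^ k.1 * c ^ k.2 * C) =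
          ∑ s : Equiv.Perm (Fin (k.1 + k.2)), ρ ^ k.1 * c ^ k.2 * C := by
        simp [Fintype.card_perm]
      rw [h2, h3]
      refine DerivBound.sum fun s _ => ?_
      have h4 := DerivBound.wordProd hρ hc hX hP hC (H := H) (orderedLetters ν μ s) (j := J)
        (by rw [countP_isRight_orderedLetters]; omega)
        (hH.mono le_rfl (by rw [countP_isRight_orderedLetters]; omega))
      rwa [countP_isRight_orderedLetters, countP_isLeft_orderedLetters] at h4
    have h5 := h1.clm_apply (spinAct (f k.1 k.2 ν μ)) (norm_spinAct_le _)
    convert h5 using 1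
    ring

section Dirac

variable (hf : f.Convergent) {H : smoothFn (E D × E D) (ι × σ → ℂ)} (hc : HasCompactSupport H.1)

include hf hc

theorem exists_summable_bound_diracTerm (J : ℕ) :
    ∃ v : ℕ × ℕ → ℝ, Summable v ∧ ∀ k, DerivBound (tsupport H.1) J (v k) (diracTerm hA f H k) := by
  obtain ⟨N, ρ, c, hρ, hc0, h⟩ := exists_derivBound_diracTerm hA hf.1 hc.isCompact J
  obtain ⟨C, hC⟩ := DerivBound.exists_of_hasCompactSupport (smoothFn.contDiff H) hc N
  exact ⟨_, (summable_diracBound hf hρ hc0).mul_right C, h C H hC⟩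

theorem hasSum_dirac₂ (z : E D × E D) :
    HasSum (fun k => diracTerm hA f H k z) (dirac₂ hA f H z) := by
  obtain ⟨v, hv, h⟩ := exists_summable_bound_diracTerm hA hf hc 0
  exact (Summable.of_norm_bounded hv fun k => (h k).norm_le z).hasSum

theorem contDiff_dirac₂ : ContDiff ℝ ((⊤ : ℕ∞) : WithTop ℕ∞) (dirac₂ hA f H) := by
  refine contDiff_infty.2 fun n => ?_
  obtain ⟨v, hv, h⟩ := exists_summable_bound_diracTerm hA hf hc n
  exact contDiff_tsum (N := (n : ℕ∞)) (v := fun _ => v)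
    (fun k => (h k).contDiff.of_le (by exact_mod_cast le_top)) (fun _ _ => hv)
    (fun i k z hi => (h k).bound i (by exact_mod_cast hi) z)

theorem dirac₂_eq_zero {z : E D × E D} (hz : z ∉ tsupport H.1) : dirac₂ hA f H z = 0 := by
  obtain ⟨v, hv, h⟩ := exists_summable_bound_diracTerm hA hf hc 0
  simp [dirac₂, (h _).eq_zero hz]

theorem hasCompactSupport_dirac₂ : HasCompactSupport (dirac₂ hA f H) :=
  HasCompactSupport.intro hc.isCompact fun _ hz => dirac₂_eq_zero hA hf hc hz

end Dirac

end TwoPoint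

end GaugeWigner

end

noncomputable section

namespace GaugeWigner

open MeasureTheory Set

/-! ### Test functions and kernels -/

section TestFunctions

variable {D : ℕ}

theorem toTest_apply {h : E D × E D → ℂ} (h1 : ContDiff ℝ ((⊤ : ℕ∞) : WithTop ℕ∞) h)
    (h2 : HasCompactSupport h) (z : E D × E D) : toTest h z = h z := by
  rw [toTest, dif_pos ⟨h1, h2⟩]
  rfl

/-- A linear functional on test functions that is bounded by finitely many derivatives on every
compact set, as a distribution. -/
def distributionOfBound (φ : Test2 D → ℂ) (hadd : ∀ g h, φ (g + h) = φ g + φ h)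
    (hsmul : ∀ (c : ℂ) h, φ (c • h) = c • φ h)
    (hb : ∀ K : Set (E D × E D), IsCompact K → ∃ (N : ℕ) (C : ℝ), 0 ≤ C ∧
      ∀ (B : ℝ) (h : Test2 D), DerivBound K N B h → ‖φ h‖ ≤ C * B) : Test2 D →L[ℂ] ℂ :=
  TestFunction.mkCLM ℂ φ hadd hsmul fun K hK =>
    (ContDiffMapSupportedIn.mkCLMtoNormedSpace (𝕜 := ℂ)
      (fun h => φ (TestFunction.ofSupportedIn hK h))
      (fun g h => hadd (.ofSupportedIn hK g) (.ofSupportedIn hK h))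
      (fun c h => hsmul c (.ofSupportedIn hK h)) (by
        obtain ⟨N, C, hC, h⟩ := hb K K.isCompact
        refine ⟨Finset.range (N + 1), C, hC, fun g => h _ _
          ⟨g.contDiff, g.tsupport_subset, fun i hi z => ?_⟩⟩
        exact (ContDiffMapSupportedIn.norm_iteratedFDeriv_apply_le_seminorm_top ℂ).trans
          (Seminorm.le_finset_sup_apply (Finset.mem_range.2 (by omega))))).continuous

theorem hasCompactSupport_diag {V : Type*} [Zero V] {F : E D × E D → V}
    (hc : HasCompactSupport F) : HasCompactSupport fun u => F (u, u) := by
  refine HasCompactSupport.intro (hc.isCompact.image continuous_fst) fun u hu => ?_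
  by_contra h
  exact hu ⟨(u, u), subset_tsupport _ h, rfl⟩

theorem integrable_diag {V : Type*} [NormedAddCommGroup V] {F : E D × E D → V}
    (hF : Continuous F) (hc : HasCompactSupport F) : Integrable fun u => F (u, u) :=
  (hF.comp (f := fun u : E D => (u, u)) (by fun_prop)).integrable_of_hasCompactSupport
    (hasCompactSupport_diag hc)

theorem norm_integral_diag_le {F : E D × E D → ℂ} {K : Set (E D × E D)}
    (hK : IsCompact K) {C : ℝ} (hF : ∀ z ∉ K, F z = 0) (hC : ∀ z, ‖F z‖ ≤ C) :
    ‖∫ u, F (u, u)‖ ≤ volume.real (Prod.fst '' K) * C := by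
  rw [← setIntegral_eq_integral_of_forall_compl_eq_zero (s := Prod.fst '' K), mul_comm]
  · exact norm_setIntegral_le_of_norm_le_const (hK.image continuous_fst).measure_lt_top
      fun u _ => hC _
  · intro u hu
    exact hF _ fun h => hu ⟨_, h, rfl⟩

variable {ι σ : Type*} [Fintype ι] [DecidableEq ι] [Fintype σ] [DecidableEq σ]

/-- A test function placed in one component of a multiplet. -/
def component (d : ι × σ) (h : Test2 D) : smoothFn (E D × E D) (ι × σ → ℂ) :=
  ⟨fun z => Pi.single d (h z), mem_smoothFn.2
    ((ContinuousLinearMap.single ℝ (fun _ : ι × σ => ℂ) d).contDiff.comp h.contDiff)⟩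

theorem component_apply (d : ι × σ) (h : Test2 D) (z : E D × E D) :
    (component d h).1 z = Pi.single d (h z) := rfl

theorem component_add (d : ι × σ) (g h : Test2 D) :
    component d (g + h) = component d g + component d h :=
  Subtype.ext (funext fun z => by
    simp [component_apply, Pi.single_add])

theorem component_smul (d : ι × σ) (c : ℂ) (h : Test2 D) :
    component d (c • h) = c • component d h :=
  Subtype.ext (funext fun z => by
    simp only [component_apply, Submodule.coe_smul, Pi.smul_apply, FunLike.coe_smul]
    exact Pi.single_smul (f := fun _ => ℂ) d c (h z))

theorem derivBound_component {d : ι × σ} {K : Set (E D × E D)} {N : ℕ} {B : ℝ} {h : Test2 D}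
    (hh : DerivBound K N B h) : DerivBound K N B (component d h).1 := by
  have := hh.clm_apply (ContinuousLinearMap.single ℝ (fun _ : ι × σ => ℂ) d) (N := 1)
    (ContinuousLinearMap.opNorm_le_bound _ zero_le_one fun x => by simp [Pi.norm_single])
  rw [one_mul] at this
  exact this

theorem hasCompactSupport_component (d : ι × σ) (h : Test2 D) :
    HasCompactSupport (component d h).1 :=
  h.hasCompactSupport.comp_left (g := fun x : ℂ => (Pi.single d x : ι × σ → ℂ)) (by simp)

variable {A : Fin D → E D → Matrix ι ι ℂ} {f : Coeffs D σ}
  (hA : ∀ μ i j, ContDiff ℝ ((⊤ : ℕ∞) : WithTop ℕ∞) fun x => A μ x i j) (hf : f.Convergent)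

theorem diracTerm_add (H H' : smoothFn (E D × E D) (ι × σ → ℂ)) (k : ℕ × ℕ) (z : E D × E D) :
    diracTerm hA f (H + H') k z = diracTerm hA f H k z + diracTerm hA f H' k z := by
  simp [diracTerm, Finset.sum_add_distrib]

theorem diracTerm_smul (c : ℂ) (H : smoothFn (E D × E D) (ι × σ → ℂ)) (k : ℕ × ℕ)
    (z : E D × E D) : diracTerm hA f (c • H) k z = c • diracTerm hA f H k z := by
  simp [diracTerm, Finset.smul_sum, spinAct_apply, Matrix.mulVec_smul]

theorem dirac₂_smul (c : ℂ) (H : smoothFn (E D × E D) (ι × σ → ℂ)) (z : E D × E D) :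
    dirac₂ hA f (c • H) z = c • dirac₂ hA f H z := by
  simp only [dirac₂, diracTerm_smul]
  exact tsum_const_smul'' c

include hf in
theorem dirac₂_add {H H' : smoothFn (E D × E D) (ι × σ → ℂ)} (hc : HasCompactSupport H.1)
    (hc' : HasCompactSupport H'.1) (z : E D × E D) :
    dirac₂ hA f (H + H') z = dirac₂ hA f H z + dirac₂ hA f H' z := by
  have := (hasSum_dirac₂ hA hf hc z).add (hasSum_dirac₂ hA hf hc' z)
  simp only [← diracTerm_add] at this
  exact this.tsum_eq

/-- The test function `(u, w) ↦ (Q̂_w h)(u, w)`. -/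
def diracTest (h : Test2 D) (c d : ι × σ) : Test2 D :=
  toTest fun z => dirac₂ hA f (component d h) z c

include hf in
theorem contDiff_dirac₂_entry {H : smoothFn (E D × E D) (ι × σ → ℂ)}
    (hc : HasCompactSupport H.1) (c : ι × σ) :
    ContDiff ℝ ((⊤ : ℕ∞) : WithTop ℕ∞) fun z => dirac₂ hA f H z c :=
  contDiff_pi.1 (contDiff_dirac₂ hA hf hc) c

include hf in
theorem hasCompactSupport_dirac₂_entry {H : smoothFn (E D × E D) (ι × σ → ℂ)}
    (hc : HasCompactSupport H.1) (c : ι × σ) :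
    HasCompactSupport fun z => dirac₂ hA f H z c :=
  (hasCompactSupport_dirac₂ hA hf hc).comp_left (g := fun v : ι × σ → ℂ => v c) rfl

include hf in
theorem diracTest_apply (h : Test2 D) (c d : ι × σ) (z : E D × E D) :
    diracTest hA (f := f) h c d z = dirac₂ hA f (component d h) z c :=
  toTest_apply (contDiff_dirac₂_entry hA hf (hasCompactSupport_component d h) c)
    (hasCompactSupport_dirac₂_entry hA hf (hasCompactSupport_component d h) c) z

include hf in
theorem integrable_dirac₂_diag {H : smoothFn (E D × E D) (ι × σ → ℂ)}
    (hc : HasCompactSupport H.1) (c : ι × σ) : Integrable fun u => dirac₂ hA f H (u, u) c :=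
  integrable_diag (F := fun z => dirac₂ hA f H z c)
    (contDiff_dirac₂_entry hA hf hc c).continuous (hasCompactSupport_dirac₂_entry hA hf hc c)

/-- The matrix elements of `Q̂`. -/
def diracKernel : Kernel D ι σ := fun c d =>
  distributionOfBound (fun h => ∫ u, dirac₂ hA f (component d h) (u, u) c)
    (fun g h => by
      simp only [component_add, dirac₂_add hA hf (hasCompactSupport_component d g)
        (hasCompactSupport_component d h), Pi.add_apply]
      exact integral_add (integrable_dirac₂_diag hA hf (hasCompactSupport_component d g) c)
        (integrable_dirac₂_diag hA hf (hasCompactSupport_component d h) c))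
    (fun r h => by
      simp only [component_smul, dirac₂_smul, Pi.smul_apply]
      exact integral_smul r _)
    (fun K hK => by
      obtain ⟨N, ρ, b, hρ, hb, hbd⟩ := exists_derivBound_diracTerm (σ := σ) hA hf.1 hK 0
      have hs := summable_diracBound hf hρ hb
      have h0 : ∀ k, 0 ≤ diracBound f ρ b k := fun k => by unfold diracBound; positivity
      refine ⟨N, volume.real (Prod.fst '' K) * ∑' k, diracBound f ρ b k,
        mul_nonneg measureReal_nonneg (tsum_nonneg h0), fun B h hh => ?_⟩
      have hd := hbd B _ (derivBound_component (d := d) hh)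
      have hs' := hs.mul_right B
      rw [mul_assoc, ← tsum_mul_right]
      refine norm_integral_diag_le (F := fun z => dirac₂ hA f (component d h) z c) hK
        (fun z hz => ?_) fun z => ?_
      · simp [dirac₂, (hd _).eq_zero hz]
      · exact (norm_le_pi_norm _ c).trans
          (tsum_of_norm_bounded hs'.hasSum fun k => (hd k).norm_le z))

theorem diracKernel_apply (c d : ι × σ) (h : Test2 D) :
    diracKernel hA hf c d h = ∫ u, dirac₂ hA f (component d h) (u, u) c := rfl

/-- Q̂ differentiates only the second variable, so on the slice at w the factor χ(w) is a scalar and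
passes through Q̂ by linearity. -/
theorem diracKernel_prod (h : Test2 D) (u : E D) (χ : Test1 D) (c d : ι × σ) :
    diracKernel hA hf c d (toTest fun z : E D × E D => χ z.1 * h (u, z.2)) =
      ∫ w : E D, χ w * diracTest hA (f := f) h c d (u, w) := by
  have h1 : ContDiff ℝ ((⊤ : ℕ∞) : WithTop ℕ∞) fun z : E D × E D => χ z.1 * h (u, z.2) := by
    have h2 := χ.contDiff.comp (contDiff_fst (E := E D) (F := E D))
    have h3 := h.contDiff.comp
      ((contDiff_const (c := u)).prodMk (contDiff_snd (E := E D) (F := E D)))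
    exact h2.mul h3
  have h2 : HasCompactSupport fun z : E D × E D => χ z.1 * h (u, z.2) := by
    refine HasCompactSupport.intro (χ.hasCompactSupport.isCompact.prod
      (h.hasCompactSupport.isCompact.image continuous_snd)) fun z hz => ?_
    by_contra h3
    refine hz ⟨subset_tsupport _ (left_ne_zero_of_mul h3), ⟨(u, z.2), ?_, rfl⟩⟩
    exact subset_tsupport _ (right_ne_zero_of_mul h3)
  rw [diracKernel_apply]
  congr 1
  funext w
  rw [diracTest_apply hA hf, ← diracOp_section hA]
  have h3 : (fun v => (component d (toTest fun z : E D × E D => χ z.1 * h (u, z.2))).1 (w, v)) =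
      fun v => (χ w • component d h).1 (u, v) := by
    funext v
    rw [component_apply, toTest_apply h1 h2]
    simp [component_apply, ← Pi.single_smul]
  rw [h3, diracOp_section hA, dirac₂_smul]
  rfl

/-- The matrix elements of the identity operator. -/
def deltaKernel (D : ℕ) (ι σ : Type*) [DecidableEq ι] [DecidableEq σ] : Kernel D ι σ := fun a d =>
  distributionOfBound (deltaPairing a d)
    (fun g h => by
      unfold deltaPairing
      split_ifs
      · exact integral_add (integrable_diag g.continuous g.hasCompactSupport)
          (integrable_diag h.continuous h.hasCompactSupport)
      · simp)
    (fun r h => by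
      unfold deltaPairing
      split_ifs
      · exact integral_smul r _
      · simp)
    (fun K hK => by
      refine ⟨0, volume.real (Prod.fst '' K), measureReal_nonneg, fun B h hh => ?_⟩
      unfold deltaPairing
      split_ifs
      · exact norm_integral_diag_le hK (fun z hz => hh.eq_zero hz) hh.norm_le
      · rw [norm_zero]
        exact mul_nonneg measureReal_nonneg hh.nonneg)

omit [Fintype ι] [Fintype σ] in
theorem deltaKernel_apply (a d : ι × σ) (h : Test2 D) :
    deltaKernel D ι σ a d h = deltaPairing a d h := rfl

theorem sum_apply_diracTest {G : Kernel D ι σ} (hG : IsGreenFunction A f G) (h : Test2 D)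
    (a d : ι × σ) : ∑ c, G a c (diracTest hA (f := f) h c d) = deltaPairing a d h := by
  rw [← hG.1 h a d]
  refine Finset.sum_congr rfl fun c _ => ?_
  unfold diracTest
  congr 2
  funext z
  rw [← diracOp_section hA]
  rfl

theorem isProduct_diracKernel {G : Kernel D ι σ} (hG : IsGreenFunction A f G) :
    IsProduct G (diracKernel hA hf) (deltaKernel D ι σ) :=
  ⟨diracTest hA, diracKernel_prod hA hf, fun h a d => (sum_apply_diracTest hA hG h a d).symm⟩

/-- The product of `Ĝ` and `Q̂` is unique. -/
theorem eq_deltaKernel_of_isProduct {G Z : Kernel D ι σ} (hG : IsGreenFunction A f G)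
    (hZ : IsProduct G (diracKernel hA hf) Z) : Z = deltaKernel D ι σ := by
  obtain ⟨T, hT, hZT⟩ := hZ
  have h1 : ∀ h c d, T h c d = diracTest hA (f := f) h c d := by
    intro h c d
    ext ⟨u, w⟩
    have hcont : ∀ g : Test2 D, Continuous fun w => g (u, w) := fun g =>
      g.continuous.comp (by fun_prop)
    -- For fixed u, both sides have the same integrals against every χ. The fundamental lemma of the
    -- calculus of variations gives equality almost everywhere in w, and continuity gives it
    -- everywhere.
    have h2 : (fun w => T h c d (u, w) - diracTest hA (f := f) h c d (u, w)) =ᵐ[volume] 0 := by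
      refine ae_eq_zero_of_integral_contDiff_smul_eq_zero
        (((hcont _).sub (hcont _)).locallyIntegrable) fun g hg hgc => ?_
      let χ : Test1 D := ⟨fun x => (g x : ℂ), Complex.ofRealCLM.contDiff.comp hg,
        hgc.comp_left (g := fun x : ℝ => (x : ℂ)) (by simp), fun _ _ => trivial⟩
      have h3 := (hT h u χ c d).symm.trans (diracKernel_prod hA hf h u χ c d)
      have hint : ∀ t : Test2 D, Integrable fun w => χ w * t (u, w) := fun t =>
        (χ.continuous.mul (hcont t)).integrable_of_hasCompactSupport
          χ.hasCompactSupport.mul_right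
      rw [← sub_eq_zero, ← integral_sub (hint _) (hint _)] at h3
      rw [← h3]
      congr 1
      funext x
      rw [← mul_sub]
      exact Complex.real_smul
    have h3 := (Continuous.ae_eq_iff_eq volume ((hcont _).sub (hcont _)) continuous_zero).1 h2
    exact sub_eq_zero.1 (congrFun h3 w)
  funext a d
  ext h
  rw [hZT, deltaKernel_apply, ← sum_apply_diracTest hA hG]
  simp only [h1]

end TestFunctions

end GaugeWigner

end

noncomputable section

namespace GaugeWigner

open MeasureTheory Set

/-! ### Phase-space test functions -/

section Phase

variable {D : ℕ}

open FourierTransform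

/-- The function `Φ(x, p) = (2π)^{-D} ∫ e^{-ip·y} g(x, y) dy`. -/
def phaseFn (g : Test2 D) (x p : E D) : ℂ :=
  (((2 * Real.pi) ^ D : ℝ) : ℂ)⁻¹ *
    ∫ y : E D, Complex.exp (-(Complex.I * ((inner ℝ p y : ℝ) : ℂ))) * g (x, y)

/-- The phase-space test function defined by `g`. -/
def phaseTest (g : Test2 D) : PhaseTest D := ⟨phaseFn g, g, fun _ _ => rfl⟩

theorem exists_eq_phaseTest (Φ : PhaseTest D) : ∃ g, Φ = phaseTest g := by
  obtain ⟨Φ, g, hg⟩ := Φ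
  exact ⟨g, Subtype.ext (funext fun x => funext fun p => hg x p)⟩

variable (g : Test2 D)

theorem contDiff_slice (x : E D) : ContDiff ℝ ((⊤ : ℕ∞) : WithTop ℕ∞) fun y => g (x, y) := by
  have h := g.contDiff.comp ((contDiff_const (c := x)).prodMk (contDiff_id (E := E D)))
  exact h

theorem hasCompactSupport_slice (x : E D) : HasCompactSupport fun y => g (x, y) := by
  refine HasCompactSupport.intro (g.hasCompactSupport.isCompact.image continuous_snd) fun y hy => ?_
  by_contra h
  exact hy ⟨(x, y), subset_tsupport _ h, rfl⟩

theorem slice_eq_zero {x : E D} (hx : x ∉ Prod.fst '' tsupport g) (y : E D) : g (x, y) = 0 := by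
  by_contra h
  exact hx ⟨(x, y), subset_tsupport _ h, rfl⟩

theorem norm_iteratedFDeriv_slice_le (i : ℕ) (x y : E D) :
    ‖iteratedFDeriv ℝ i (fun y => g (x, y)) y‖ ≤ ‖iteratedFDeriv ℝ i g (x, y)‖ := by
  have h1 : (fun y => g (x, y)) =
      (fun z => g ((x, 0) + z)) ∘ ContinuousLinearMap.inr ℝ (E D) (E D) := by
    funext y
    simp
  have h2 : ContDiff ℝ ((⊤ : ℕ∞) : WithTop ℕ∞) fun z => g ((x, 0) + z) := by
    have h := g.contDiff.comp ((contDiff_const (c := ((x, 0) : E D × E D))).add contDiff_id)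
    exact h
  rw [h1, ContinuousLinearMap.iteratedFDeriv_comp_right _ h2 _ (by exact_mod_cast le_top)]
  refine (ContinuousMultilinearMap.norm_compContinuousLinearMap_le _ _).trans ?_
  rw [iteratedFDeriv_comp_add_left]
  simp only [ContinuousLinearMap.inr_apply, Prod.mk_add_mk, add_zero, zero_add]
  refine mul_le_of_le_one_right (norm_nonneg _) (Finset.prod_le_one (fun _ _ => norm_nonneg _)
    fun _ _ => ContinuousLinearMap.norm_inr_le_one ℝ (E D) (E D))

theorem phaseFn_eq_fourier (x p : E D) :
    phaseFn g x p = (((2 * Real.pi) ^ D : ℝ) : ℂ)⁻¹ *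
      𝓕 (fun y => g (x, y)) ((2 * Real.pi)⁻¹ • p) := by
  rw [phaseFn, Real.fourier_eq']
  congr 2
  funext y
  rw [smul_eq_mul, inner_smul_right, real_inner_comm]
  congr 2
  push_cast
  have : (Real.pi : ℂ) ≠ 0 := by exact_mod_cast Real.pi_ne_zero
  field_simp

/-- Powers of q are traded for derivatives in y. The bound is uniform in x because all slices are
supported in one compact projection and their derivatives are dominated by those of g. -/
theorem exists_fourier_slice_bound (n : ℕ) : ∃ C, ∀ x q : E D,
    ‖q‖ ^ n * ‖𝓕 (fun y => g (x, y)) q‖ ≤ C := by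
  obtain ⟨B, hB⟩ := DerivBound.exists_of_hasCompactSupport g.contDiff g.hasCompactSupport n
  set K := Prod.snd '' tsupport g with hK
  have hKc : IsCompact K := g.hasCompactSupport.isCompact.image continuous_snd
  have hint : ∀ (x : E D) (k i : ℕ), Integrable fun y =>
      ‖y‖ ^ k * ‖iteratedFDeriv ℝ i (fun y => g (x, y)) y‖ := by
    intro x k i
    refine Continuous.integrable_of_hasCompactSupport
      ((by fun_prop : Continuous fun y : E D => ‖y‖ ^ k).mul
        ((contDiff_slice g x).continuous_iteratedFDeriv (by exact_mod_cast le_top)).norm) ?_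
    exact ((hasCompactSupport_slice g x).iteratedFDeriv i).norm.mul_left
  refine ⟨2 ^ n * ∑ i ∈ Finset.range (n + 1), B * volume.real K, fun x q => ?_⟩
  have h1 := Real.pow_mul_norm_iteratedFDeriv_fourier_le (K := 0) (N := (⊤ : ℕ∞))
    (contDiff_slice g x) (fun k i _ _ => hint x k i) (k := 0) (n := n) le_rfl le_top q
  simp only [norm_iteratedFDeriv_zero, pow_zero, Nat.cast_zero, mul_zero, zero_add, one_mul,
    Finset.range_one, Finset.sum_product, Finset.sum_singleton] at h1
  refine h1.trans (mul_le_mul_of_nonneg_left (Finset.sum_le_sum fun i hi => ?_) (by positivity))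
  have hi' : i ≤ n := by have := Finset.mem_range.1 hi; omega
  have h2 : ∀ y ∉ K, ‖iteratedFDeriv ℝ i (fun y => g (x, y)) y‖ = 0 := by
    intro y hy
    have h3 : iteratedFDeriv ℝ i g (x, y) = 0 := by
      by_contra h
      exact hy ⟨(x, y), support_iteratedFDeriv_subset i h, rfl⟩
    have := norm_iteratedFDeriv_slice_le g i x y
    rw [h3, norm_zero] at this
    exact le_antisymm this (norm_nonneg _)
  rw [← setIntegral_eq_integral_of_forall_compl_eq_zero h2]
  refine (le_abs_self _).trans ?_
  rw [← Real.norm_eq_abs]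
  refine norm_setIntegral_le_of_norm_le_const hKc.measure_lt_top fun y _ => ?_
  rw [norm_norm]
  exact (norm_iteratedFDeriv_slice_le g i x y).trans (hB.bound i hi' _)

theorem phaseFn_eq_zero {x : E D} (hx : x ∉ Prod.fst '' tsupport g) (p : E D) :
    phaseFn g x p = 0 := by
  simp [phaseFn, slice_eq_zero g hx]

theorem exists_phaseFn_bound (n : ℕ) : ∃ C, 0 ≤ C ∧ ∀ x p : E D,
    (1 + ‖p‖) ^ n * ‖phaseFn g x p‖ ≤ C := by
  obtain ⟨C₀, hC₀⟩ := exists_fourier_slice_bound g 0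
  obtain ⟨C₁, hC₁⟩ := exists_fourier_slice_bound g n
  set c : ℝ := ‖(((2 * Real.pi) ^ D : ℝ) : ℂ)⁻¹‖ with hc
  have hc0 : 0 ≤ c := norm_nonneg _
  have hpi : 0 < 2 * Real.pi := by positivity
  have key : ∀ x p : E D, (1 + ‖p‖) ^ n * ‖phaseFn g x p‖ ≤
      2 ^ (n - 1) * (c * C₀ + (2 * Real.pi) ^ n * (c * C₁)) := by
    intro x p
    have h1 := hC₀ x ((2 * Real.pi)⁻¹ • p)
    have h2 := hC₁ x ((2 * Real.pi)⁻¹ • p)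
    rw [pow_zero, one_mul] at h1
    have h3 : ‖(2 * Real.pi)⁻¹ • p‖ ^ n = ((2 * Real.pi) ^ n)⁻¹ * ‖p‖ ^ n := by
      rw [norm_smul, mul_pow, norm_inv, Real.norm_of_nonneg hpi.le, inv_pow]
    rw [h3, mul_assoc, inv_mul_le_iff₀ (by positivity)] at h2
    rw [phaseFn_eq_fourier, norm_mul, ← hc]
    set F := ‖𝓕 (fun y => g (x, y)) ((2 * Real.pi)⁻¹ • p)‖ with hF
    have hF0 : 0 ≤ F := norm_nonneg _
    calc (1 + ‖p‖) ^ n * (c * F) ≤ 2 ^ (n - 1) * (1 ^ n + ‖p‖ ^ n) * (c * F) :=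
          mul_le_mul_of_nonneg_right (add_pow_le zero_le_one (norm_nonneg p) n) (by positivity)
      _ = 2 ^ (n - 1) * (c * F + c * (‖p‖ ^ n * F)) := by rw [one_pow]; ring
      _ ≤ 2 ^ (n - 1) * (c * C₀ + c * ((2 * Real.pi) ^ n * C₁)) := by gcongr
      _ = _ := by ring
  exact ⟨_, (mul_nonneg (by positivity) (norm_nonneg _)).trans (key 0 0), key⟩

theorem stronglyMeasurable_phaseFn : StronglyMeasurable fun z : E D × E D => phaseFn g z.1 z.2 := by
  unfold phaseFn
  refine StronglyMeasurable.const_mul ?_ _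
  refine StronglyMeasurable.integral_prod_right (f := fun (z : E D × E D) (y : E D) =>
    Complex.exp (-(Complex.I * ((inner ℝ z.2 y : ℝ) : ℂ))) * g (z.1, y)) ?_
  refine Continuous.stronglyMeasurable ?_
  have h1 : Continuous fun w : (E D × E D) × E D => g (w.1.1, w.2) :=
    g.continuous.comp (by fun_prop)
  have h2 : Continuous fun w : (E D × E D) × E D => ((inner ℝ w.1.2 w.2 : ℝ) : ℂ) := by fun_prop
  exact (Complex.continuous_exp.comp (continuous_const.mul h2).neg).mul h1

/-- Compact support in x and rapid decay in p: D + 1 further powers of 1 + ‖p‖ are spent on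
integrability over ℝ^D. -/
theorem integrable_pow_mul_phaseFn (n : ℕ) :
    Integrable fun z : E D × E D => (1 + ‖z.2‖) ^ n * ‖phaseFn g z.1 z.2‖ := by
  obtain ⟨C, hC0, hC⟩ := exists_phaseFn_bound g (n + (D + 1))
  set K := Prod.fst '' tsupport g with hK
  have hKc : IsCompact K := g.hasCompactSupport.isCompact.image continuous_fst
  have h1 : Integrable fun x : E D => K.indicator (fun _ => C) x :=
    (integrable_indicator_iff hKc.measurableSet).2 (by
      simp [integrableOn_const_iff, hKc.measure_lt_top])
  have h2 : Integrable fun p : E D => (1 + ‖p‖) ^ (-((D + 1 : ℕ) : ℝ)) :=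
    integrable_one_add_norm (by simp)
  refine (h1.mul_prod h2).mono' ?_ (Filter.Eventually.of_forall fun z => ?_)
  · exact ((by fun_prop : Continuous fun z : E D × E D => (1 + ‖z.2‖) ^ n).stronglyMeasurable.mul
      (stronglyMeasurable_phaseFn g).norm).aestronglyMeasurable
  · have hpos : 0 < 1 + ‖z.2‖ := by positivity
    rw [norm_mul, norm_norm, norm_pow, Real.norm_of_nonneg hpos.le]
    by_cases hz : z.1 ∈ K
    · rw [indicator_of_mem hz, Real.rpow_neg hpos.le, Real.rpow_natCast, ← div_eq_mul_inv,
        le_div_iff₀ (by positivity)]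
      calc _ = (1 + ‖z.2‖) ^ (n + (D + 1)) * ‖phaseFn g z.1 z.2‖ := by rw [pow_add]; ring
        _ ≤ C := hC z.1 z.2
    · simp [phaseFn_eq_zero g hz, indicator_of_notMem hz]

/-- Fourier inversion in y. The substitution p = 2πq passes to the normalization with e^{2πi q·y},
and its Jacobian (2π)^D cancels the prefactor of Φ. -/
theorem fourierP_phaseTest (x y : E D) : fourierP (phaseTest g) x y = g (x, y) := by
  have hpi : (0 : ℝ) < 2 * Real.pi := by positivity
  have hint : Integrable (𝓕 fun y => g (x, y)) := by
    obtain ⟨C, hC0, hC⟩ := exists_phaseFn_bound g (D + 1)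
    have h2 : Integrable fun p : E D => C * (1 + ‖p‖) ^ (-((D + 1 : ℕ) : ℝ)) :=
      (integrable_one_add_norm (by simp)).const_mul C
    have h3 : Integrable (phaseFn g x) := by
      refine h2.mono' ((stronglyMeasurable_phaseFn g).comp_measurable
        (measurable_prodMk_left (x := x))).aestronglyMeasurable
        (Filter.Eventually.of_forall fun p => ?_)
      have hpos : 0 < 1 + ‖p‖ := by positivity
      rw [Real.rpow_neg hpos.le, Real.rpow_natCast, ← div_eq_mul_inv, le_div_iff₀ (by positivity),
        mul_comm]
      exact hC x p
    have h4 := (h3.comp_smul hpi.ne').const_mul (((2 * Real.pi) ^ D : ℝ) : ℂ)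
    refine h4.congr (Filter.Eventually.of_forall fun q => ?_)
    have h5 : (((2 * Real.pi) ^ D : ℝ) : ℂ) ≠ 0 := by
      exact_mod_cast (pow_pos hpi D).ne'
    simp only [phaseFn_eq_fourier, smul_smul, inv_mul_cancel₀ hpi.ne', one_smul]
    rw [mul_inv_cancel_left₀ h5]
  have h1 := congrFun ((contDiff_slice g x).continuous.fourierInv_fourier_eq
    ((contDiff_slice g x).continuous.integrable_of_hasCompactSupport
      (hasCompactSupport_slice g x)) hint) y
  rw [← h1, Real.fourierInv_eq']
  have h6 := Measure.integral_comp_smul (volume : Measure (E D)) (fun q =>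
    Complex.exp ((↑(2 * Real.pi * inner ℝ q y) * Complex.I)) •
      𝓕 (fun y => g (x, y)) q) (2 * Real.pi)⁻¹
  rw [finrank_euclideanSpace_fin, inv_pow, inv_inv, abs_of_pos (by positivity)] at h6
  unfold fourierP
  calc _ = (((2 * Real.pi) ^ D : ℝ) : ℂ)⁻¹ * ∫ p : E D, Complex.exp
        ((↑(2 * Real.pi * inner ℝ ((2 * Real.pi)⁻¹ • p) y) * Complex.I)) •
          𝓕 (fun y => g (x, y)) ((2 * Real.pi)⁻¹ • p) := by
        rw [← integral_const_mul]
        congr 1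
        funext p
        change _ * phaseFn g x p = _
        rw [phaseFn_eq_fourier, inner_smul_left, RCLike.conj_to_real,
          mul_inv_cancel_left₀ hpi.ne', smul_eq_mul, mul_comm Complex.I]
        ring
    _ = _ := by
        rw [h6, Complex.real_smul, inv_mul_cancel_left₀]
        exact_mod_cast (pow_pos hpi D).ne'

/-- The function `a·x + i b·p` on phase space, for `v = (a, b)`. -/
def linSymbol (v z : E D × E D) : ℂ :=
  ((inner ℝ v.1 z.1 : ℝ) : ℂ) + Complex.I * ((inner ℝ v.2 z.2 : ℝ) : ℂ)

theorem continuous_linSymbol (v : E D × E D) : Continuous (linSymbol v) := by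
  unfold linSymbol
  fun_prop

/-- The integrals `∫∫ (a·x + i b·p)^k e^{t (a·x + i b·p)} Φ(x, p) dx dp`. -/
def expMoment (v : E D × E D) (k : ℕ) (t : ℝ) : ℂ :=
  ∫ z : E D × E D, linSymbol v z ^ k * Complex.exp (t * linSymbol v z) * phaseFn g z.1 z.2

/-- The momentum enters e^{t(a·x + i b·p)} only through a phase, and x stays bounded on the support,
so the exponential is bounded; the symbol itself grows at most linearly in p. -/
theorem exists_norm_linSymbol_le (v : E D × E D) :
    ∃ R c : ℝ, 0 ≤ R ∧ 0 ≤ c ∧ ∀ z : E D × E D, z.1 ∈ Prod.fst '' tsupport g →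
      ‖linSymbol v z‖ ≤ c * (1 + ‖z.2‖) ∧ ∀ t : ℝ, ‖Complex.exp (t * linSymbol v z)‖ ≤
        Real.exp (|t| * R) := by
  have hKc := g.hasCompactSupport.isCompact.image continuous_fst
  obtain ⟨r, hr⟩ := hKc.exists_bound_of_continuousOn (f := fun x => x) continuousOn_id
  refine ⟨‖v.1‖ * |r|, ‖v.1‖ * |r| + ‖v.2‖, by positivity, by positivity, fun z hz => ?_⟩
  have h1 : |inner ℝ v.1 z.1| ≤ ‖v.1‖ * |r| := (abs_real_inner_le_norm _ _).trans
    (mul_le_mul_of_nonneg_left ((hr _ hz).trans (le_abs_self r)) (norm_nonneg _))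
  constructor
  · calc ‖linSymbol v z‖ ≤ |inner ℝ v.1 z.1| + |inner ℝ v.2 z.2| := by
          refine (norm_add_le _ _).trans_eq ?_
          simp
      _ ≤ ‖v.1‖ * |r| + ‖v.2‖ * ‖z.2‖ := add_le_add h1 (abs_real_inner_le_norm _ _)
      _ ≤ (‖v.1‖ * |r| + ‖v.2‖) * (1 + ‖z.2‖) := by
          have : 0 ≤ ‖v.1‖ * |r| * ‖z.2‖ := by positivity
          nlinarith [norm_nonneg v.2]
  · intro t
    rw [Complex.norm_exp]
    refine Real.exp_le_exp.2 ?_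
    have : ((t : ℂ) * linSymbol v z).re = t * inner ℝ v.1 z.1 := by
      simp [linSymbol]
    rw [this]
    refine (le_abs_self _).trans ?_
    rw [abs_mul]
    gcongr

theorem exists_expMoment_bound (v : E D × E D) (k : ℕ) (T : ℝ) :
    ∃ b : E D × E D → ℝ, Integrable b ∧ ∀ z, ∀ t : ℝ, |t| ≤ T →
      ‖linSymbol v z ^ k * Complex.exp (t * linSymbol v z) * phaseFn g z.1 z.2‖ ≤ b z := by
  obtain ⟨R, c, hR, hc, h⟩ := exists_norm_linSymbol_le g v
  refine ⟨_, (integrable_pow_mul_phaseFn g k).const_mul (c ^ k * Real.exp (T * R)),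
    fun z t ht => ?_⟩
  by_cases hz : z.1 ∈ Prod.fst '' tsupport g
  · obtain ⟨h1, h2⟩ := h z hz
    rw [norm_mul, norm_mul, norm_pow]
    have h3 : Real.exp (|t| * R) ≤ Real.exp (T * R) := by gcongr
    calc _ ≤ (c * (1 + ‖z.2‖)) ^ k * Real.exp (T * R) * ‖phaseFn g z.1 z.2‖ := by
          gcongr
          exact (h2 t).trans h3
      _ = _ := by rw [mul_pow]; ring
  · simp [phaseFn_eq_zero g hz]

theorem aestronglyMeasurable_expMoment (v : E D × E D) (k : ℕ) (t : ℝ) :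
    AEStronglyMeasurable (fun z : E D × E D =>
      linSymbol v z ^ k * Complex.exp (t * linSymbol v z) * phaseFn g z.1 z.2) := by
  have := continuous_linSymbol v
  exact ((by fun_prop : Continuous fun z : E D × E D =>
    linSymbol v z ^ k * Complex.exp (t * linSymbol v z)).stronglyMeasurable.mul
      (stronglyMeasurable_phaseFn g)).aestronglyMeasurable

theorem integrable_expMoment (v : E D × E D) (k : ℕ) (t : ℝ) :
    Integrable (fun z : E D × E D =>
      linSymbol v z ^ k * Complex.exp (t * linSymbol v z) * phaseFn g z.1 z.2) := by
  obtain ⟨b, hb, h⟩ := exists_expMoment_bound g v k |t|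
  exact hb.mono' (aestronglyMeasurable_expMoment g v k t)
    (Filter.Eventually.of_forall fun z => h z t le_rfl)

theorem hasDerivAt_expMoment (v : E D × E D) (k : ℕ) (t : ℝ) :
    HasDerivAt (expMoment g v k) (expMoment g v (k + 1) t) t := by
  obtain ⟨b, hb, h⟩ := exists_expMoment_bound g v (k + 1) (|t| + 1)
  refine (hasDerivAt_integral_of_dominated_loc_of_deriv_le (Metric.ball_mem_nhds t zero_lt_one)
    (Filter.Eventually.of_forall fun s => aestronglyMeasurable_expMoment g v k s)
    (integrable_expMoment g v k t) (F' := fun (s : ℝ) z =>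
      linSymbol v z ^ (k + 1) * Complex.exp (s * linSymbol v z) * phaseFn g z.1 z.2)
    (aestronglyMeasurable_expMoment g v (k + 1) t)
    (Filter.Eventually.of_forall fun z s hs => h z s ?_) hb
    (Filter.Eventually.of_forall fun z s hs => ?_)).2
  · have h1 : |s - t| < 1 := by simpa [Real.dist_eq] using hs
    have h2 : |s| ≤ |s - t| + |t| := by simpa using abs_add_le (s - t) t
    linarith
  · have h1 : HasDerivAt (fun s : ℝ => (s : ℂ) * linSymbol v z) (linSymbol v z) s := by
      simpa using (Complex.ofRealCLM.hasDerivAt (x := s)).mul_const (linSymbol v z)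
    have h2 := ((h1.cexp).const_mul (linSymbol v z ^ k)).mul_const (phaseFn g z.1 z.2)
    have h3 : linSymbol v z ^ (k + 1) * Complex.exp (s * linSymbol v z) * phaseFn g z.1 z.2 =
        linSymbol v z ^ k * (Complex.exp (s * linSymbol v z) * linSymbol v z) *
          phaseFn g z.1 z.2 := by ring
    rw [h3]
    exact h2

/-- By Fubini the p-integral is done first; the factor e^{it b·p} makes it the inverse Fourier
integral at y = t b. -/
theorem expMoment_zero (v : E D × E D) (t : ℝ) :
    expMoment g v 0 t =
      ∫ x : E D, Complex.exp (t * ((inner ℝ v.1 x : ℝ) : ℂ)) * g (x, t • v.2) := by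
  have hint := integrable_expMoment g v 0 t
  unfold expMoment
  rw [Measure.volume_eq_prod] at hint ⊢
  rw [integral_prod _ hint]
  congr 1
  funext x
  rw [← fourierP_phaseTest g, fourierP, ← integral_const_mul]
  congr 1
  funext p
  change _ = _ * (_ * phaseFn g x p)
  rw [pow_zero, one_mul, linSymbol, mul_add, Complex.exp_add, inner_smul_right,
    real_inner_comm v.2 p, mul_assoc]
  congr 3
  push_cast
  ring

end Phase

end GaugeWigner

end

noncomputable section

namespace GaugeWigner

open MeasureTheory Set

/-! ### Integrals depending on a time parameter -/

section TimeDerivatives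

variable {D : ℕ}

/-- Smooth functions of position and time, whose support in the position is locally bounded with
respect to time. -/
structure SpatiallyCompact (φ : E D × ℝ → ℂ) : Prop where
  contDiff : ContDiff ℝ ((⊤ : ℕ∞) : WithTop ℕ∞) φ
  support : ∀ T : ℝ, ∃ K : Set (E D), IsCompact K ∧ ∀ u t, |t| ≤ T → u ∉ K → φ (u, t) = 0

/-- The time derivative. -/
def timeDeriv (φ : E D × ℝ → ℂ) (p : E D × ℝ) : ℂ := fderiv ℝ φ p (0, 1)

theorem hasDerivAt_timeDeriv {φ : E D × ℝ → ℂ} (h : ContDiff ℝ ((⊤ : ℕ∞) : WithTop ℕ∞) φ)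
    (u : E D) (t : ℝ) : HasDerivAt (fun t => φ (u, t)) (timeDeriv φ (u, t)) t := by
  have h1 : HasDerivAt (fun t : ℝ => ((u, t) : E D × ℝ)) (0, 1) t :=
    (hasDerivAt_const t u).prodMk (hasDerivAt_id t)
  exact ((h.differentiable (by simp) (u, t)).hasFDerivAt).comp_hasDerivAt t h1

namespace SpatiallyCompact

variable {φ : E D × ℝ → ℂ}

theorem timeDeriv (h : SpatiallyCompact φ) : SpatiallyCompact (timeDeriv φ) := by
  refine ⟨(h.contDiff.fderiv_right (m := ((⊤ : ℕ∞) : WithTop ℕ∞)) (by simp)).clm_apply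
    contDiff_const, fun T => ?_⟩
  obtain ⟨K, hK, hφ⟩ := h.support (T + 1)
  refine ⟨K, hK, fun u t ht hu => ?_⟩
  have h1 : (fun s => φ (u, s)) =ᶠ[nhds t] fun _ => 0 := by
    filter_upwards [Metric.ball_mem_nhds t zero_lt_one] with s hs
    have h2 : |s - t| < 1 := by simpa [Real.dist_eq] using hs
    have h3 : |s| ≤ |s - t| + |t| := by simpa using abs_add_le (s - t) t
    exact hφ u s (by linarith) hu
  exact (hasDerivAt_timeDeriv h.contDiff u t).unique
    ((hasDerivAt_const t (0 : ℂ)).congr_of_eventuallyEq h1)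

theorem iterate (h : SpatiallyCompact φ) (k : ℕ) :
    SpatiallyCompact (GaugeWigner.timeDeriv^[k] φ) := by
  induction k with
  | zero => exact h
  | succ k ih =>
    rw [Function.iterate_succ_apply']
    exact ih.timeDeriv

theorem hasCompactSupport_slice (h : SpatiallyCompact φ) (t : ℝ) :
    HasCompactSupport fun u => φ (u, t) := by
  obtain ⟨K, hK, hφ⟩ := h.support |t|
  exact HasCompactSupport.intro hK fun u hu => hφ u t le_rfl hu

theorem integrable_slice (h : SpatiallyCompact φ) (t : ℝ) : Integrable fun u => φ (u, t) :=
  (h.contDiff.continuous.comp (f := fun u : E D => (u, t))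
    (by fun_prop)).integrable_of_hasCompactSupport (h.hasCompactSupport_slice t)

theorem hasDerivAt_integral (h : SpatiallyCompact φ) (t : ℝ) :
    HasDerivAt (fun t => ∫ u, φ (u, t)) (∫ u, GaugeWigner.timeDeriv φ (u, t)) t := by
  obtain ⟨K, hK, hφ⟩ := h.timeDeriv.support (|t| + 1)
  obtain ⟨C, hC⟩ := (hK.prod (isCompact_closedBall t 1)).exists_bound_of_continuousOn
    h.timeDeriv.contDiff.continuous.continuousOn
  refine (hasDerivAt_integral_of_dominated_loc_of_deriv_le
    (Metric.ball_mem_nhds t zero_lt_one)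
    (Filter.Eventually.of_forall fun s => (h.integrable_slice s).aestronglyMeasurable)
    (h.integrable_slice t) (F' := fun s u => GaugeWigner.timeDeriv φ (u, s))
    (bound := K.indicator fun _ => C)
    (h.timeDeriv.integrable_slice t).aestronglyMeasurable
    (Filter.Eventually.of_forall fun u s hs => ?_) ((integrable_indicator_iff hK.measurableSet).2
      (by simp [integrableOn_const_iff, hK.measure_lt_top]))
    (Filter.Eventually.of_forall fun u s _ => hasDerivAt_timeDeriv h.contDiff u s)).2
  by_cases hu : u ∈ K
  · rw [indicator_of_mem hu]
    exact hC (u, s) ⟨hu, Metric.ball_subset_closedBall hs⟩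
  · have h1 : |s - t| < 1 := by simpa [Real.dist_eq] using hs
    have h2 : |s| ≤ |s - t| + |t| := by simpa using abs_add_le (s - t) t
    rw [hφ u s (by linarith) hu, indicator_of_notMem hu, norm_zero]

end SpatiallyCompact

/-- Replaces the comparison of Taylor coefficients: two sequences of successive derivatives with the
same start coincide. It is used to read off k-th powers from exponential families without any
convergence of operator exponentials. -/
theorem eq_of_hasDerivAt_succ {Y Z : ℕ → ℝ → ℂ} (hY : ∀ k t, HasDerivAt (Y k) (Y (k + 1) t) t)
    (hZ : ∀ k t, HasDerivAt (Z k) (Z (k + 1) t) t) (h0 : ∀ t, Y 0 t = Z 0 t) (k : ℕ) (t : ℝ) :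
    Y k t = Z k t := by
  induction k generalizing t with
  | zero => exact h0 t
  | succ k ih =>
    have h1 := hY k t
    rw [funext ih] at h1
    exact h1.unique (hZ k t)

variable (g : Test2 D) (v : E D × E D)

/-- The weight `e^{t a·u + t² a·b / 2}`, for `v = (a, b)`. -/
def lineWeight (u : E D) (t : ℝ) : ℂ :=
  Complex.exp ((t * inner ℝ v.1 u + t ^ 2 / 2 * inner ℝ v.1 v.2 : ℝ) : ℂ)

/-- The function `e^{t a·u + t² a·b / 2} g(u + t b / 2, t b)`, for `v = (a, b)`. -/
def lineProfile (p : E D × ℝ) : ℂ :=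
  lineWeight v p.1 p.2 * g (p.1 + (p.2 / 2) • v.2, p.2 • v.2)

theorem hasDerivAt_lineWeight (u : E D) (t : ℝ) :
    HasDerivAt (lineWeight v u) (((inner ℝ v.1 (u + t • v.2) : ℝ) : ℂ) * lineWeight v u t) t := by
  have h1 : HasDerivAt (fun t : ℝ => t * inner ℝ v.1 u + t ^ 2 / 2 * inner ℝ v.1 v.2)
      (inner ℝ v.1 (u + t • v.2)) t := by
    have h2 := ((hasDerivAt_id t).mul_const (inner ℝ v.1 u)).add
      ((((hasDerivAt_id t).pow 2).div_const 2).mul_const (inner ℝ v.1 v.2))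
    refine h2.congr_deriv ?_
    rw [inner_add_right, inner_smul_right]
    simp
  have h2 := (Complex.ofRealCLM.hasDerivAt.scomp t h1).cexp
  refine h2.congr_deriv ?_
  simp [lineWeight, mul_comm]

theorem contDiff_lineWeight :
    ContDiff ℝ ((⊤ : ℕ∞) : WithTop ℕ∞) fun p : E D × ℝ => lineWeight v p.1 p.2 := by
  unfold lineWeight
  have h1 : ContDiff ℝ ((⊤ : ℕ∞) : WithTop ℕ∞) fun p : E D × ℝ => (inner ℝ v.1 p.1 : ℝ) :=
    contDiff_const.inner ℝ contDiff_fst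
  have h2 : ContDiff ℝ ((⊤ : ℕ∞) : WithTop ℕ∞) fun p : E D × ℝ =>
      p.2 * inner ℝ v.1 p.1 + p.2 ^ 2 / 2 * inner ℝ v.1 v.2 :=
    (contDiff_snd.mul h1).add (((contDiff_snd.pow 2).div_const 2).mul contDiff_const)
  exact (Complex.ofRealCLM.contDiff.comp h2).cexp

theorem spatiallyCompact_lineProfile : SpatiallyCompact (lineProfile g v) := by
  refine ⟨?_, fun T => ?_⟩
  · have h1 : ContDiff ℝ ((⊤ : ℕ∞) : WithTop ℕ∞) fun p : E D × ℝ =>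
        ((p.1 + (p.2 / 2) • v.2, p.2 • v.2) : E D × E D) := by fun_prop
    have h2 := g.contDiff.comp h1
    exact (contDiff_lineWeight v).mul h2
  · have hK := g.hasCompactSupport.isCompact.image continuous_fst
    refine ⟨(fun q : E D × ℝ => q.1 - (q.2 / 2) • v.2) ''
      ((Prod.fst '' tsupport g) ×ˢ Metric.closedBall (0 : ℝ) T),
      (hK.prod (isCompact_closedBall _ _)).image (by fun_prop), fun u t ht hu => ?_⟩
    by_contra h
    refine hu ⟨(u + (t / 2) • v.2, t), ⟨⟨_, subset_tsupport _ (right_ne_zero_of_mul h), rfl⟩,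
      by simpa using ht⟩, by simp⟩

theorem integral_timeDeriv_lineProfile (k : ℕ) (t : ℝ) :
    ∫ u, timeDeriv^[k] (lineProfile g v) (u, t) = expMoment g v k t := by
  have hs := spatiallyCompact_lineProfile g v
  refine eq_of_hasDerivAt_succ (Y := fun k t => ∫ u, timeDeriv^[k] (lineProfile g v) (u, t))
    (fun k t => ?_) (fun k t => hasDerivAt_expMoment g v k t) (fun t => ?_) k t
  · have := (hs.iterate k).hasDerivAt_integral t
    rwa [← Function.iterate_succ_apply' timeDeriv k] at this
  -- The translation x = u + tb/2 turns e^{t a·x} into the weight e^{t a·u + t² a·b/2}; this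
  -- midpoint shift is the reason for the quadratic term.
  · rw [expMoment_zero, ← integral_add_right_eq_self (fun x : E D =>
      Complex.exp (t * ((inner ℝ v.1 x : ℝ) : ℂ)) * g (x, t • v.2)) ((t / 2) • v.2)]
    congr 1
    funext u
    simp only [Function.iterate_zero, id, lineProfile, lineWeight]
    congr 2
    rw [inner_add_right, inner_smul_right]
    push_cast
    ring

end TimeDerivatives

/-! ### The powers of `a·x + b·D` and parallel transport -/

section Transport

open scoped Matrix.Norms.Operator

variable {D : ℕ} {ι σ : Type*} [Fintype ι] [DecidableEq ι] [Fintype σ] [DecidableEq σ]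
  {A : Fin D → E D → Matrix ι ι ℂ}
  (hA : ∀ μ i j, ContDiff ℝ ((⊤ : ℕ∞) : WithTop ℕ∞) fun x => A μ x i j)

/-- The function `e^{t a·u + t² a·b / 2} U(u, u + t b) H(u, u + t b)`, for `v = (a, b)`. -/
def transported (A : Fin D → E D → Matrix ι ι ℂ) (v : E D × E D) (u : E D)
    (H : E D × E D → ι × σ → ℂ) (t : ℝ) : ι × σ → ℂ :=
  lineWeight v u t • (wilson A u (u + t • v.2) ⊗ₖ (1 : Matrix σ σ ℂ)).mulVec (H (u, u + t • v.2))

/-- The derivative of U(u, u + tb) contributes -U times i b·A, which completes ∂_b to the covariant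
derivative, and the weight contributes a·(u + tb). Together they are a·x + b·D applied to H at the
moving point. -/
theorem hasDerivAt_transported (v : E D × E D) (u : E D)
    (H : smoothFn (E D × E D) (ι × σ → ℂ)) (t : ℝ) :
    HasDerivAt (transported A v u H.1) (transported A v u (linOp hA v H).1 t) t := by
  let act : Matrix ι ι ℂ →L[ℝ] ((ι × σ → ℂ) →L[ℝ] (ι × σ → ℂ)) :=
    (ContinuousLinearMap.restrictScalarsL ℂ (ι × σ → ℂ) (ι × σ → ℂ) ℝ ℝ).comp
      (LinearMap.toContinuousLinearMap (gaugeAct (ι := ι) σ))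
  have hact : ∀ M w, act M w = (M ⊗ₖ (1 : Matrix σ σ ℂ)).mulVec w := fun _ _ => rfl
  have h1 : HasDerivAt (fun t : ℝ => act (wilson A u (u + t • v.2)))
      (act (-(wilson A u (u + t • v.2) * gaugeGen A v.2 (u + t • v.2)))) t :=
    act.hasFDerivAt.comp_hasDerivAt t (hasDerivAt_wilson_line_symm hA u v.2 t)
  have h2 : HasDerivAt (fun t : ℝ => H.1 (u, u + t • v.2))
      (fderiv ℝ H.1 (u, u + t • v.2) (0, v.2)) t := by
    have h3 : HasDerivAt (fun t : ℝ => ((u, u + t • v.2) : E D × E D)) (0, v.2) t := by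
      refine (hasDerivAt_const t u).prodMk ?_
      simpa using ((hasDerivAt_id t).smul_const v.2).const_add u
    exact (smoothFn.differentiable H (u, u + t • v.2)).hasFDerivAt.comp_hasDerivAt t h3
  have h3 := (hasDerivAt_lineWeight v u t).smul (h1.clm_apply h2)
  refine h3.congr_deriv ?_
  unfold transported
  rw [linOp_apply, map_neg, _root_.neg_apply]
  simp only [hact, Matrix.mulVec_add, Matrix.mulVec_sub, Matrix.mulVec_smul, smul_add, smul_sub]
  rw [Matrix.mulVec_mulVec, ← Matrix.mul_kronecker_mul, one_mul,
    smul_neg, mul_smul, smul_comm (lineWeight v u t) ((inner ℝ v.1 _ : ℝ) : ℂ)]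
  abel

/-- The `k`-th time derivative at `0` of the transported function is given by the `k`-th power of
`a·x + b·D`. -/
theorem sum_spinAct_linOp_pow {κ : Type*} [Fintype κ] (v : E D × E D) (u : E D)
    (H : κ → smoothFn (E D × E D) (ι × σ → ℂ)) (M : Matrix σ σ ℂ) (comp : κ → ι × σ)
    {φ : E D × ℝ → ℂ} (hφ : ContDiff ℝ ((⊤ : ℕ∞) : WithTop ℕ∞) φ)
    (h : ∀ t, ∑ c, spinAct M (transported A v u (H c).1 t) (comp c) = φ (u, t)) (k : ℕ) :
    ∑ c, spinAct M ((linOp hA v ^ k) (H c) |>.1 (u, u)) (comp c) = timeDeriv^[k] φ (u, 0) := by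
  have hφk : ∀ k, ContDiff ℝ ((⊤ : ℕ∞) : WithTop ℕ∞) (timeDeriv^[k] φ) := fun k => by
    induction k with
    | zero => exact hφ
    | succ k ih =>
      rw [Function.iterate_succ_apply']
      exact (ih.fderiv_right (m := ((⊤ : ℕ∞) : WithTop ℕ∞)) (by simp)).clm_apply contDiff_const
  have := eq_of_hasDerivAt_succ
    (Y := fun k t => ∑ c, spinAct M (transported A v u ((linOp hA v ^ k) (H c)).1 t) (comp c))
    (Z := fun k t => timeDeriv^[k] φ (u, t)) (fun k t => ?_) (fun k t => ?_) h k 0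
  -- At t = 0 the weight and the transport are both trivial.
  · simpa [transported, lineWeight, wilson_self hA] using this
  · refine HasDerivAt.fun_sum fun c _ => ?_
    have h1 := hasDerivAt_transported hA v u ((linOp hA v ^ k) (H c)) t
    rw [← Module.End.mul_apply, ← pow_succ'] at h1
    exact hasDerivAt_pi.1 ((spinAct M).hasFDerivAt.comp_hasDerivAt t h1) (comp c)
  · have := hasDerivAt_timeDeriv (hφk k) u t
    rwa [← Function.iterate_succ_apply' timeDeriv k] at this

end Transport

end GaugeWigner

end

noncomputable section

namespace GaugeWigner

open MeasureTheory Set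

/-! ### The generalized Wigner transform -/

section WignerTransform

variable {D : ℕ} {ι σ : Type*} [Fintype ι] [DecidableEq ι] [Fintype σ] [DecidableEq σ]
  {A : Fin D → E D → Matrix ι ι ℂ}
  (hA : ∀ μ i j, ContDiff ℝ ((⊤ : ℕ∞) : WithTop ℕ∞) fun x => A μ x i j)

/-- The midpoint and the difference of two points. -/
def midDiff (z : E D × E D) : E D × E D := ((1 / 2 : ℝ) • (z.1 + z.2), z.2 - z.1)

/-- The two points with given midpoint and difference. -/
def ofMidDiff (w : E D × E D) : E D × E D :=
  (w.1 - (1 / 2 : ℝ) • w.2, w.1 + (1 / 2 : ℝ) • w.2)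

theorem ofMidDiff_midDiff (z : E D × E D) : ofMidDiff (midDiff z) = z := by
  refine Prod.ext ?_ ?_
  · simp only [ofMidDiff, midDiff]
    module
  · simp only [ofMidDiff, midDiff]
    module

theorem midDiff_ofMidDiff (w : E D × E D) : midDiff (ofMidDiff w) = w := by
  refine Prod.ext ?_ ?_
  · simp only [ofMidDiff, midDiff]
    module
  · simp only [ofMidDiff, midDiff]
    module

theorem contDiff_midDiff :
    ContDiff ℝ ((⊤ : ℕ∞) : WithTop ℕ∞) (midDiff : E D × E D → E D × E D) := by
  unfold midDiff
  fun_prop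

theorem contDiff_ofMidDiff :
    ContDiff ℝ ((⊤ : ℕ∞) : WithTop ℕ∞) (ofMidDiff : E D × E D → E D × E D) := by
  unfold ofMidDiff
  fun_prop

omit [Fintype σ] in
open scoped Matrix.Norms.Operator in
include hA in
theorem contDiff_wilson_kronecker {F : Type*} [NormedAddCommGroup F] [NormedSpace ℝ F]
    {p q : F → E D} (hp : ContDiff ℝ ((⊤ : ℕ∞) : WithTop ℕ∞) p)
    (hq : ContDiff ℝ ((⊤ : ℕ∞) : WithTop ℕ∞) q) (a b : ι × σ) :
    ContDiff ℝ ((⊤ : ℕ∞) : WithTop ℕ∞) fun z =>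
      (wilson A (p z) (q z) ⊗ₖ (1 : Matrix σ σ ℂ)) a b := by
  simp only [Matrix.kroneckerMap_apply]
  have h := (contDiff_wilson hA).comp (hp.prodMk hq)
  exact (contDiff_entry h a.1 b.1).mul contDiff_const

variable (A)

/-- The test function with which `⟨u|X̂|v⟩` is paired in the Wigner transform. -/
def wignerTest (g : Test2 D) (α c d β : ι × σ) : Test2 D := toTest fun z : E D × E D =>
  (wilson A ((1 / 2 : ℝ) • (z.1 + z.2)) z.1 ⊗ₖ (1 : Matrix σ σ ℂ)) α c
    * g (midDiff z)
    * (wilson A z.2 ((1 / 2 : ℝ) • (z.1 + z.2)) ⊗ₖ (1 : Matrix σ σ ℂ)) d β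

theorem wigner_phaseTest (X : Kernel D ι σ) (g : Test2 D) (α β : ι × σ) :
    wigner A X (phaseTest g) α β = ∑ c, ∑ d, X c d (wignerTest A g α c d β) := by
  simp only [wigner, Matrix.of_apply, fourierP_phaseTest]
  rfl

variable {A}

omit [Fintype σ] in
include hA in
theorem wignerTest_apply (g : Test2 D) (α c d β : ι × σ) (z : E D × E D) :
    wignerTest A g α c d β z =
      (wilson A ((1 / 2 : ℝ) • (z.1 + z.2)) z.1 ⊗ₖ (1 : Matrix σ σ ℂ)) α c
        * g (midDiff z)
        * (wilson A z.2 ((1 / 2 : ℝ) • (z.1 + z.2)) ⊗ₖ (1 : Matrix σ σ ℂ)) d β := by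
  refine toTest_apply ?_ ?_ z
  · have h1 := g.contDiff.comp (contDiff_midDiff (D := D))
    exact ((contDiff_wilson_kronecker hA (by fun_prop) contDiff_fst α c).mul h1).mul
      (contDiff_wilson_kronecker hA contDiff_snd (by fun_prop) d β)
  · refine HasCompactSupport.intro
      (g.hasCompactSupport.isCompact.image contDiff_ofMidDiff.continuous) fun z hz => ?_
    have : g (midDiff z) = 0 := by
      by_contra h
      exact hz ⟨_, subset_tsupport _ h, ofMidDiff_midDiff z⟩
    simp [this]

variable (A) in
/-- A phase-space test function from which a component of `h` is recovered by undoing the parallel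
transports in the Wigner transform. -/
def unwignerTest (h : Test2 D) (a α β b : ι × σ) : Test2 D := toTest fun w : E D × E D =>
  (wilson A (ofMidDiff w).1 w.1 ⊗ₖ (1 : Matrix σ σ ℂ)) a α
    * h (ofMidDiff w)
    * (wilson A w.1 (ofMidDiff w).2 ⊗ₖ (1 : Matrix σ σ ℂ)) β b

omit [Fintype σ] in
include hA in
theorem unwignerTest_midDiff (h : Test2 D) (a α β b : ι × σ) (z : E D × E D) :
    unwignerTest A h a α β b (midDiff z) =
      (wilson A z.1 ((1 / 2 : ℝ) • (z.1 + z.2)) ⊗ₖ (1 : Matrix σ σ ℂ)) a α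
        * h z
        * (wilson A ((1 / 2 : ℝ) • (z.1 + z.2)) z.2 ⊗ₖ (1 : Matrix σ σ ℂ)) β b := by
  refine (toTest_apply ?_ ?_ (midDiff z)).trans ?_
  · have h1 := h.contDiff.comp (contDiff_ofMidDiff (D := D))
    exact ((contDiff_wilson_kronecker hA contDiff_ofMidDiff.fst contDiff_fst a α).mul h1).mul
      (contDiff_wilson_kronecker hA contDiff_fst contDiff_ofMidDiff.snd β b)
  · refine HasCompactSupport.intro
      (h.hasCompactSupport.isCompact.image contDiff_midDiff.continuous) fun w hw => ?_
    have : h (ofMidDiff w) = 0 := by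
      by_contra h'
      exact hw ⟨_, subset_tsupport _ h', midDiff_ofMidDiff w⟩
    simp [this]
  · simp only [ofMidDiff_midDiff]
    rfl

include hA in
theorem wilson_kronecker_mul_symm (x w : E D) :
    (wilson A x w ⊗ₖ (1 : Matrix σ σ ℂ)) * (wilson A w x ⊗ₖ (1 : Matrix σ σ ℂ)) = 1 := by
  rw [← Matrix.mul_kronecker_mul, wilson_mul_wilson_symm hA, one_mul, Matrix.one_kronecker_one]

-- The Wigner transform surrounds the kernel by U(m, z₁) and U(z₂, m), with m the midpoint.
-- Multiplying by the opposite transports and summing over the outer indices isolates a single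
-- matrix element.
include hA in
theorem sum_wignerTest_unwignerTest (h : Test2 D) (a b c d : ι × σ) :
    ∑ α, ∑ β, wignerTest A (unwignerTest A h a α β b) α c d β = if a = c ∧ d = b then h else 0 := by
  ext z
  rw [_root_.sum_apply]
  simp only [_root_.sum_apply, wignerTest_apply hA, unwignerTest_midDiff hA]
  set m := (1 / 2 : ℝ) • (z.1 + z.2)
  have h1 := congrFun (congrFun (wilson_kronecker_mul_symm (σ := σ) hA z.1 m) a) c
  have h2 := congrFun (congrFun (wilson_kronecker_mul_symm (σ := σ) hA z.2 m) d) b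
  rw [Matrix.mul_apply] at h1 h2
  calc _ = (∑ α, (wilson A z.1 m ⊗ₖ (1 : Matrix σ σ ℂ)) a α *
          (wilson A m z.1 ⊗ₖ (1 : Matrix σ σ ℂ)) α c) * h z *
        ∑ β, (wilson A z.2 m ⊗ₖ (1 : Matrix σ σ ℂ)) d β *
          (wilson A m z.2 ⊗ₖ (1 : Matrix σ σ ℂ)) β b := by
        simp only [Finset.sum_mul, Finset.mul_sum]
        rw [Finset.sum_comm]
        refine Finset.sum_congr rfl fun β _ => Finset.sum_congr rfl fun α _ => ?_
        ring
    _ = _ := by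
        rw [h1, h2, Matrix.one_apply, Matrix.one_apply]
        by_cases hac : a = c <;> by_cases hdb : d = b <;> simp [hac, hdb]

include hA in
/-- An operator is determined by its Wigner transform. -/
theorem wigner_injective {X Y : Kernel D ι σ} (hXY : wigner A X = wigner A Y) : X = Y := by
  have key : ∀ (X : Kernel D ι σ) (h : Test2 D) (a b : ι × σ),
      ∑ α, ∑ β, wigner A X (phaseTest (unwignerTest A h a α β b)) α β = X a b h := by
    intro X h a b
    simp only [wigner_phaseTest]
    calc _ = ∑ c, ∑ d, X c d (∑ α, ∑ β, wignerTest A (unwignerTest A h a α β b) α c d β) := by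
          simp only [map_sum]
          rw [Finset.sum_congr rfl fun α _ => Finset.sum_comm, Finset.sum_comm]
          refine Finset.sum_congr rfl fun c _ => ?_
          rw [Finset.sum_congr rfl fun α _ => Finset.sum_comm, Finset.sum_comm]
      _ = X a b h := by
          simp only [sum_wignerTest_unwignerTest hA]
          rw [Finset.sum_eq_single a, Finset.sum_eq_single b]
          · simp
          · intro d _ hd
            simp [hd]
          · simp
          · intro c _ hc
            simp [hc.symm]
          · simp
  funext a b
  ext h
  rw [← key X, ← key Y, hXY]

end WignerTransform

end GaugeWigner

end

noncomputable section

namespace GaugeWigner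

open MeasureTheory Set

/-! ### The symbol of the Dirac operator -/

section DiracSymbol

variable {D : ℕ}

theorem linSymbol_add (v w z : E D × E D) :
    linSymbol (v + w) z = linSymbol v z + linSymbol w z := by
  simp only [linSymbol, Prod.fst_add, Prod.snd_add, inner_add_left, Complex.ofReal_add]
  ring

theorem linSymbol_sum {κ : Type*} (s : Finset κ) (v : κ → E D × E D) (z : E D × E D) :
    linSymbol (∑ i ∈ s, v i) z = ∑ i ∈ s, linSymbol (v i) z :=
  map_sum (AddMonoidHom.mk' (fun v => linSymbol v z) fun v w => linSymbol_add v w z) v s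

theorem sum_orderedWord_eq {n m : ℕ} (ν : Fin n → Fin D) (μ : Fin m → Fin D) (z : E D × E D) :
    ∑ s : Equiv.Perm (Fin (n + m)), orderedWord (fun ν : Fin D => ((z.1 ν : ℝ) : ℂ))
      (fun μ => Complex.I * ((z.2 μ : ℝ) : ℂ)) ν μ s =
    ∑ C : Finset (Fin (n + m)), (-1 : ℤ) ^ C.card •
      linSymbol (∑ i ∈ Cᶜ, letterVec ν μ i) z ^ (n + m) := by
  have h1 : ∀ i, Fin.append ((fun ν : Fin D => ((z.1 ν : ℝ) : ℂ)) ∘ ν)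
      ((fun μ => Complex.I * ((z.2 μ : ℝ) : ℂ)) ∘ μ) i = linSymbol (letterVec ν μ i) z := by
    intro i
    rw [letterVec, comp_append (fun v => linSymbol v z)]
    congr 1
    · funext j
      simp [linSymbol, EuclideanSpace.inner_single_left]
    · funext j
      simp [linSymbol, EuclideanSpace.inner_single_left]
  unfold orderedWord
  refine (sum_perm_prod_ofFn (R := ℂ) _).trans ?_
  simp only [h1, linSymbol_sum]

theorem norm_sum_orderedWord_le {n m : ℕ} (ν : Fin n → Fin D) (μ : Fin m → Fin D)
    (z : E D × E D) :
    ‖∑ s : Equiv.Perm (Fin (n + m)), orderedWord (fun ν : Fin D => ((z.1 ν : ℝ) : ℂ))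
      (fun μ => Complex.I * ((z.2 μ : ℝ) : ℂ)) ν μ s‖ ≤
    (n + m).factorial * (‖z.1‖ ^ n * ‖z.2‖ ^ m) := by
  refine (norm_sum_le _ _).trans ((Finset.sum_le_card_nsmul _ _ (‖z.1‖ ^ n * ‖z.2‖ ^ m)
    fun s _ => ?_).trans_eq ?_)
  · rw [orderedWord_of_comm, norm_mul, norm_prod, norm_prod]
    refine mul_le_mul ?_ ?_ (by positivity) (by positivity)
    · refine (Finset.prod_le_prod (fun _ _ => norm_nonneg _) (g := fun _ => ‖z.1‖)
        fun i _ => ?_).trans_eq (by simp)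
      rw [Complex.norm_real]
      exact PiLp.norm_apply_le z.1 (ν i)
    · refine (Finset.prod_le_prod (fun _ _ => norm_nonneg _) (g := fun _ => ‖z.2‖)
        fun i _ => ?_).trans_eq (by simp)
      rw [norm_mul, Complex.norm_I, one_mul, Complex.norm_real]
      exact PiLp.norm_apply_le z.2 (μ i)
  · simp [Fintype.card_perm]

variable {σ : Type*} [Fintype σ]

/-- The terms of the function `Q(x, p)`. -/
def symbolTerm (f : Coeffs D σ) (k : ℕ × ℕ) (z : E D × E D) : Matrix σ σ ℂ :=
  ∑ ν, ∑ μ, ∑ s : Equiv.Perm (Fin (k.1 + k.2)),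
    (orderedWord (fun ν : Fin D => ((z.1 ν : ℝ) : ℂ))
      (fun μ => Complex.I * ((z.2 μ : ℝ) : ℂ)) ν μ s) • f k.1 k.2 ν μ

variable {f : Coeffs D σ}

omit [Fintype σ] in
theorem symbolTerm_apply (k : ℕ × ℕ) (z : E D × E D) (a b : σ) :
    symbolTerm f k z a b = ∑ ν, ∑ μ, (∑ s : Equiv.Perm (Fin (k.1 + k.2)),
      orderedWord (fun ν : Fin D => ((z.1 ν : ℝ) : ℂ)) (fun μ => Complex.I * ((z.2 μ : ℝ) : ℂ))
        ν μ s) * f k.1 k.2 ν μ a b := by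
  simp only [symbolTerm, Matrix.sum_apply, Matrix.smul_apply, smul_eq_mul, Finset.sum_mul]

omit [Fintype σ] in
theorem continuous_symbolTerm (k : ℕ × ℕ) (a b : σ) : Continuous fun z => symbolTerm f k z a b := by
  simp only [symbolTerm_apply, sum_orderedWord_eq]
  refine continuous_finsetSum _ fun ν _ => continuous_finsetSum _ fun μ _ =>
    (continuous_finsetSum _ fun C _ => ?_).mul continuous_const
  exact ((continuous_linSymbol _).pow _).const_smul _

/-- The majorant of the operator series also controls the symbol series, with ‖x‖ and ‖p‖ as the
costs of the letters. -/
theorem norm_symbolTerm_le (k : ℕ × ℕ) (z : E D × E D) (a b : σ) :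
    ‖symbolTerm f k z a b‖ ≤ diracBound f ‖z.1‖ ‖z.2‖ k := by
  rw [symbolTerm_apply]
  refine norm_sum_le_of_le _ fun ν _ => norm_sum_le_of_le _ fun μ _ => ?_
  rw [norm_mul, mul_comm]
  refine mul_le_mul ?_ (norm_sum_orderedWord_le ν μ z) (norm_nonneg _) (by positivity)
  exact (Finset.single_le_sum (f := fun b => ‖f k.1 k.2 ν μ a b‖) (fun _ _ => norm_nonneg _)
    (Finset.mem_univ b)).trans (Finset.single_le_sum (f := fun a => ∑ b, ‖f k.1 k.2 ν μ a b‖)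
      (fun _ _ => by positivity) (Finset.mem_univ a))

theorem summable_symbolTerm (hf : f.Convergent) (z : E D × E D) (a b : σ) :
    Summable fun k => symbolTerm f k z a b :=
  .of_norm_bounded (summable_diracBound hf (norm_nonneg _) (norm_nonneg _))
    fun k => norm_symbolTerm_le k z a b

theorem diracSymbol_apply (hf : f.Convergent) (x p : E D) (a b : σ) :
    diracSymbol f x p a b = ∑' k, symbolTerm f k (x, p) a b := by
  have h1 : Summable fun k => symbolTerm f k (x, p) :=
    Pi.summable.2 fun a => Pi.summable.2 fun b => summable_symbolTerm hf (x, p) a b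
  change (∑' k, symbolTerm f k (x, p)) a b = _
  exact (congrFun (tsum_apply h1) b).trans (tsum_apply (Pi.summable.1 h1 a))

theorem diracBound_le {M : ℕ} (hM : ∀ n m ν μ, M < m → f n m ν μ = 0) {ρ R q : ℝ}
    (hρ : 0 ≤ ρ) (h : ρ ≤ R) (hq : 0 ≤ q) (k : ℕ × ℕ) :
    diracBound f ρ q k ≤ diracBound f R 1 k * (1 + q) ^ M := by
  unfold diracBound
  rw [Finset.sum_mul]
  refine Finset.sum_le_sum fun ν _ => ?_
  rw [Finset.sum_mul]
  refine Finset.sum_le_sum fun μ _ => ?_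
  by_cases hk : M < k.2
  · simp [hM _ _ ν μ hk]
  · have h2 : q ^ k.2 ≤ (1 + q) ^ M :=
      (pow_le_pow_left₀ hq (by linarith) _).trans
        (pow_le_pow_right₀ (by linarith) (not_lt.1 hk))
    rw [mul_assoc, mul_assoc, mul_assoc, one_pow, one_mul]
    have h3 : 0 ≤ R := hρ.trans h
    gcongr

/-- The pairing of `Q(x, p)` with a phase-space test function, term by term. -/
theorem hasSum_integral_symbolTerm (hf : f.Convergent) (g : Test2 D) (a b : σ) :
    HasSum (fun k => ∫ z, symbolTerm f k z a b * phaseFn g z.1 z.2)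
      (∫ z : E D × E D, diracSymbol f z.1 z.2 a b * phaseFn g z.1 z.2) := by
  obtain ⟨M, hM⟩ := hf.1
  obtain ⟨R, hR⟩ := (g.hasCompactSupport.isCompact.image
    continuous_fst).exists_bound_of_continuousOn (f := fun x => x) continuousOn_id
  -- The majorant separates into a summable function of k and an integrable function of z: the
  -- degree in p is at most M for every k, and x is bounded on the support of Φ.
  have hb : ∀ k z, ‖symbolTerm f k z a b * phaseFn g z.1 z.2‖ ≤
      diracBound f |R| 1 k * ((1 + ‖z.2‖) ^ M * ‖phaseFn g z.1 z.2‖) := by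
    intro k z
    by_cases hz : z.1 ∈ Prod.fst '' tsupport g
    · rw [norm_mul, ← mul_assoc]
      exact mul_le_mul_of_nonneg_right ((norm_symbolTerm_le k z a b).trans
        (diracBound_le hM (norm_nonneg _) ((hR _ hz).trans (le_abs_self R)) (norm_nonneg _) k))
        (norm_nonneg _)
    · simp [phaseFn_eq_zero g hz]
  have hint : ∀ k, Integrable fun z => symbolTerm f k z a b * phaseFn g z.1 z.2 := fun k =>
    ((integrable_pow_mul_phaseFn g M).const_mul _).mono'
      ((continuous_symbolTerm k a b).stronglyMeasurable.mul
        (stronglyMeasurable_phaseFn g)).aestronglyMeasurable (Filter.Eventually.of_forall (hb k))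
  have h1 := hasSum_integral_of_summable_integral_norm hint (.of_nonneg_of_le
    (fun k => integral_nonneg fun z => norm_nonneg _)
    (fun k => (integral_mono (hint k).norm ((integrable_pow_mul_phaseFn g M).const_mul _)
      (hb k)).trans_eq (integral_const_mul _ _))
    ((summable_diracBound hf (abs_nonneg R) zero_le_one).mul_right _))
  simpa only [tsum_mul_right, ← diracSymbol_apply hf] using h1

omit [Fintype σ] in
theorem integral_symbolTerm (g : Test2 D) (k : ℕ × ℕ) (a b : σ) :
    ∫ z, symbolTerm f k z a b * phaseFn g z.1 z.2 =
      ∑ ν, ∑ μ, f k.1 k.2 ν μ a b * ∑ C : Finset (Fin (k.1 + k.2)), (-1 : ℤ) ^ C.card •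
        expMoment g (∑ i ∈ Cᶜ, letterVec ν μ i) (k.1 + k.2) 0 := by
  have hint : ∀ v, Integrable fun z => linSymbol v z ^ (k.1 + k.2) * phaseFn g z.1 z.2 := by
    intro v
    simpa using integrable_expMoment g v (k.1 + k.2) 0
  have h1 : ∀ v, expMoment g v (k.1 + k.2) 0 =
      ∫ z, linSymbol v z ^ (k.1 + k.2) * phaseFn g z.1 z.2 := by
    intro v
    simp [expMoment]
  have h2 : ∀ z, symbolTerm f k z a b * phaseFn g z.1 z.2 = ∑ ν, ∑ μ, f k.1 k.2 ν μ a b *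
      ∑ C : Finset (Fin (k.1 + k.2)), (-1 : ℤ) ^ C.card •
        (linSymbol (∑ i ∈ Cᶜ, letterVec ν μ i) z ^ (k.1 + k.2) * phaseFn g z.1 z.2) := by
    intro z
    rw [symbolTerm_apply]
    simp only [sum_orderedWord_eq, Finset.sum_mul, ← smul_mul_assoc]
    refine Finset.sum_congr rfl fun ν _ => Finset.sum_congr rfl fun μ _ => ?_
    rw [Finset.mul_sum]
    refine Finset.sum_congr rfl fun C _ => ?_
    ring
  have h4 : ∀ v (r : ℤ), Integrable fun z =>
      r • (linSymbol v z ^ (k.1 + k.2) * phaseFn g z.1 z.2) := fun v r => (hint v).smul r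
  have h3 : ∀ (ν : Fin k.1 → Fin D) (μ : Fin k.2 → Fin D), Integrable fun z =>
      ∑ C : Finset (Fin (k.1 + k.2)), (-1 : ℤ) ^ C.card •
        (linSymbol (∑ i ∈ Cᶜ, letterVec ν μ i) z ^ (k.1 + k.2) * phaseFn g z.1 z.2) :=
    fun ν μ => integrable_finsetSum _ fun C _ => h4 _ _
  simp only [h2, h1]
  rw [integral_finsetSum _ fun ν _ => integrable_finsetSum _ fun μ _ => (h3 ν μ).const_mul _]
  refine Finset.sum_congr rfl fun ν _ => ?_
  rw [integral_finsetSum _ fun μ _ => (h3 ν μ).const_mul _]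
  refine Finset.sum_congr rfl fun μ _ => ?_
  rw [integral_const_mul, integral_finsetSum _ fun C _ => h4 _ _]
  congr 1
  refine Finset.sum_congr rfl fun C _ => ?_
  simp only [zsmul_eq_mul, integral_const_mul]

end DiracSymbol

end GaugeWigner

end

noncomputable section

namespace GaugeWigner

open MeasureTheory Set

/-! ### The Weyl symbols of the Dirac operator and of the identity -/

section WeylSymbols

variable {D : ℕ} {ι σ : Type*} [Fintype ι] [DecidableEq ι] [Fintype σ] [DecidableEq σ]
  {A : Fin D → E D → Matrix ι ι ℂ}
  (hA : ∀ μ i j, ContDiff ℝ ((⊤ : ℕ∞) : WithTop ℕ∞) fun x => A μ x i j)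

theorem midDiff_line (u b : E D) (t : ℝ) :
    midDiff (u, u + t • b) = (u + (t / 2) • b, t • b) := by
  refine Prod.ext ?_ ?_
  · simp only [midDiff]
    module
  · simp only [midDiff]
    module

-- Here the gauge field disappears. Starting from the midpoint, the test function brings the
-- transports to u and from u + tb; with U(u, u + tb) between them they retrace a line and compose
-- to 1. The spinor matrix acts on the other tensor factor and commutes with them.
include hA in
theorem sum_spinAct_transported_wignerTest (g : Test2 D) (v : E D × E D) (F : Matrix σ σ ℂ)
    (α β : ι × σ) (u : E D) (t : ℝ) :
    ∑ κ : (ι × σ) × (ι × σ), spinAct F (transported A v u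
      (component κ.2 (wignerTest A g α κ.1 κ.2 β)).1 t) κ.1 =
    ((1 : Matrix ι ι ℂ) ⊗ₖ F) α β * lineProfile g v (u, t) := by
  set b := v.2 with hb
  have hmid : (1 / 2 : ℝ) • (u + (u + t • b)) = u + (t / 2) • b :=
    congrArg Prod.fst (midDiff_line u b t)
  set P := wilson A (u + (t / 2) • b) u ⊗ₖ (1 : Matrix σ σ ℂ) with hP
  set W := wilson A u (u + t • b) ⊗ₖ (1 : Matrix σ σ ℂ) with hW
  set Q := wilson A (u + t • b) (u + (t / 2) • b) ⊗ₖ (1 : Matrix σ σ ℂ) with hQ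
  set F' := (1 : Matrix ι ι ℂ) ⊗ₖ F with hF
  have h1 : ∀ c d, spinAct F (transported A v u
      (component d (wignerTest A g α c d β)).1 t) c =
      lineProfile g v (u, t) * (P α c * (F' * W) c d * Q d β) := by
    intro c d
    rw [spinAct_apply, transported, component_apply, wignerTest_apply hA, ← hb, midDiff_line,
      Matrix.mulVec_smul, Matrix.mulVec_mulVec, Matrix.mulVec_single, lineProfile]
    simp only [hmid, Pi.smul_apply, Matrix.col_apply, smul_eq_mul, MulOpposite.smul_eq_mul_unop,
      MulOpposite.unop_op]
    simp only [← hP, ← hQ, ← hW, ← hF]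
    ring
  have h2 : P * (F' * W) * Q = F' := by
    simp only [hP, hQ, hW, hF, ← Matrix.mul_kronecker_mul, one_mul, mul_one, mul_assoc]
    rw [wilson_mul_wilson_mul_wilson hA]
  rw [Fintype.sum_prod_type]
  simp only [h1]
  rw [← congrFun (congrFun h2 α) β, Matrix.mul_apply, Finset.sum_mul, Finset.sum_comm]
  refine Finset.sum_congr rfl fun d _ => ?_
  rw [Matrix.mul_apply, Finset.sum_mul, Finset.sum_mul]
  exact Finset.sum_congr rfl fun c _ => by ring

theorem iterate_timeDeriv_const_mul {φ : E D × ℝ → ℂ}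
    (h : ContDiff ℝ ((⊤ : ℕ∞) : WithTop ℕ∞) φ) (c : ℂ) (k : ℕ) :
    timeDeriv^[k] (fun p => c * φ p) = fun p => c * timeDeriv^[k] φ p := by
  induction k generalizing φ with
  | zero => rfl
  | succ k ih =>
    have h1 : timeDeriv (fun p => c * φ p) = fun p => c * timeDeriv φ p := by
      funext p
      rw [timeDeriv, fderiv_const_mul (h.differentiable (by simp) p)]
      rfl
    simp only [Function.iterate_succ_apply, h1]
    exact ih ((h.fderiv_right (m := ((⊤ : ℕ∞) : WithTop ℕ∞)) (by simp)).clm_apply contDiff_const)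

variable {f : Coeffs D σ}

/-- After polarization, each power (a·x + b·D)^{n+m} on the diagonal becomes a time derivative at 0
of a gauge-independent scalar function. -/
theorem sum_diracTerm_wignerTest (g : Test2 D) (α β : ι × σ) (k : ℕ × ℕ) (u : E D) :
    ∑ κ : (ι × σ) × (ι × σ),
      diracTerm hA f (component κ.2 (wignerTest A g α κ.1 κ.2 β)) k (u, u) κ.1 =
    ∑ ν, ∑ μ, ((1 : Matrix ι ι ℂ) ⊗ₖ f k.1 k.2 ν μ) α β *
      ∑ C : Finset (Fin (k.1 + k.2)), (-1 : ℤ) ^ C.card •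
        timeDeriv^[k.1 + k.2] (lineProfile g (∑ i ∈ Cᶜ, letterVec ν μ i)) (u, 0) := by
  have h1 : ∀ (F : Matrix σ σ ℂ) v, ∑ κ : (ι × σ) × (ι × σ), spinAct F
      ((linOp hA v ^ (k.1 + k.2)) (component κ.2 (wignerTest A g α κ.1 κ.2 β)) |>.1 (u, u)) κ.1 =
      ((1 : Matrix ι ι ℂ) ⊗ₖ F) α β * timeDeriv^[k.1 + k.2] (lineProfile g v) (u, 0) := by
    intro F v
    have hv := (spatiallyCompact_lineProfile g v).contDiff
    refine (sum_spinAct_linOp_pow hA v u _ F Prod.fst (contDiff_const.mul hv)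
      (sum_spinAct_transported_wignerTest hA g v F α β u) _).trans ?_
    rw [iterate_timeDeriv_const_mul hv]
  have h2 : ∀ (ν : Fin k.1 → Fin D) (μ : Fin k.2 → Fin D)
      (H : smoothFn (E D × E D) (ι × σ → ℂ)), (symOp hA ν μ H).1 (u, u) =
      ∑ C : Finset (Fin (k.1 + k.2)), (-1 : ℤ) ^ C.card •
        ((linOp hA (∑ i ∈ Cᶜ, letterVec ν μ i) ^ (k.1 + k.2)) H).1 (u, u) := by
    intro ν μ H
    rw [symOp_eq, LinearMap.sum_apply, Submodule.coe_sum, Finset.sum_apply]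
    rfl
  simp only [diracTerm, Finset.sum_apply, h2, map_sum, map_zsmul, Pi.smul_apply]
  rw [Finset.sum_comm]
  refine Finset.sum_congr rfl fun ν _ => ?_
  rw [Finset.sum_comm]
  refine Finset.sum_congr rfl fun μ _ => ?_
  rw [Finset.sum_comm, Finset.mul_sum]
  refine Finset.sum_congr rfl fun C _ => ?_
  rw [← Finset.smul_sum, h1, mul_smul_comm]

/-- Sum and integral are interchanged because all terms live on the same compact set, with summable
sup norms. -/
theorem hasSum_integral_diracTerm (hf : f.Convergent) {H : smoothFn (E D × E D) (ι × σ → ℂ)}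
    (hc : HasCompactSupport H.1) (c : ι × σ) :
    (∀ k, Integrable fun u => diracTerm hA f H k (u, u) c) ∧
    HasSum (fun k => ∫ u, diracTerm hA f H k (u, u) c) (∫ u, dirac₂ hA f H (u, u) c) := by
  obtain ⟨v, hv, h⟩ := exists_summable_bound_diracTerm hA hf hc 0
  have hK := hc.isCompact
  have hint : ∀ k, Integrable fun u => diracTerm hA f H k (u, u) c := fun k =>
    integrable_diag (F := fun z => diracTerm hA f H k z c)
      ((continuous_apply c).comp (h k).contDiff.continuous)
      (HasCompactSupport.intro hK fun z hz => by simp [(h k).eq_zero hz])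
  refine ⟨hint, ?_⟩
  have hnorm : ∀ k z, ‖diracTerm hA f H k z c‖ ≤ v k := fun k z =>
    (norm_le_pi_norm _ c).trans ((h k).norm_le z)
  have h1 := hasSum_integral_of_summable_integral_norm hint (.of_norm_bounded
    (hv.mul_left (volume.real (Prod.fst '' tsupport H.1))) fun k => by
      have h2 := norm_integral_diag_le (F := fun z => ((‖diracTerm hA f H k z c‖ : ℝ) : ℂ)) hK
        (fun z hz => by simp [(h k).eq_zero hz]) (C := v k)
        (fun z => by simpa using hnorm k z)
      rwa [integral_complex_ofReal, Complex.norm_real] at h2)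
  have h3 : ∀ u, ∑' k, diracTerm hA f H k (u, u) c = dirac₂ hA f H (u, u) c := fun u =>
    (Pi.hasSum.1 (hasSum_dirac₂ hA hf hc (u, u)) c).tsum_eq
  simpa only [h3] using h1

/-- Both sides are the same polarized sum of moments: the left through time derivatives of the line
profile, the right through powers of a·x + i b·p. -/
theorem sum_integral_diracTerm_wignerTest (hf : f.Convergent) (g : Test2 D) (α β : ι × σ)
    (k : ℕ × ℕ) :
    ∑ κ : (ι × σ) × (ι × σ),
      ∫ u, diracTerm hA f (component κ.2 (wignerTest A g α κ.1 κ.2 β)) k (u, u) κ.1 =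
    (1 : Matrix ι ι ℂ) α.1 β.1 * ∫ z, symbolTerm f k z α.2 β.2 * phaseFn g z.1 z.2 := by
  have h1 : ∀ v (r : ℤ), Integrable fun u =>
      r • timeDeriv^[k.1 + k.2] (lineProfile g v) (u, 0) := fun v r =>
    (((spatiallyCompact_lineProfile g v).iterate (k.1 + k.2)).integrable_slice 0).smul r
  have h2 : ∀ (ν : Fin k.1 → Fin D) (μ : Fin k.2 → Fin D), Integrable fun u =>
      ∑ C : Finset (Fin (k.1 + k.2)), (-1 : ℤ) ^ C.card •
        timeDeriv^[k.1 + k.2] (lineProfile g (∑ i ∈ Cᶜ, letterVec ν μ i)) (u, 0) :=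
    fun ν μ => integrable_finsetSum _ fun C _ => h1 _ _
  rw [← integral_finsetSum _ fun κ _ => (hasSum_integral_diracTerm hA hf
    (hasCompactSupport_component κ.2 (wignerTest A g α κ.1 κ.2 β)) κ.1).1 k]
  simp only [sum_diracTerm_wignerTest]
  rw [integral_symbolTerm, integral_finsetSum _ fun ν _ => integrable_finsetSum _ fun μ _ =>
    (h2 ν μ).const_mul _, Finset.mul_sum]
  refine Finset.sum_congr rfl fun ν _ => ?_
  rw [integral_finsetSum _ fun μ _ => (h2 ν μ).const_mul _, Finset.mul_sum]
  refine Finset.sum_congr rfl fun μ _ => ?_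
  rw [integral_const_mul, integral_finsetSum _ fun C _ => h1 _ _, Matrix.kroneckerMap_apply,
    mul_assoc]
  congr 2
  refine Finset.sum_congr rfl fun C _ => ?_
  simp only [zsmul_eq_mul, integral_const_mul, integral_timeDeriv_lineProfile]

/-- The Weyl symbol of `Q̂` is the function `Q(x, p)`. -/
theorem wigner_diracKernel (hf : f.Convergent) :
    wigner A (diracKernel hA hf) =
      ofFun fun x p => (1 : Matrix ι ι ℂ) ⊗ₖ diracSymbol f x p := by
  funext Φ
  obtain ⟨g, rfl⟩ := exists_eq_phaseTest Φ
  ext α β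
  have h1 := hasSum_sum (s := Finset.univ) fun (κ : (ι × σ) × (ι × σ)) _ =>
    (hasSum_integral_diracTerm hA hf
      (hasCompactSupport_component κ.2 (wignerTest A g α κ.1 κ.2 β)) κ.1).2
  simp only [sum_integral_diracTerm_wignerTest hA hf] at h1
  have h2 := h1.unique ((hasSum_integral_symbolTerm hf g α.2 β.2).mul_left
    ((1 : Matrix ι ι ℂ) α.1 β.1))
  rw [Fintype.sum_prod_type] at h2
  rw [wigner_phaseTest]
  simp only [diracKernel_apply]
  rw [h2, ofFun, Matrix.of_apply, ← integral_const_mul]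
  congr 1
  funext z
  exact (mul_assoc _ _ _).symm

include hA in
/-- The Weyl symbol of the identity operator is the constant function `1`. -/
theorem wigner_deltaKernel :
    wigner A (deltaKernel D ι σ) = ofFun fun _ _ => 1 := by
  funext Φ
  obtain ⟨g, rfl⟩ := exists_eq_phaseTest Φ
  ext α β
  have h1 : ∀ u : E D, midDiff (u, u) = (u, 0) := fun u => by simpa using midDiff_line u 0 0
  have h2 : ∀ u : E D, (1 / 2 : ℝ) • (u + u) = u := fun u => congrArg Prod.fst (h1 u)
  have h3 : ∫ z : E D × E D, phaseFn g z.1 z.2 = ∫ u : E D, g (u, 0) := by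
    simpa [expMoment, linSymbol] using expMoment_zero g 0 0
  rw [wigner_phaseTest]
  simp only [deltaKernel_apply, deltaPairing, wignerTest_apply hA, h1, h2, wilson_self hA,
    Matrix.one_kronecker_one]
  rw [ofFun, Matrix.of_apply]
  change _ = ∫ z : E D × E D, (1 : Matrix (ι × σ) (ι × σ) ℂ) α β * phaseFn g z.1 z.2
  rw [integral_const_mul, h3, Finset.sum_eq_single α, Finset.sum_eq_single α]
  · simp [mul_comm _ ((1 : Matrix (ι × σ) (ι × σ) ℂ) α β), integral_const_mul]
  · intro d _ hd
    simp [hd.symm]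
  · simp
  · intro c _ hc
    simp [Matrix.one_apply_ne hc.symm]
  · simp

end WeylSymbols

end GaugeWigner

end

/-! ### The generalized Groenewold equation. -/

theorem theorem6 (D : ℕ) {ι σ : Type*} [Fintype ι] [DecidableEq ι] [Fintype σ] [DecidableEq σ]
    (A : Fin D → GaugeWigner.E D → Matrix ι ι ℂ)
    (hA_herm : ∀ μ x, (A μ x).IsHermitian)
    (hA_smooth : ∀ μ i j, ContDiff ℝ ((⊤ : ℕ∞) : WithTop ℕ∞) fun x => A μ x i j)
    (f : GaugeWigner.Coeffs D σ) (hf : f.Convergent)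
    (G : GaugeWigner.Kernel D ι σ) (hG : GaugeWigner.IsGreenFunction A f G) :
    GaugeWigner.starProd A (GaugeWigner.wigner A G)
        (GaugeWigner.ofFun fun x p => (1 : Matrix ι ι ℂ) ⊗ₖ GaugeWigner.diracSymbol f x p)
      = GaugeWigner.ofFun fun _ _ => 1 := by
  rw [← GaugeWigner.wigner_diracKernel hA_smooth hf]
  -- The star product is defined, so `starProd` does not take its default value 0: Ĝ and Q̂
  -- represent the two symbols and have the identity as product.
  have hex : ∃ c, GaugeWigner.IsStarProduct A (GaugeWigner.wigner A G)
      (GaugeWigner.wigner A (GaugeWigner.diracKernel hA_smooth hf)) c :=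
    ⟨_, G, _, _, rfl, rfl, GaugeWigner.isProduct_diracKernel hA_smooth hf hG, rfl⟩
  rw [GaugeWigner.starProd, dif_pos hex]
  -- The chosen value may come from other representatives; injectivity of the Wigner transform and
  -- uniqueness of the product force them to be Ĝ, Q̂ and 1.
  obtain ⟨X, Y, Z, hX, hY, hXYZ, hZ⟩ := hex.choose_spec
  obtain rfl := GaugeWigner.wigner_injective hA_smooth hX
  obtain rfl := GaugeWigner.wigner_injective hA_smooth hY
  rw [← hZ, GaugeWigner.eq_deltaKernel_of_isProduct hA_smooth hf hG hXYZ,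
    GaugeWigner.wigner_deltaKernel hA_smooth]
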